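/- For $\alpha,\lambda>0$ and $\beta\in(0,1)$ let $\mathrm{TS}_+(\alpha,\beta,\lambda)$ be the probability law on $[0,\infty)$ with characteristic function $u\mapsto\exp\left(\int_0^\infty (e^{iuy}-1)\,\alpha\, e^{-\lambda y}y^{-1-\beta}\,dy\right)$, let $\mathrm{TS}_-(\alpha,\beta,\lambda)$ be its image under $y\mapsto -y$, and let $$\mathrm{TS}(\alpha_+,\beta_+,\lambda_+,\alpha_-,\beta_-,\lambda_-)=\mathrm{TS}_+(\alpha_+,\beta_+,\lambda_+)\ast\mathrm{TS}_-(\alpha_-,\beta_-,\lambda_-).$$ Let $\alpha_\pm,\lambda_\pm>0$ and let $\beta_\pm\in(0,1)$ be irrational, such that $m\beta_++n\beta_-\notin\mathbb Z$ for all integers $m,n\ge 1$. Put $a_\pm=-\alpha_\pm\Gamma(-\beta_\pm)$, $\underline\lambda=\lambda_++\lambda_-$ and $\gamma=a_+\lambda_+^{\beta_+}+a_-\lambda_-^{\beta_-}$. Then the law $\mathrm{TS}(\alpha_+,\beta_+,\lambda_+,\alpha_-,\beta_-,\lambda_-)$ has a continuous density $f$ on $\mathbb R$, and for every $x>0$ $$f(x)=e^{\gamma-\lambda_+x}\sum_{(n_1,n_2,n_3)\in\mathbb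 N^3}\frac{(-1)^{n_1+n_2+n_3}a_+^{n_2}a_-^{n_3}}{n_1!\,n_2!\,n_3!}\left(d^{(1)}_{n}(x)+d^{(2)}_{n}(x)\right),$$ where $\mathbb N=\{0,1,2,\dots\}$, $n=(n_1,n_2,n_3)$ and $$d^{(1)}_{n}(x)=\frac{\Gamma(1-n_1+\beta_+n_2+\beta_-n_3)\,\Gamma(n_1-\beta_-n_3)}{\Gamma(1+\beta_+n_2)\,\Gamma(-\beta_+n_2)\,\Gamma(-\beta_-n_3)}\,\underline\lambda^{n_1}x^{-1+n_1-\beta_+n_2-\beta_-n_3},$$ $$d^{(2)}_{n}(x)=\frac{\Gamma(-1-n_1-\beta_+n_2-\beta_-n_3)\,\Gamma(1+n_1+\beta_+n_2)}{\Gamma(-\beta_+n_2)\,\Gamma(1+\beta_+n_2)\,\Gamma(-\beta_-n_3)}\,\underline\lambda^{1+n_1+\beta_+n_2+\beta_-n_3}x^{n_1}.$$ Here the quotient $\Gamma(n_1-\beta_-n_3)/\Gamma(-\beta_-n_3)$ is read as the Pochhammer symbol $(-\beta_-n_3)_{n_1}=\prod_{j=0}^{n_1-1}(j-\beta_-n_3)$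 (so it is $1$ for $n_1=0$), $1/\Gamma(0)=0$, and $d^{(1)}_n=d^{(2)}_n=0$ when $n_2=n_3=0$. The series is summed as follows: for all $n_2,n_3$ the sum over $n_1$ converges absolutely, and then so does the sum of the results over $(n_2,n_3)\in\mathbb N^2$. If moreover there are $c>0$ and $K\in\mathbb R$ with $|m\beta_++n\beta_--k|\ge c\,e^{-K(m+n)}$ for all integers $m,n\ge1$ and $k$, then the triple series converges absolutely over $\mathbb N^3$, to the same sum. For $x<0$ the same holds with $x$ replaced by $-x$ and the parameters $(\alpha_+,\beta_+,\lambda_+)$ and $(\alpha_-,\beta_-,\lambda_-)$ exchanged on the right-hand side. -/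

import Mathlib

open MeasureTheory

noncomputable section

/-- `μ` is the one-sided tempered stable law `TS₊(α, β, l)`: a probability law carried by `[0, ∞)`
whose characteristic function is `exp (∫ (e^{iux} - 1) ν(x) dx)` for the Lévy density
`ν(x) = α e^{-l x} / x^{1+β}` on `(0, ∞)`. -/
structure IsTSPlus (α β l : ℝ) (μ : Measure ℝ) : Prop where
  isProb : IsProbabilityMeasure μ
  support : μ (Set.Iio 0) = 0
  charFun_eq : ∀ u : ℝ, charFun μ u =
    Complex.exp (∫ x in Set.Ioi (0 : ℝ),
      (Complex.exp (Complex.I * u * x) - 1) *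
        ((α * (Real.exp (-l * x) / x ^ (1 + β)) : ℝ) : ℂ))

/-- `TS₋(α, β, l)`: the image of `TS₊(α, β, l)` under `x ↦ -x`. -/
def IsTSMinus (α β l : ℝ) (μ : Measure ℝ) : Prop :=
  ∃ ρ : Measure ℝ, IsTSPlus α β l ρ ∧ μ = ρ.map (fun x => -x)

/-- The double-sided law `TS(αp, βp, lp, αm, βm, lm) = TS₊(αp, βp, lp) ∗ TS₋(αm, βm, lm)`. -/
def IsTS (αp βp lp αm βm lm : ℝ) (μ : Measure ℝ) : Prop :=
  ∃ μp μm : Measure ℝ, IsTSPlus αp βp lp μp ∧ IsTSMinus αm βm lm μm ∧ μ = μp.conv μm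

/-- `f` is the continuous probability density of `μ` (there is at most one). -/
structure IsContinuousDensity (μ : Measure ℝ) (f : ℝ → ℝ) : Prop where
  continuous : Continuous f
  nonneg : ∀ x, 0 ≤ f x
  eq_withDensity : μ = volume.withDensity (fun x => ENNReal.ofReal (f x))

/-- The constant `a = -α Γ(-β)`. -/
def tsA (α β : ℝ) : ℝ := -α * Real.Gamma (-β)

/-- The constant `γ = a₊ lp^βp + a₋ lm^βm`. -/
def tsGamma (αp βp lp αm βm lm : ℝ) : ℝ :=
  tsA αp βp * lp ^ βp + tsA αm βm * lm ^ βm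

/-- The quotient `Γ(z + n) / Γ(z)`, continuously extended to its removable singularities
at `z = 0`: it is `1` for `n = 0`, and `Γ(n) / Γ(0)` is `0` for `n ≥ 1`, in accordance with
the convention `Real.Gamma 0 = 0`, `y / 0 = 0`. -/
def gammaQuot (z : ℝ) (n : ℕ) : ℝ :=
  if n = 0 then 1 else Real.Gamma (z + n) / Real.Gamma z

/-- The coefficient `d⁽¹⁾`, with `L = lp + lm`. The value `1 / Γ(0)` is `0`, and the quotient
`Γ(n₁ - βm n₃) / Γ(-βm n₃)` is read as `gammaQuot (-βm n₃) n₁`. -/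
def tsD1 (βp βm L : ℝ) (n₁ n₂ n₃ : ℕ) (x : ℝ) : ℝ :=
  Real.Gamma (1 - n₁ + βp * n₂ + βm * n₃) * gammaQuot (-(βm * n₃)) n₁ /
      (Real.Gamma (1 + βp * n₂) * Real.Gamma (-(βp * n₂))) *
    L ^ n₁ * x ^ (-1 + n₁ - βp * n₂ - βm * n₃)

/-- The coefficient `d⁽²⁾`, with `L = lp + lm` and `1 / Γ(0) = 0`. -/
def tsD2 (βp βm L : ℝ) (n₁ n₂ n₃ : ℕ) (x : ℝ) : ℝ :=
  Real.Gamma (-1 - n₁ - βp * n₂ - βm * n₃) * Real.Gamma (1 + n₁ + βp * n₂) /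
      (Real.Gamma (-(βp * n₂)) * Real.Gamma (1 + βp * n₂) * Real.Gamma (-(βm * n₃))) *
    L ^ (1 + n₁ + βp * n₂ + βm * n₃) * x ^ n₁

/-- The general term of the triple series. -/
def tsTerm (αp βp lp αm βm lm x : ℝ) (n₁ n₂ n₃ : ℕ) : ℝ :=
  (-1) ^ (n₁ + n₂ + n₃) * tsA αp βp ^ n₂ * tsA αm βm ^ n₃ /
      (n₁.factorial * n₂.factorial * n₃.factorial) *
    (tsD1 βp βm (lp + lm) n₁ n₂ n₃ x + tsD2 βp βm (lp + lm) n₁ n₂ n₃ x)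

/-- `∑_{(n₂, n₃)} (∑_{n₁} t n₁ n₂ n₃) = T`, all the sums being absolutely convergent. -/
def HasIteratedSum (t : ℕ → ℕ → ℕ → ℝ) (T : ℝ) : Prop :=
  ∃ S : ℕ × ℕ → ℝ,
    (∀ n₂ n₃ : ℕ, HasSum (fun n₁ => t n₁ n₂ n₃) (S (n₂, n₃))) ∧ HasSum S T

/-- `∑_{(n₁, n₂, n₃)} t n₁ n₂ n₃ = T`, absolutely convergent as a triple series. -/
def HasTripleSum (t : ℕ → ℕ → ℕ → ℝ) (T : ℝ) : Prop :=
  HasSum (fun n : ℕ × ℕ × ℕ => t n.1 n.2.1 n.2.2) T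

/-- The distance of `m βp + n βm` to the integers decays at most exponentially in `m + n`. -/
def NoSmallDivisors (βp βm : ℝ) : Prop :=
  ∃ c K : ℝ, 0 < c ∧ ∀ m n : ℕ, 1 ≤ m → 1 ≤ n → ∀ k : ℤ,
    c * Real.exp (-K * (m + n)) ≤ |m * βp + n * βm - k|

end

/-! Write a₊, a₋ for the two values of `tsA`, and L = lp + lm. The Lévy–Khintchine integral has a
closed form (`integral_levy_tempered_stable`). Consequently the Fourier inversion integrand at
frequency u is e^{γ - lp x} F(w) at w = lp - iu, where F(w) = exp(x w - a₊ w^βp - a₋ (L - w)^βm) is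
`tsF`. On this vertical line the factor with a₋ decays like exp(-κ|u|^βm), so the characteristic
function is integrable and `exists_continuousDensity` gives a continuous density by inversion.

F is analytic off the cuts (-∞, 0] and [L, ∞). For x > 0 the factor e^{xw} decays to the left, so
the upper half of the line can be rotated about lp onto the negative axis. Conjugation symmetry then
leaves -(1/π) ∫₀^∞ Im F(-s) ds (`integral_tsF_vertical`). On the upper edge of the cut w^βp is s^βp
e^{iπβp}, while (L - w)^βm is the positive number (L + s)^βm. Expanding both exponentials produces
the factors sin(π βp n₂), which the reflection formula turns into the Gamma quotients of the
theorem, times the integrals ∫ e^{-xs} s^b (L + s)^c ds with b = βp n₂ and c = βm n₃. Termwise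
integration is legitimate because even the series of absolute values has a finite integral: powers
below 1 lose against e^{-xs}. This is the outer sum over (n₂, n₃) (`hasSum_integral_im_tsF`).

For n₂, n₃ ≥ 1 the inner sum over n₁ is the connection formula for Tricomi's function
(`tricomiInt_eq_tsum`): when c and b + c are not integers, the integral is a power series in Lx plus
(Lx)^{1+b+c} times another one, and these two series are d⁽¹⁾ and d⁽²⁾. To prove it, the difference
of the two sides (`tricomiDefect`) is shown to inherit the derivative formula and the contiguity
relation of the integral. For -2 < b + c < -1 these form a linear system with an integrable
singularity at 0, whose only solution vanishing at 0 is zero (`eq_zero_of_singular_system`). Larger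
c follow by integrating upwards.

The Gamma factors of d⁽¹⁾ and d⁽²⁾ blow up as b + c approaches an integer, but their sum over n₁ is
an integral without poles; hence the iterated series needs no arithmetic condition beyond
non-integrality. For the triple series each term is estimated separately. If the distance of b + c
to the integers is at least E^{-(n₂+n₃)}, the loss is a power E^{2(n₂+n₃)}, which merely rescales a₊
and a₋ in a series already known to converge (`summable_tsTerm`). The case x < 0 is the case x > 0
for the reflected law. -/

section TemperedStable

open Set Filter Topology ProbabilityTheory

/-! ### Tricomi's integral: derivative, contiguity, behaviour at 0 -/

/-- The integral `∫₀^∞ e^{-s} s^b (z + s)^c ds`, a multiple of Tricomi's function. -/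
noncomputable def tricomiInt (b c z : ℝ) : ℝ :=
  ∫ s in Ioi (0 : ℝ), Real.exp (-s) * s ^ b * (z + s) ^ c

/-- Half of the decay of e^{-s} pays for the factor (z + s)^c; the other half keeps the integrals
convergent. -/
theorem exists_rpow_add_le_exp (c z : ℝ) (hz : 0 < z) :
    ∃ C : ℝ, ∀ s : ℝ, 0 < s → (z + s) ^ c ≤ C * Real.exp (s / 2) := by
  rcases le_or_gt c 0 with hc | hc
  · refine ⟨z ^ c, fun s hs => ?_⟩
    have h1 : (z + s) ^ c ≤ z ^ c := Real.rpow_le_rpow_of_nonpos hz (by linarith) hc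
    have h2 : (1 : ℝ) ≤ Real.exp (s / 2) := Real.one_le_exp (by linarith)
    have h3 : 0 ≤ z ^ c := by positivity
    nlinarith
  · set n := ⌈c⌉₊
    refine ⟨2 ^ n * n.factorial * Real.exp ((1 + z) / 2), fun s hs => ?_⟩
    have h1 : (z + s) ^ c ≤ (1 + z + s) ^ c :=
      Real.rpow_le_rpow (by linarith) (by linarith) hc.le
    have h2 : (1 + z + s) ^ c ≤ (1 + z + s) ^ (n : ℝ) :=
      Real.rpow_le_rpow_of_exponent_le (by linarith) (Nat.le_ceil c)
    rw [Real.rpow_natCast] at h2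
    have h3 := Real.pow_div_factorial_le_exp ((1 + z + s) / 2) (by linarith) n
    rw [div_le_iff₀ (by positivity), div_pow, div_le_iff₀ (by positivity)] at h3
    have h4 : Real.exp ((1 + z + s) / 2) = Real.exp ((1 + z) / 2) * Real.exp (s / 2) := by
      rw [← Real.exp_add]; ring_nf
    rw [h4] at h3
    linarith

theorem integrableOn_exp_mul_rpow {b r : ℝ} (hb : -1 < b) (hr : 0 < r) :
    IntegrableOn (fun s : ℝ => Real.exp (-(r * s)) * s ^ b) (Ioi 0) := by
  have h := integrableOn_rpow_mul_exp_neg_mul_rpow (p := 1) hb one_pos hr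
  refine h.congr_fun (fun s _ => ?_) measurableSet_Ioi
  simp only [Real.rpow_one]
  rw [mul_comm, neg_mul]

theorem integrableOn_tricomi {b : ℝ} (c : ℝ) {z : ℝ} (hb : -1 < b) (hz : 0 < z) :
    IntegrableOn (fun s : ℝ => Real.exp (-s) * s ^ b * (z + s) ^ c) (Ioi 0) := by
  obtain ⟨C, hC⟩ := exists_rpow_add_le_exp c z hz
  have h := (integrableOn_exp_mul_rpow hb (r := 1 / 2) (by norm_num)).const_mul C
  refine Integrable.mono' h (by fun_prop) ?_
  refine (ae_restrict_iff' measurableSet_Ioi).2 (Eventually.of_forall fun s hs => ?_)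
  have hs : 0 < s := hs
  have h1 := hC s hs
  have h2 : 0 < Real.exp (-s) * s ^ b := by positivity
  have h3 : 0 < (z + s) ^ c := by positivity
  rw [Real.norm_of_nonneg (by positivity)]
  have h4 : Real.exp (-(1 / 2 * s)) = Real.exp (-s) * Real.exp (s / 2) := by
    rw [← Real.exp_add]; ring_nf
  rw [h4]
  nlinarith

/-- A power is monotone in one direction or the other, so one of the two endpoint values dominates.
Taking their sum gives majorants that do not depend on the sign of the exponent. -/
theorem rpow_le_add_rpow {u v w : ℝ} (c : ℝ) (hu : 0 < u) (huv : u ≤ v) (hvw : v ≤ w) :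
    v ^ c ≤ u ^ c + w ^ c := by
  have h1 : 0 < u ^ c := by positivity
  have h2 : 0 < w ^ c := Real.rpow_pos_of_pos (by linarith) c
  rcases le_or_gt c 0 with hc | hc
  · have := Real.rpow_le_rpow_of_nonpos hu huv hc
    linarith
  · have := Real.rpow_le_rpow (by linarith) hvw hc.le
    linarith

theorem hasDerivAt_tricomiInt {b : ℝ} (c : ℝ) {z : ℝ} (hb : -1 < b) (hz : 0 < z) :
    HasDerivAt (tricomiInt b c) (c * tricomiInt b (c - 1) z) z := by
  have key := hasDerivAt_integral_of_dominated_loc_of_deriv_le (μ := volume.restrict (Ioi (0 : ℝ)))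
    (F := fun z s : ℝ => Real.exp (-s) * s ^ b * (z + s) ^ c)
    (F' := fun z s : ℝ => Real.exp (-s) * s ^ b * (c * (z + s) ^ (c - 1))) (x₀ := z)
    (s := Ioo (z / 2) (2 * z))
    (bound := fun s => |c| * (Real.exp (-s) * s ^ b * (z / 2 + s) ^ (c - 1)
      + Real.exp (-s) * s ^ b * (2 * z + s) ^ (c - 1)))
    (Ioo_mem_nhds (by linarith) (by linarith)) ?_ ?_ ?_ ?_ ?_ ?_
  · refine key.2.congr_deriv ?_
    rw [tricomiInt, ← integral_const_mul]
    congr 1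
    ext s
    ring
  · exact Eventually.of_forall fun _ => by fun_prop
  · exact integrableOn_tricomi c hb hz
  · fun_prop
  · refine (ae_restrict_iff' measurableSet_Ioi).2 (Eventually.of_forall fun s hs y hy => ?_)
    have hs : 0 < s := hs
    have hy0 : 0 < y := by linarith [hy.1]
    have h2 : 0 < Real.exp (-s) * s ^ b := by positivity
    have h3 := rpow_le_add_rpow (c - 1) (u := z / 2 + s) (v := y + s) (w := 2 * z + s)
      (by linarith) (by linarith [hy.1]) (by linarith [hy.2])
    have h4 : 0 < (y + s) ^ (c - 1) := by positivity
    rw [norm_mul, Real.norm_of_nonneg h2.le, norm_mul, Real.norm_of_nonneg h4.le, Real.norm_eq_abs]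
    have := mul_le_mul_of_nonneg_left h3 h2.le
    have := mul_le_mul_of_nonneg_left this (abs_nonneg c)
    linarith
  · exact ((integrableOn_tricomi (c - 1) hb (by linarith)).add
      (integrableOn_tricomi (c - 1) hb (by linarith))).const_mul _
  · refine (ae_restrict_iff' measurableSet_Ioi).2 (Eventually.of_forall fun s hs y hy => ?_)
    have hs : 0 < s := hs
    have hy0 : 0 < y := by linarith [hy.1]
    have := ((hasDerivAt_id y).add_const s).rpow_const (p := c) (Or.inl (by simp; linarith))
    simp only [id, one_mul] at this
    exact this.const_mul _

theorem tricomiInt_add_one {b : ℝ} (c : ℝ) {z : ℝ} (hb : -1 < b) (hz : 0 < z) :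
    tricomiInt b (c + 1) z = z * tricomiInt b c z + tricomiInt (b + 1) c z := by
  rw [tricomiInt, tricomiInt, tricomiInt, ← integral_const_mul, ← integral_add
    ((integrableOn_tricomi c hb hz).const_mul z) (integrableOn_tricomi c (by linarith) hz)]
  refine setIntegral_congr_fun measurableSet_Ioi fun s hs => ?_
  have hs : 0 < s := hs
  rw [Real.rpow_add_one (by positivity), Real.rpow_add_one (by positivity)]
  ring

/-- Integration by parts: the integral of the derivative of e^{-s} s^{b+1} (z + s)^c is zero, the
boundary term at 0 vanishing because b + 1 > 0. -/
theorem tricomiInt_parts {b : ℝ} (c : ℝ) {z : ℝ} (hb : -1 < b) (hz : 0 < z) :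
    tricomiInt (b + 1) c z = (b + 1) * tricomiInt b c z + c * tricomiInt (b + 1) (c - 1) z := by
  have i1 := (integrableOn_tricomi c hb hz).const_mul (b + 1)
  have i2 := (integrableOn_tricomi (c - 1) (b := b + 1) (by linarith) hz).const_mul c
  have i3 := integrableOn_tricomi c (b := b + 1) (by linarith) hz
  have key := integral_Ioi_of_hasDerivAt_of_tendsto (a := (0 : ℝ)) (m := 0)
    (f := fun s => Real.exp (-s) * s ^ (b + 1) * (z + s) ^ c)
    (f' := fun s => (b + 1) * (Real.exp (-s) * s ^ b * (z + s) ^ c)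
      + c * (Real.exp (-s) * s ^ (b + 1) * (z + s) ^ (c - 1))
      - Real.exp (-s) * s ^ (b + 1) * (z + s) ^ c) ?_ ?_ ((i1.add i2).sub i3) ?_
  · have e1 := integral_sub (i1.add i2) i3
    have e2 := integral_add i1 i2
    simp only [Pi.add_apply] at e1
    rw [e1, e2, integral_const_mul, integral_const_mul] at key
    have h0 : (0 : ℝ) ^ (b + 1) = 0 := Real.zero_rpow (by linarith)
    simp only [h0, mul_zero, zero_mul, sub_zero] at key
    unfold tricomiInt
    linarith
  · refine ContinuousAt.continuousWithinAt ?_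
    refine ContinuousAt.mul (ContinuousAt.mul (by fun_prop) ?_) ?_
    · exact Real.continuousAt_rpow_const _ _ (Or.inr (by linarith))
    · exact ContinuousAt.rpow_const (by fun_prop) (Or.inl (by simp; linarith))
  · intro s hs
    have hs : 0 < s := hs
    have d1 : HasDerivAt (fun s : ℝ => Real.exp (-s)) (-Real.exp (-s)) s := by
      simpa using (hasDerivAt_neg s).exp
    have d2 := (hasDerivAt_id s).rpow_const (p := b + 1) (Or.inl hs.ne')
    have d3 := ((hasDerivAt_id s).const_add z).rpow_const (p := c) (Or.inl (by simp; linarith))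
    refine ((d1.mul d2).mul d3).congr_deriv ?_
    simp only [id, Pi.mul_apply, add_sub_cancel_right]
    ring
  · obtain ⟨C, hC⟩ := exists_rpow_add_le_exp c z hz
    have h0 := (tendsto_rpow_mul_exp_neg_mul_atTop_nhds_zero (b + 1) (1 / 2)
      (by norm_num)).const_mul C
    rw [mul_zero] at h0
    refine squeeze_zero' ?_ ?_ h0
    · filter_upwards [eventually_gt_atTop 0] with s hs
      positivity
    · filter_upwards [eventually_gt_atTop 0] with s hs
      have h1 := hC s hs
      have h4 : Real.exp (-(1 / 2) * s) = Real.exp (-s) * Real.exp (s / 2) := by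
        rw [← Real.exp_add]; ring_nf
      have h2 : 0 < Real.exp (-s) * s ^ (b + 1) := by positivity
      rw [h4]
      nlinarith

/-- The contiguity relation that is equivalent to Kummer's equation. -/
theorem tricomiInt_contiguous {b : ℝ} (c : ℝ) {z : ℝ} (hb : -1 < b) (hz : 0 < z) :
    z * (c * tricomiInt b (c - 1) z) =
      (b + 1 + c) * tricomiInt b c z - tricomiInt b (c + 1) z + z * tricomiInt b c z := by
  have h1 := tricomiInt_add_one c hb hz
  have h2 := tricomiInt_add_one (c - 1) hb hz
  have h3 := tricomiInt_parts c hb hz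
  rw [sub_add_cancel] at h2
  have h4 : c * tricomiInt (b + 1) (c - 1) z =
      c * tricomiInt b c z - z * (c * tricomiInt b (c - 1) z) := by rw [h2]; ring
  linarith

/-- In the range b + c > -1 the integrand remains integrable at z = 0, where it becomes the
integrand of Γ(1 + b + c). -/
theorem tendsto_tricomiInt_zero {b c : ℝ} (hb : -1 < b) (hbc : -1 < b + c) :
    Tendsto (tricomiInt b c) (𝓝[>] 0) (𝓝 (Real.Gamma (1 + b + c))) := by
  have hG : Real.Gamma (1 + b + c) = ∫ s in Ioi (0 : ℝ), Real.exp (-s) * s ^ b * s ^ c := by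
    rw [Real.Gamma_eq_integral (by linarith)]
    refine setIntegral_congr_fun measurableSet_Ioi fun s hs => ?_
    have hs : 0 < s := hs
    rw [mul_assoc, ← Real.rpow_add hs]
    ring_nf
  rw [hG]
  refine tendsto_integral_filter_of_dominated_convergence
    (fun s => Real.exp (-s) * s ^ b * s ^ c + Real.exp (-s) * s ^ b * (1 + s) ^ c) ?_ ?_ ?_ ?_
  · exact Eventually.of_forall fun _ => by fun_prop
  · filter_upwards [Ioo_mem_nhdsGT (zero_lt_one' ℝ)] with z hz
    refine (ae_restrict_iff' measurableSet_Ioi).2 (Eventually.of_forall fun s hs => ?_)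
    have hs : 0 < s := hs
    have hz0 := hz.1
    rw [Real.norm_of_nonneg (by positivity), ← mul_add]
    exact mul_le_mul_of_nonneg_left
      (rpow_le_add_rpow c hs (by linarith) (by linarith [hz.2])) (by positivity)
  · refine Integrable.add ?_ (integrableOn_tricomi c hb one_pos)
    refine (integrableOn_exp_mul_rpow hbc one_pos).congr_fun (fun s hs => ?_) measurableSet_Ioi
    have hs : 0 < s := hs
    simp only
    rw [one_mul, mul_assoc, ← Real.rpow_add hs]
  · refine (ae_restrict_iff' measurableSet_Ioi).2 (Eventually.of_forall fun s hs => ?_)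
    have hs : 0 < s := hs
    refine Tendsto.const_mul _ (tendsto_nhdsWithin_of_tendsto_nhds ?_)
    have : ContinuousAt (fun z : ℝ => (z + s) ^ c) 0 :=
      ContinuousAt.rpow_const (by fun_prop) (Or.inl (by simp; linarith))
    simpa using this.tendsto

theorem integrableOn_rpow_mul_one_add_rpow {b c : ℝ} (hb : -1 < b) (hbc : b + c < -1) :
    IntegrableOn (fun t : ℝ => t ^ b * (1 + t) ^ c) (Ioi 0) := by
  rw [← Ioc_union_Ioi_eq_Ioi (zero_le_one' ℝ)]
  have hc : c ≤ 0 := by linarith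
  refine IntegrableOn.union ?_ ?_
  · have h : IntegrableOn (fun t : ℝ => t ^ b) (Ioc 0 1) :=
      (intervalIntegrable_iff_integrableOn_Ioc_of_le zero_le_one).1
        (intervalIntegral.intervalIntegrable_rpow' hb)
    refine Integrable.mono' h (by fun_prop) ?_
    refine (ae_restrict_iff' measurableSet_Ioc).2 (Eventually.of_forall fun t ht => ?_)
    have ht0 : 0 < t := ht.1
    rw [Real.norm_of_nonneg (by positivity)]
    exact mul_le_of_le_one_right (by positivity)
      (Real.rpow_le_one_of_one_le_of_nonpos (by linarith) hc)
  · have h : IntegrableOn (fun t : ℝ => t ^ (b + c)) (Ioi 1) :=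
      integrableOn_Ioi_rpow_of_lt hbc one_pos
    refine Integrable.mono' h (by fun_prop) ?_
    refine (ae_restrict_iff' measurableSet_Ioi).2 (Eventually.of_forall fun t ht => ?_)
    have ht0 : 0 < t := lt_trans one_pos ht
    rw [Real.norm_of_nonneg (by positivity), Real.rpow_add ht0]
    exact mul_le_mul_of_nonneg_left (Real.rpow_le_rpow_of_nonpos ht0 (by linarith) hc)
      (by positivity)

/-- The Beta integral over the half-line. -/
theorem integral_rpow_mul_one_add_rpow {b c : ℝ} (hb : -1 < b) (hbc : b + c < -1) :
    ∫ t in Ioi (0 : ℝ), t ^ b * (1 + t) ^ c =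
      Real.Gamma (1 + b) * Real.Gamma (-1 - b - c) / Real.Gamma (-c) := by
  have hc : 0 < -c := by linarith
  have hG : 0 < Real.Gamma (-c) := Real.Gamma_pos_of_pos hc
  rw [eq_div_iff hG.ne', ← integral_mul_const]
  have inner1 : ∀ t ∈ Ioi (0 : ℝ), ∫ u in Ioi (0 : ℝ),
      t ^ b * (u ^ (-c - 1) * Real.exp (-((1 + t) * u))) =
        t ^ b * (1 + t) ^ c * Real.Gamma (-c) := by
    intro t ht
    have ht : 0 < t := ht
    rw [integral_const_mul, Real.integral_rpow_mul_exp_neg_mul_Ioi hc (by linarith), one_div,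
      Real.inv_rpow (by linarith), Real.rpow_neg (by linarith), inv_inv, mul_assoc]
  have inner2 : ∀ u ∈ Ioi (0 : ℝ), ∫ t in Ioi (0 : ℝ),
      t ^ b * (u ^ (-c - 1) * Real.exp (-((1 + t) * u))) =
        Real.Gamma (1 + b) * (Real.exp (-u) * u ^ (-1 - b - c - 1)) := by
    intro u hu
    have hu : 0 < u := hu
    have h1 : ∀ t : ℝ, t ^ b * (u ^ (-c - 1) * Real.exp (-((1 + t) * u))) =
        (u ^ (-c - 1) * Real.exp (-u)) * (t ^ (1 + b - 1) * Real.exp (-(u * t))) := by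
      intro t
      rw [show -((1 + t) * u) = -u + -(u * t) by ring, Real.exp_add, add_sub_cancel_left]
      ring
    simp_rw [h1]
    rw [integral_const_mul, Real.integral_rpow_mul_exp_neg_mul_Ioi (by linarith) hu, one_div,
      Real.inv_rpow hu.le, ← Real.rpow_neg hu.le,
      show (-1 - b - c - 1) = (-c - 1) + -(1 + b) by ring, Real.rpow_add hu]
    ring
  rw [← setIntegral_congr_fun measurableSet_Ioi inner1, integral_integral_swap,
    setIntegral_congr_fun measurableSet_Ioi inner2, integral_const_mul,
    ← Real.Gamma_eq_integral (by linarith)]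
  rw [integrable_prod_iff]
  · constructor
    · refine (ae_restrict_iff' measurableSet_Ioi).2 (Eventually.of_forall fun t ht => ?_)
      have ht : 0 < t := ht
      have h : IntegrableOn (fun u : ℝ => u ^ (-c - 1) * Real.exp (-((1 + t) * u))) (Ioi 0) :=
        (integrableOn_exp_mul_rpow (b := -c - 1) (r := 1 + t) (by linarith)
          (by linarith)).congr_fun (fun u _ => mul_comm _ _) measurableSet_Ioi
      exact Integrable.const_mul h (t ^ b)
    · have h := (integrableOn_rpow_mul_one_add_rpow hb hbc).mul_const (Real.Gamma (-c))
      refine IntegrableOn.congr_fun h (fun t ht => ?_) measurableSet_Ioi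
      rw [← inner1 t ht]
      refine setIntegral_congr_fun measurableSet_Ioi fun u hu => ?_
      have hu : 0 < u := hu
      have ht : 0 < t := ht
      simp only [Function.uncurry]
      rw [Real.norm_of_nonneg (by positivity)]
  · exact Measurable.aestronglyMeasurable (by unfold Function.uncurry; fun_prop)

/-- The substitution s = zt exhibits the power z^{1+b+c} that governs the singular part. -/
theorem tricomiInt_eq_scaled (b c : ℝ) {z : ℝ} (hz : 0 < z) :
    tricomiInt b c z =
      z ^ (1 + b + c) * ∫ t in Ioi (0 : ℝ), Real.exp (-(z * t)) * (t ^ b * (1 + t) ^ c) := by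
  have h := integral_comp_mul_left_Ioi (fun s : ℝ => Real.exp (-s) * s ^ b * (z + s) ^ c) 0 hz
  rw [mul_zero, smul_eq_mul] at h
  have h2 : tricomiInt b c z = z * ∫ t in Ioi (0 : ℝ),
      Real.exp (-(z * t)) * (z * t) ^ b * (z + z * t) ^ c := by
    rw [h, ← mul_assoc, mul_inv_cancel₀ hz.ne', one_mul, tricomiInt]
  rw [h2, ← integral_const_mul, ← integral_const_mul]
  refine setIntegral_congr_fun measurableSet_Ioi fun t ht => ?_
  have ht : 0 < t := ht
  rw [show z + z * t = z * (1 + t) by ring, Real.mul_rpow hz.le ht.le,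
    Real.mul_rpow hz.le (by linarith), Real.rpow_add hz, Real.rpow_add hz, Real.rpow_one]
  ring

/-- In the range b + c < -1 the singular part dominates at 0, and its leading coefficient is a Beta
integral. -/
theorem tendsto_rpow_mul_tricomiInt_zero {b c : ℝ} (hb : -1 < b) (hbc : b + c < -1) :
    Tendsto (fun z => z ^ (-(1 + b + c)) * tricomiInt b c z) (𝓝[>] 0)
      (𝓝 (Real.Gamma (1 + b) * Real.Gamma (-1 - b - c) / Real.Gamma (-c))) := by
  rw [← integral_rpow_mul_one_add_rpow hb hbc]
  have key : Tendsto (fun z : ℝ => ∫ t in Ioi (0 : ℝ),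
      Real.exp (-(z * t)) * (t ^ b * (1 + t) ^ c)) (𝓝[>] 0)
      (𝓝 (∫ t in Ioi (0 : ℝ), t ^ b * (1 + t) ^ c)) := by
    refine tendsto_integral_filter_of_dominated_convergence (fun t => t ^ b * (1 + t) ^ c)
      (Eventually.of_forall fun _ => by fun_prop) ?_ (integrableOn_rpow_mul_one_add_rpow hb hbc) ?_
    · filter_upwards [self_mem_nhdsWithin] with z hz
      have hz : 0 < z := hz
      refine (ae_restrict_iff' measurableSet_Ioi).2 (Eventually.of_forall fun t ht => ?_)
      have ht : 0 < t := ht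
      rw [Real.norm_of_nonneg (by positivity)]
      exact mul_le_of_le_one_left (by positivity) (Real.exp_le_one_iff.2 (by nlinarith))
    · refine Eventually.of_forall fun t => tendsto_nhdsWithin_of_tendsto_nhds ?_
      have : ContinuousAt (fun z : ℝ => Real.exp (-(z * t)) * (t ^ b * (1 + t) ^ c)) 0 := by
        fun_prop
      simpa using this.tendsto
  refine key.congr' ?_
  filter_upwards [self_mem_nhdsWithin] with z hz
  have hz : 0 < z := hz
  rw [tricomiInt_eq_scaled b c hz, ← mul_assoc, ← Real.rpow_add hz, neg_add_cancel, Real.rpow_zero,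
    one_mul]

/-! ### Everywhere convergent power series -/

/-- Since n + 1 ≤ 2^{n+1}, the differentiated series at radius R is dominated by the original one at
radius 2R; everywhere convergence makes this affordable. -/
theorem norm_succ_mul_pow_le (a r : ℝ) (n : ℕ) {R : ℝ} (hR : 1 ≤ R) (hr : |r| ≤ R) :
    ‖((n : ℝ) + 1) * a * r ^ n‖ ≤ ‖a * (2 * R) ^ (n + 1)‖ := by
  rw [norm_mul, norm_mul, norm_mul, norm_pow, norm_pow, Real.norm_eq_abs r,
    Real.norm_of_nonneg (by positivity : (0 : ℝ) ≤ n + 1),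
    Real.norm_of_nonneg (by linarith : 0 ≤ 2 * R), mul_pow]
  have h1 : |r| ^ n ≤ R ^ (n + 1) :=
    (pow_le_pow_left₀ (abs_nonneg r) hr _).trans (pow_le_pow_right₀ hR (Nat.le_succ _))
  have h2 : (n : ℝ) + 1 ≤ 2 ^ (n + 1) := by exact_mod_cast Nat.lt_two_pow_self.le
  calc ((n : ℝ) + 1) * ‖a‖ * |r| ^ n = ‖a‖ * (((n : ℝ) + 1) * |r| ^ n) := by ring
    _ ≤ ‖a‖ * (2 ^ (n + 1) * R ^ (n + 1)) := by gcongr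

theorem summable_succ_mul_pow {a : ℕ → ℝ} (ha : ∀ r : ℝ, Summable fun n => a n * r ^ n) (r : ℝ) :
    Summable fun n : ℕ => ((n : ℝ) + 1) * a (n + 1) * r ^ n := by
  have hu := (summable_nat_add_iff 1).2 (ha (2 * max 1 |r|)).norm
  exact Summable.of_norm_bounded hu fun n =>
    norm_succ_mul_pow_le _ r n (le_max_left _ _) (le_max_right _ _)

theorem summable_nat_mul_pow {a : ℕ → ℝ} (ha : ∀ r : ℝ, Summable fun n => a n * r ^ n) (r : ℝ) :
    Summable fun n : ℕ => (n : ℝ) * a n * r ^ n := by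
  rw [← summable_nat_add_iff 1]
  refine ((summable_succ_mul_pow ha r).mul_left r).congr fun n => ?_
  push_cast
  ring

theorem mul_tsum_succ_mul_pow {a : ℕ → ℝ} (ha : ∀ r : ℝ, Summable fun n => a n * r ^ n) (r : ℝ) :
    r * ∑' n : ℕ, ((n : ℝ) + 1) * a (n + 1) * r ^ n = ∑' n : ℕ, (n : ℝ) * a n * r ^ n := by
  rw [(summable_nat_mul_pow ha r).tsum_eq_zero_add, ← tsum_mul_left]
  simp only [Nat.cast_zero, zero_mul, zero_add]
  refine tsum_congr fun n => ?_
  push_cast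
  ring

theorem hasDerivAt_tsum_pow {a : ℕ → ℝ} (ha : ∀ r : ℝ, Summable fun n => a n * r ^ n) (z : ℝ) :
    HasDerivAt (fun z => ∑' n, a n * z ^ n) (∑' n : ℕ, ((n : ℝ) + 1) * a (n + 1) * z ^ n) z := by
  set r := |z| + 1 with hr
  have hr0 : 1 ≤ r := by have := abs_nonneg z; linarith
  have hu : Summable fun n => ‖a (n + 1) * (2 * r) ^ (n + 1)‖ :=
    (summable_nat_add_iff 1).2 (ha _).norm
  have key := hasDerivAt_tsum_of_isPreconnected (g := fun n z => a (n + 1) * z ^ (n + 1))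
    (g' := fun n z => ((n : ℝ) + 1) * a (n + 1) * z ^ n) hu Metric.isOpen_ball
    (convex_ball (0 : ℝ) r).isPreconnected (fun n y _ => ?_) ?_
    (y₀ := z) (y := z) (by simp [hr]) ((summable_nat_add_iff 1).2 (ha z)) (by simp [hr])
  · refine (key.const_add (a 0 * z ^ 0)).congr_of_eventuallyEq (Eventually.of_forall fun y => ?_)
    simp only
    rw [(ha y).tsum_eq_zero_add, pow_zero, pow_zero]
  · refine ((hasDerivAt_pow (n + 1) y).const_mul _).congr_deriv ?_
    push_cast
    ring
  · intro n y hy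
    have hy : |y| < r := by simpa using hy
    exact norm_succ_mul_pow_le _ _ _ hr0 hy.le

theorem tendsto_tsum_pow_zero {a : ℕ → ℝ} (ha : ∀ r : ℝ, Summable fun n => a n * r ^ n) :
    Tendsto (fun z => ∑' n, a n * z ^ n) (𝓝[>] 0) (𝓝 (a 0)) := by
  have h := (hasDerivAt_tsum_pow ha 0).continuousAt.tendsto
  have h0 : ∑' n, a n * (0 : ℝ) ^ n = a 0 := by
    rw [tsum_eq_single 0 (fun n hn => by simp [hn])]
    simp
  rw [h0] at h
  exact tendsto_nhdsWithin_of_tendsto_nhds h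

theorem summable_pow_of_ratio {a : ℕ → ℝ} (ha : ∀ n, a n ≠ 0)
    (h : Tendsto (fun n => ‖a (n + 1)‖ / ‖a n‖) atTop (𝓝 0)) (r : ℝ) :
    Summable fun n => a n * r ^ n := by
  rcases eq_or_ne r 0 with rfl | hr
  · refine summable_of_ne_finset_zero (s := {0}) fun n hn => ?_
    have : n ≠ 0 := by simpa using hn
    simp [this]
  · refine summable_of_ratio_test_tendsto_lt_one (l := 0) one_pos
      (Eventually.of_forall fun n => mul_ne_zero (ha n) (pow_ne_zero _ hr)) ?_
    have := h.mul_const |r|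
    rw [zero_mul] at this
    refine this.congr fun n => ?_
    have h1 := norm_ne_zero_iff.2 (ha n)
    have h2 : |r| ≠ 0 := abs_ne_zero.2 hr
    rw [norm_mul, norm_mul, norm_pow, norm_pow, Real.norm_eq_abs r, pow_succ]
    field_simp

/-! ### The two coefficient sequences and their recurrences -/

/-- Power series coefficients of the part of `tricomiInt b c` that is regular at `0`. -/
noncomputable def tricomiCoeffReg (b c : ℝ) (n : ℕ) : ℝ :=
  Real.Gamma (1 + c) * Real.Gamma (1 + b + c - n) / (n.factorial * Real.Gamma (1 + c - n))

/-- Power series coefficients of the part of `tricomiInt b c` that is singular at `0`,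
divided by `z ^ (1 + b + c)`. -/
noncomputable def tricomiCoeffSing (b c : ℝ) (n : ℕ) : ℝ :=
  (-1) ^ n * Real.Gamma (-1 - n - b - c) * Real.Gamma (1 + n + b) /
    (Real.Gamma (-c) * n.factorial)

/-- `c` is not an integer. -/
def NotInt (c : ℝ) : Prop := ∀ k : ℤ, c ≠ k

theorem NotInt.add_int {c : ℝ} (h : NotInt c) (k : ℤ) : NotInt (c + k) := fun m hm =>
  h (m - k) (by push_cast; linarith)

theorem NotInt.int_sub {c : ℝ} (h : NotInt c) (k : ℤ) : NotInt (k - c) := fun m hm =>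
  h (k - m) (by push_cast; linarith)

theorem NotInt.ne_zero {c : ℝ} (h : NotInt c) : c ≠ 0 := by simpa using h 0

theorem NotInt.Gamma_ne_zero {c : ℝ} (h : NotInt c) : Real.Gamma c ≠ 0 :=
  Real.Gamma_ne_zero fun m => by simpa using h (-m)

theorem NotInt.add_one {c : ℝ} (h : NotInt c) : NotInt (c + 1) := by simpa using h.add_int 1

theorem NotInt.sub_one {c : ℝ} (h : NotInt c) : NotInt (c - 1) := by
  simpa [sub_eq_add_neg] using h.add_int (-1)

theorem NotInt.add_int' {c : ℝ} (h : NotInt c) {d : ℝ} (k : ℤ) (hd : d = c + k) : NotInt d :=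
  hd ▸ h.add_int k

theorem NotInt.int_sub' {c : ℝ} (h : NotInt c) {d : ℝ} (k : ℤ) (hd : d = k - c) : NotInt d :=
  hd ▸ h.int_sub k

section coefficients

variable {b c : ℝ}

theorem tricomiCoeffReg_zero (hc : NotInt c) : tricomiCoeffReg b c 0 = Real.Gamma (1 + b + c) := by
  have h : Real.Gamma (1 + c) ≠ 0 := (hc.add_int' 1 (by push_cast; ring)).Gamma_ne_zero
  simp only [tricomiCoeffReg, Nat.factorial_zero, Nat.cast_zero, sub_zero, Nat.cast_one, one_mul]
  field_simp

/-- Coefficient form of the derivative formula `hasDerivAt_tricomiInt`: differentiating lowers c by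
one and multiplies by c. -/
theorem succ_mul_tricomiCoeffReg (hc : NotInt c) (n : ℕ) :
    ((n : ℝ) + 1) * tricomiCoeffReg b c (n + 1) = c * tricomiCoeffReg b (c - 1) n := by
  have h1 : Real.Gamma (1 + c) = c * Real.Gamma c := by
    rw [add_comm, Real.Gamma_add_one hc.ne_zero]
  have h2 : Real.Gamma (c - n) ≠ 0 :=
    (hc.add_int' (-n) (by push_cast; ring)).Gamma_ne_zero
  simp only [tricomiCoeffReg, Nat.factorial_succ, Nat.cast_mul, Nat.cast_add, Nat.cast_one]
  rw [h1, show 1 + b + c - ((n : ℝ) + 1) = b + c - n by ring,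
    show 1 + c - ((n : ℝ) + 1) = c - n by ring, show 1 + (c - 1) = c by ring,
    show 1 + b + (c - 1) - (n : ℝ) = b + c - n by ring]
  field_simp

theorem tricomiCoeffReg_succ (hc : NotInt c) (hbc : NotInt (b + c)) (n : ℕ) :
    tricomiCoeffReg b c (n + 1) =
      tricomiCoeffReg b c n * ((c - n) / (((n : ℝ) + 1) * (b + c - n))) := by
  have hcn := hc.add_int' (d := c - n) (-n) (by push_cast; ring)
  have hbcn := hbc.add_int' (d := b + c - n) (-n) (by push_cast; ring)
  have h1 : Real.Gamma (1 + c - n) = (c - n) * Real.Gamma (c - n) := by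
    rw [← Real.Gamma_add_one hcn.ne_zero]; congr 1; ring
  have h2 : Real.Gamma (1 + b + c - n) = (b + c - n) * Real.Gamma (b + c - n) := by
    rw [← Real.Gamma_add_one hbcn.ne_zero]; congr 1; ring
  have h3 := hcn.Gamma_ne_zero
  have h4 := hcn.ne_zero
  have h5 := hbcn.ne_zero
  simp only [tricomiCoeffReg, Nat.factorial_succ, Nat.cast_mul, Nat.cast_add, Nat.cast_one]
  rw [h1, h2, show 1 + b + c - ((n : ℝ) + 1) = b + c - n by ring,
    show 1 + c - ((n : ℝ) + 1) = c - n by ring]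
  field_simp

theorem tricomiCoeffReg_ne_zero (hc : NotInt c) (hbc : NotInt (b + c)) (n : ℕ) :
    tricomiCoeffReg b c n ≠ 0 := by
  have h1 := (hc.add_int' (d := 1 + c - n) (1 - n) (by push_cast; ring)).Gamma_ne_zero
  have h2 := (hbc.add_int' (d := 1 + b + c - n) (1 - n) (by push_cast; ring)).Gamma_ne_zero
  have h3 := (hc.add_int' (d := 1 + c) 1 (by push_cast; ring)).Gamma_ne_zero
  have h4 : (n.factorial : ℝ) ≠ 0 := by positivity
  exact div_ne_zero (mul_ne_zero h3 h2) (mul_ne_zero h4 h1)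

theorem tricomiCoeffReg_zero_contiguous (hc : NotInt c) (hbc : NotInt (b + c)) :
    (b + 1 + c) * tricomiCoeffReg b c 0 = tricomiCoeffReg b (c + 1) 0 := by
  rw [tricomiCoeffReg_zero hc, tricomiCoeffReg_zero hc.add_one,
    show 1 + b + (c + 1) = (1 + b + c) + 1 by ring, Real.Gamma_add_one]
  · ring
  · exact (hbc.add_int' (d := 1 + b + c) 1 (by push_cast; ring)).ne_zero

/-- The coefficient of z^{n+1} in the relation `tricomiInt_contiguous`;
`tricomiCoeffReg_zero_contiguous` is its constant term. -/
theorem tricomiCoeffReg_contiguous (hc : NotInt c) (hbc : NotInt (b + c)) (n : ℕ) :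
    (n + 1 : ℝ) * tricomiCoeffReg b c (n + 1) - (b + 1 + c) * tricomiCoeffReg b c (n + 1)
      + tricomiCoeffReg b (c + 1) (n + 1) = tricomiCoeffReg b c n := by
  have hcn := hc.add_int' (d := c - n) (-n) (by push_cast; ring)
  have hbcn := hbc.add_int' (d := b + c - n) (-n) (by push_cast; ring)
  have h1 : Real.Gamma (1 + c - n) = (c - n) * Real.Gamma (c - n) := by
    rw [← Real.Gamma_add_one hcn.ne_zero]; congr 1; ring
  have h2 : Real.Gamma (1 + b + c - n) = (b + c - n) * Real.Gamma (b + c - n) := by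
    rw [← Real.Gamma_add_one hbcn.ne_zero]; congr 1; ring
  have h6 : Real.Gamma (1 + (c + 1)) = (1 + c) * Real.Gamma (1 + c) := by
    rw [← Real.Gamma_add_one (hc.add_int' (d := 1 + c) 1 (by push_cast; ring)).ne_zero]
    congr 1; ring
  have h3 := hcn.Gamma_ne_zero
  have h4 := hcn.ne_zero
  simp only [tricomiCoeffReg, Nat.factorial_succ, Nat.cast_mul, Nat.cast_add, Nat.cast_one]
  rw [h6, show 1 + b + c - ((n : ℝ) + 1) = b + c - n by ring,
    show 1 + c - ((n : ℝ) + 1) = c - n by ring,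
    show 1 + b + (c + 1) - ((n : ℝ) + 1) = 1 + b + c - n by ring,
    show 1 + (c + 1) - ((n : ℝ) + 1) = 1 + c - n by ring, h1, h2]
  field_simp
  ring

theorem tricomiCoeffSing_zero :
    tricomiCoeffSing b c 0 = Real.Gamma (1 + b) * Real.Gamma (-1 - b - c) / Real.Gamma (-c) := by
  simp [tricomiCoeffSing, mul_comm]

theorem Gamma_neg_sub_one (hc : NotInt c) : Real.Gamma (-c) = (-c - 1) * Real.Gamma (-c - 1) := by
  rw [← Real.Gamma_add_one, sub_add_cancel]
  exact (hc.int_sub' (d := -c - 1) (-1) (by push_cast; ring)).ne_zero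

/-- The same derivative formula for the singular part: the factor 1 + b + c + n comes from
differentiating z^{1+b+c+n}. -/
theorem add_mul_tricomiCoeffSing (hc : NotInt c) (hbc : NotInt (b + c)) (n : ℕ) :
    (1 + b + c + n) * tricomiCoeffSing b c n = c * tricomiCoeffSing b (c - 1) n := by
  have h1 : Real.Gamma (-1 - n - b - (c - 1)) =
      (-1 - n - b - c) * Real.Gamma (-1 - n - b - c) := by
    rw [← Real.Gamma_add_one]
    · congr 1; ring
    · exact (hbc.int_sub' (d := -1 - n - b - c) (-1 - n) (by push_cast; ring)).ne_zero
  have h2 : Real.Gamma (-(c - 1)) = -c * Real.Gamma (-c) := by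
    rw [← Real.Gamma_add_one (neg_ne_zero.2 hc.ne_zero)]
    congr 1; ring
  have h3 := (hc.int_sub' (d := -c) 0 (by push_cast; ring)).Gamma_ne_zero
  have h4 := hc.ne_zero
  simp only [tricomiCoeffSing]
  rw [h1, h2]
  field_simp
  ring

theorem tricomiCoeffSing_succ (hb : -1 < b) (hc : NotInt c) (hbc : NotInt (b + c)) (n : ℕ) :
    tricomiCoeffSing b c (n + 1) =
      tricomiCoeffSing b c n * ((1 + n + b) / (((n : ℝ) + 1) * (2 + n + b + c))) := by
  have hn : (-2 - n - b - c : ℝ) ≠ 0 :=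
    (hbc.int_sub' (d := -2 - n - b - c) (-2 - n) (by push_cast; ring)).ne_zero
  have hn' : (2 + n + b + c : ℝ) ≠ 0 := fun h => hn (by linarith)
  have h1 : Real.Gamma (-1 - n - b - c) = (-2 - n - b - c) * Real.Gamma (-2 - n - b - c) := by
    rw [← Real.Gamma_add_one hn]
    congr 1; ring
  have h2 : Real.Gamma (1 + (n + 1) + b) = (1 + n + b) * Real.Gamma (1 + n + b) := by
    rw [← Real.Gamma_add_one]
    · congr 1; ring
    · have : (0 : ℝ) ≤ n := Nat.cast_nonneg n
      linarith
  have h3 := (hc.int_sub' (d := -c) 0 (by push_cast; ring)).Gamma_ne_zero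
  simp only [tricomiCoeffSing, Nat.factorial_succ, Nat.cast_mul, Nat.cast_add, Nat.cast_one]
  rw [h1, h2, show -1 - ((n : ℝ) + 1) - b - c = -2 - n - b - c by ring]
  field_simp
  ring

/-- Expresses the derivative of the bare singular series, without its power of z, through the series
for c and c + 1. With `add_mul_tricomiCoeffSing` this also yields the contiguity relation. -/
theorem succ_mul_tricomiCoeffSing (hb : -1 < b) (hc : NotInt c) (hbc : NotInt (b + c)) (n : ℕ) :
    ((n : ℝ) + 1) * tricomiCoeffSing b c (n + 1) =
      tricomiCoeffSing b c n - tricomiCoeffSing b (c + 1) n := by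
  have hn : (-2 - n - b - c : ℝ) ≠ 0 :=
    (hbc.int_sub' (d := -2 - n - b - c) (-2 - n) (by push_cast; ring)).ne_zero
  have hn' : (2 + n + b + c : ℝ) ≠ 0 := fun h => hn (by linarith)
  have h1 : Real.Gamma (-1 - n - b - c) = (-2 - n - b - c) * Real.Gamma (-2 - n - b - c) := by
    rw [← Real.Gamma_add_one hn]
    congr 1; ring
  have h2 := Gamma_neg_sub_one hc
  have h3 := (hc.int_sub' (d := -c - 1) (-1) (by push_cast; ring)).Gamma_ne_zero
  have h4 := (hc.int_sub' (d := -c - 1) (-1) (by push_cast; ring)).ne_zero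
  rw [tricomiCoeffSing_succ hb hc hbc]
  simp only [tricomiCoeffSing]
  rw [show -(c + 1) = -c - 1 by ring, show -1 - (n : ℝ) - b - (c + 1) = -2 - n - b - c by ring,
    h1, h2]
  field_simp
  ring

theorem tricomiCoeffSing_ne_zero (hb : -1 < b) (hc : NotInt c) (hbc : NotInt (b + c)) (n : ℕ) :
    tricomiCoeffSing b c n ≠ 0 := by
  have h1 := (hbc.int_sub' (d := -1 - n - b - c) (-1 - n) (by push_cast; ring)).Gamma_ne_zero
  have h2 := (hc.int_sub' (d := -c) 0 (by push_cast; ring)).Gamma_ne_zero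
  have h3 : Real.Gamma (1 + n + b) ≠ 0 := by
    have : (0 : ℝ) ≤ n := Nat.cast_nonneg n
    exact (Real.Gamma_pos_of_pos (by linarith)).ne'
  have h4 : (n.factorial : ℝ) ≠ 0 := by positivity
  exact div_ne_zero (mul_ne_zero (mul_ne_zero (by simp) h1) h3) (mul_ne_zero h2 h4)

theorem tendsto_ratio_zero (p q : ℝ) (s : ℝ) (hs : s ≠ 0) :
    Tendsto (fun n : ℕ => (p + n) / (((n : ℝ) + 1) * (q + s * n))) atTop (𝓝 0) := by
  have h0 := tendsto_natCast_atTop_atTop (R := ℝ)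
  have h1 : Tendsto (fun n : ℕ => (1 : ℝ) / ((n : ℝ) + 1)) atTop (𝓝 0) :=
    tendsto_one_div_add_atTop_nhds_zero_nat
  have hinv : Tendsto (fun n : ℕ => ((n : ℝ))⁻¹) atTop (𝓝 0) := tendsto_inv_atTop_nhds_zero_nat
  have h2 : Tendsto (fun n : ℕ => (p * (n : ℝ)⁻¹ + 1) / (q * (n : ℝ)⁻¹ + s)) atTop (𝓝 (1 / s)) := by
    have ha := (hinv.const_mul p).add_const 1
    have hb := (hinv.const_mul q).add_const s
    simp only [mul_zero, zero_add] at ha hb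
    exact ha.div hb hs
  have h3 := h1.mul h2
  rw [zero_mul] at h3
  refine h3.congr' ?_
  filter_upwards [eventually_gt_atTop 0] with n hn
  have hn : (n : ℝ) ≠ 0 := by positivity
  have e1 : p * (n : ℝ)⁻¹ + 1 = (p + n) * (n : ℝ)⁻¹ := by field_simp
  have e2 : q * (n : ℝ)⁻¹ + s = (q + s * n) * (n : ℝ)⁻¹ := by field_simp
  rw [e1, e2, mul_div_mul_right _ _ (inv_ne_zero hn), div_mul_div_comm, one_mul]

theorem summable_tricomiCoeffReg (hc : NotInt c) (hbc : NotInt (b + c)) (r : ℝ) :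
    Summable fun n => tricomiCoeffReg b c n * r ^ n := by
  refine summable_pow_of_ratio (tricomiCoeffReg_ne_zero hc hbc) ?_ r
  have h := (tendsto_ratio_zero (-c) (-(b + c)) 1 one_ne_zero).norm
  rw [norm_zero] at h
  refine h.congr fun n => ?_
  have h1 := norm_ne_zero_iff.2 (tricomiCoeffReg_ne_zero hc hbc n)
  rw [tricomiCoeffReg_succ hc hbc, norm_mul, mul_div_cancel_left₀ _ h1,
    show -c + (n : ℝ) = -(c - n) by ring,
    show (n + 1 : ℝ) * (-(b + c) + 1 * n) = -((n + 1 : ℝ) * (b + c - n)) by ring, neg_div_neg_eq]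

theorem summable_tricomiCoeffSing (hb : -1 < b) (hc : NotInt c) (hbc : NotInt (b + c)) (r : ℝ) :
    Summable fun n => tricomiCoeffSing b c n * r ^ n := by
  refine summable_pow_of_ratio (tricomiCoeffSing_ne_zero hb hc hbc) ?_ r
  have h := (tendsto_ratio_zero (1 + b) (2 + b + c) 1 one_ne_zero).norm
  rw [norm_zero] at h
  refine h.congr fun n => ?_
  have h1 := norm_ne_zero_iff.2 (tricomiCoeffSing_ne_zero hb hc hbc n)
  rw [tricomiCoeffSing_succ hb hc hbc, norm_mul, mul_div_cancel_left₀ _ h1,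
    show 1 + b + (n : ℝ) = 1 + n + b by ring,
    show 2 + b + c + 1 * (n : ℝ) = 2 + n + b + c by ring]

end coefficients

/-! ### Uniqueness for a linear system singular at 0 -/

theorem nonneg_of_deriv_nonneg {R : ℝ} {g g' : ℝ → ℝ}
    (hg : ∀ z ∈ Ioo 0 R, HasDerivAt g (g' z) z)
    (hg' : ∀ z ∈ Ioo 0 R, 0 ≤ g' z) (hg0 : Tendsto g (𝓝[>] 0) (𝓝 0)) {z : ℝ} (hz : z ∈ Ioo 0 R) :
    0 ≤ g z := by
  have hmono : MonotoneOn g (Ioo 0 R) := by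
    refine monotoneOn_of_deriv_nonneg (convex_Ioo 0 R)
      (fun y hy => (hg y hy).continuousAt.continuousWithinAt) ?_ ?_
    · rw [interior_Ioo]
      exact fun y hy => (hg y hy).differentiableAt.differentiableWithinAt
    · rw [interior_Ioo]
      intro y hy
      rw [(hg y hy).deriv]
      exact hg' y hy
  refine le_of_tendsto hg0 ?_
  filter_upwards [Ioo_mem_nhdsGT hz.1] with y hy
  exact hmono ⟨hy.1, hy.2.trans hz.2⟩ hz hy.2.le

/-- A function that vanishes at `0+` and whose derivative is dominated by that of `h`, where `h`
vanishes at `0+`, is dominated by `h`. -/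
theorem abs_le_of_abs_deriv_le {R : ℝ} {f f' h h' : ℝ → ℝ}
    (hf : ∀ z ∈ Ioo 0 R, HasDerivAt f (f' z) z) (hh : ∀ z ∈ Ioo 0 R, HasDerivAt h (h' z) z)
    (hle : ∀ z ∈ Ioo 0 R, |f' z| ≤ h' z) (hf0 : Tendsto f (𝓝[>] 0) (𝓝 0))
    (hh0 : Tendsto h (𝓝[>] 0) (𝓝 0)) {z : ℝ} (hz : z ∈ Ioo 0 R) : |f z| ≤ h z := by
  rw [abs_le]
  constructor
  · have := nonneg_of_deriv_nonneg (g := fun z => h z + f z)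
      (fun z hz => (hh z hz).add (hf z hz)) (fun z hz => by
        have := (abs_le.1 (hle z hz)).1; linarith) (by simpa using hh0.add hf0) hz
    linarith
  · have := nonneg_of_deriv_nonneg (g := fun z => h z - f z)
      (fun z hz => (hh z hz).sub (hf z hz)) (fun z hz => by
        have := (abs_le.1 (hle z hz)).2; linarith) (by simpa using hh0.sub hf0) hz
    linarith

theorem exists_abs_le_of_tendsto_zero {F : ℝ → ℝ} (hF : ∀ z, 0 < z → ContinuousAt F z)
    (hF0 : Tendsto F (𝓝[>] 0) (𝓝 0)) (R : ℝ) : ∃ M, 0 ≤ M ∧ ∀ z ∈ Ioo 0 R, |F z| ≤ M := by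
  have h1 : ∀ᶠ z in 𝓝[>] (0 : ℝ), |F z| < 1 := by
    have := hF0.abs
    rw [abs_zero] at this
    exact this.eventually (gt_mem_nhds one_pos)
  obtain ⟨ε, hε, hε'⟩ := mem_nhdsGT_iff_exists_Ioo_subset.1 h1
  have hε : 0 < ε := hε
  have hcont : ContinuousOn F (Icc (ε / 2) R) := fun z hz =>
    (hF z (by linarith [hz.1])).continuousWithinAt
  obtain ⟨C, hC⟩ := isCompact_Icc.exists_bound_of_continuousOn hcont
  refine ⟨max 1 C, by positivity, fun z hz => ?_⟩
  rcases lt_or_ge z ε with h | h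
  · exact (hε' ⟨hz.1, h⟩ : |F z| < 1).le.trans (le_max_left _ _)
  · exact (hC z ⟨by linarith, hz.2.le⟩).trans (le_max_right _ _)

theorem tendsto_const_mul_rpow_zero (C : ℝ) {q : ℝ} (hq : 0 < q) :
    Tendsto (fun z : ℝ => C * z ^ q) (𝓝[>] 0) (𝓝 0) := by
  have : ContinuousAt (fun z : ℝ => C * z ^ q) 0 :=
    (Real.continuousAt_rpow_const _ _ (Or.inr hq.le)).const_mul C
  have h := this.tendsto
  simp only [Real.zero_rpow hq.ne', mul_zero] at h
  exact tendsto_nhdsWithin_of_tendsto_nhds h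

/-- Uniqueness for a linear system with an integrable singularity at `0`. -/
theorem eq_zero_of_singular_system {p k : ℝ} (hp : p < 1) {F G : ℝ → ℝ}
    (hF : ∀ z, 0 < z → HasDerivAt F (F z - z ^ (p - 1) * G z) z)
    (hG : ∀ z, 0 < z → HasDerivAt G (k * (z ^ (-p) * F z)) z)
    (hF0 : Tendsto F (𝓝[>] 0) (𝓝 0)) (hG0 : Tendsto G (𝓝[>] 0) (𝓝 0)) {z : ℝ} (hz : 0 < z) :
    F z = 0 := by
  obtain ⟨M, hM, hFM⟩ := exists_abs_le_of_tendsto_zero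
    (fun z hz => (hF z hz).continuousAt) hF0 (z + 1)
  set K := 1 + |k| / (1 - p) with hK
  have hp' : 0 < 1 - p := by linarith
  have hK0 : 0 < K := by positivity
  -- Picard iteration. A bound C y^n on F gives G a bound of order y^{n+1-p}; the weight y^{p-1}
  -- brings this back to y^n, so |F'| is at most C K y^n and one more integration gains a factor K y
  -- / (n + 1). The choice K = 1 + |k| / (1 - p) covers the worst denominator, that of n = 0.
  have key : ∀ n : ℕ, ∀ y ∈ Ioo 0 (z + 1), |F y| ≤ M * K ^ n / n.factorial * y ^ n := by
    intro n
    induction n with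
    | zero => simpa using hFM
    | succ n ih =>
      set C := M * K ^ n / n.factorial with hC
      have hC0 : 0 ≤ C := by positivity
      have hq : 0 < (n : ℝ) + 1 - p := by
        have : (0 : ℝ) ≤ n := Nat.cast_nonneg n
        linarith
      have hGb : ∀ y ∈ Ioo 0 (z + 1), |G y| ≤ |k| * C / (n + 1 - p) * y ^ ((n : ℝ) + 1 - p) := by
        intro y hy
        refine abs_le_of_abs_deriv_le (R := z + 1) (f' := fun z => k * (z ^ (-p) * F z))
          (h := fun y => |k| * C / (n + 1 - p) * y ^ ((n : ℝ) + 1 - p))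
          (h' := fun y => |k| * (y ^ (-p) * (C * y ^ n)))
          (fun y hy => hG y hy.1) (fun y hy => ?_) (fun y hy => ?_) hG0
          (tendsto_const_mul_rpow_zero _ hq) hy
        · refine ((Real.hasDerivAt_rpow_const (Or.inl hy.1.ne')).const_mul _).congr_deriv ?_
          rw [show (n : ℝ) + 1 - p - 1 = -p + n by ring, Real.rpow_add hy.1, Real.rpow_natCast]
          field_simp
        · have h1 : 0 < y ^ (-p) := Real.rpow_pos_of_pos hy.1 _
          rw [abs_mul, abs_mul, abs_of_pos h1]
          gcongr
          exact ih y hy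
      intro y hy
      have hfac : ((n + 1).factorial : ℝ) = (n + 1) * n.factorial := by
        rw [Nat.factorial_succ]; push_cast; ring
      refine abs_le_of_abs_deriv_le (R := z + 1) (f' := fun z => F z - z ^ (p - 1) * G z)
          (h := fun y => M * K ^ (n + 1) / (n + 1).factorial * y ^ (n + 1))
          (h' := fun y => C * K * y ^ n)
          (fun y hy => hF y hy.1) (fun y hy => ?_) (fun y hy => ?_) hF0 ?_ hy
      · refine ((hasDerivAt_pow (n + 1) y).const_mul _).congr_deriv ?_
        rw [hfac, hC]
        push_cast
        field_simp
        ring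
      · have h1 : 0 < y ^ (p - 1) := Real.rpow_pos_of_pos hy.1 _
        have h2 : y ^ (p - 1) * y ^ ((n : ℝ) + 1 - p) = y ^ n := by
          rw [← Real.rpow_add hy.1, ← Real.rpow_natCast]
          congr 1; ring
        have h3 : 0 < y ^ n := pow_pos hy.1 n
        calc |F y - y ^ (p - 1) * G y| ≤ |F y| + |y ^ (p - 1) * G y| := abs_sub _ _
          _ = |F y| + y ^ (p - 1) * |G y| := by rw [abs_mul, abs_of_pos h1]
          _ ≤ C * y ^ n + y ^ (p - 1) * (|k| * C / (n + 1 - p) * y ^ ((n : ℝ) + 1 - p)) := by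
              gcongr
              · exact ih y hy
              · exact hGb y hy
          _ = C * y ^ n + |k| * C / (n + 1 - p) * y ^ n := by rw [← h2]; ring
          _ ≤ C * y ^ n + |k| * C / (1 - p) * y ^ n := by
              gcongr
              have : (0 : ℝ) ≤ n := Nat.cast_nonneg n
              linarith
          _ = C * K * y ^ n := by rw [hK]; ring
      · have h := tendsto_const_mul_rpow_zero (M * K ^ (n + 1) / (n + 1).factorial)
          (q := ((n + 1 : ℕ) : ℝ)) (by positivity)
        simpa only [Real.rpow_natCast] using h
  have hlim : Tendsto (fun n : ℕ => M * ((K * z) ^ n / n.factorial)) atTop (𝓝 (M * 0)) :=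
    (FloorSemiring.tendsto_pow_div_factorial_atTop (K * z)).const_mul M
  rw [mul_zero] at hlim
  have hle : |F z| ≤ 0 := by
    refine ge_of_tendsto' hlim fun n => (key n z ⟨hz, by linarith⟩).trans (le_of_eq ?_)
    rw [mul_pow]; ring
  exact abs_eq_zero.1 (le_antisymm hle (abs_nonneg _))

/-! ### The connection formula -/

/-- The difference of the two sides of the connection formula. -/
noncomputable def tricomiDefect (b c z : ℝ) : ℝ :=
  tricomiInt b c z - ∑' n, tricomiCoeffReg b c n * z ^ n -
    z ^ (1 + b + c) * ∑' n, tricomiCoeffSing b c n * z ^ n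

section defect

variable {b c : ℝ}

theorem hasDerivAt_tsum_tricomiCoeffReg (hc : NotInt c) (hbc : NotInt (b + c)) (z : ℝ) :
    HasDerivAt (fun z => ∑' n, tricomiCoeffReg b c n * z ^ n)
      (c * ∑' n, tricomiCoeffReg b (c - 1) n * z ^ n) z := by
  refine (hasDerivAt_tsum_pow (summable_tricomiCoeffReg hc hbc) z).congr_deriv ?_
  rw [← tsum_mul_left]
  refine tsum_congr fun n => ?_
  rw [succ_mul_tricomiCoeffReg hc, mul_assoc]

theorem tsum_tricomiCoeffReg_contiguous (hc : NotInt c) (hbc : NotInt (b + c)) (z : ℝ) :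
    z * (c * ∑' n, tricomiCoeffReg b (c - 1) n * z ^ n) =
      (b + 1 + c) * ∑' n, tricomiCoeffReg b c n * z ^ n
        - ∑' n, tricomiCoeffReg b (c + 1) n * z ^ n
        + z * ∑' n, tricomiCoeffReg b c n * z ^ n := by
  have hs := summable_tricomiCoeffReg hc hbc
  have hs1 := summable_tricomiCoeffReg (b := b) hc.add_one
    (by rw [← add_assoc]; exact hbc.add_one) z
  have e1 : z * (c * ∑' n, tricomiCoeffReg b (c - 1) n * z ^ n) =
      ∑' n : ℕ, (n : ℝ) * tricomiCoeffReg b c n * z ^ n := by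
    rw [← mul_tsum_succ_mul_pow hs, ← tsum_mul_left]
    congr 1
    refine tsum_congr fun n => ?_
    rw [succ_mul_tricomiCoeffReg hc, mul_assoc]
  have hs0 := summable_nat_mul_pow hs z
  have e2 := (hs0.sub ((hs z).mul_left (b + 1 + c))).add hs1
  have e3 := e2.tsum_eq_zero_add
  rw [(hs0.sub ((hs z).mul_left (b + 1 + c))).tsum_add hs1,
    hs0.tsum_sub ((hs z).mul_left (b + 1 + c)), tsum_mul_left] at e3
  have h0 := tricomiCoeffReg_zero_contiguous hc hbc
  have e4 : ∑' n : ℕ, (((n + 1 : ℕ) : ℝ) * tricomiCoeffReg b c (n + 1) * z ^ (n + 1)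
      - (b + 1 + c) * (tricomiCoeffReg b c (n + 1) * z ^ (n + 1))
      + tricomiCoeffReg b (c + 1) (n + 1) * z ^ (n + 1))
      = z * ∑' n, tricomiCoeffReg b c n * z ^ n := by
    rw [← tsum_mul_left]
    refine tsum_congr fun n => ?_
    rw [← tricomiCoeffReg_contiguous hc hbc n]
    push_cast
    ring
  rw [e4] at e3
  simp only [Nat.cast_zero, zero_mul, pow_zero, mul_one, zero_sub] at e3
  rw [e1]
  linarith

theorem hasDerivAt_tsum_tricomiCoeffSing (hb : -1 < b) (hc : NotInt c) (hbc : NotInt (b + c))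
    (z : ℝ) :
    HasDerivAt (fun z => ∑' n, tricomiCoeffSing b c n * z ^ n)
      (∑' n, tricomiCoeffSing b c n * z ^ n - ∑' n, tricomiCoeffSing b (c + 1) n * z ^ n) z := by
  have hs := summable_tricomiCoeffSing hb hc hbc
  have hs1 := summable_tricomiCoeffSing hb hc.add_one
    (by rw [← add_assoc]; exact hbc.add_one) z
  refine (hasDerivAt_tsum_pow hs z).congr_deriv ?_
  rw [← (hs z).tsum_sub hs1]
  refine tsum_congr fun n => ?_
  rw [succ_mul_tricomiCoeffSing hb hc hbc, sub_mul]

/-- This one identity serves both for the derivative of z^{1+b+c} times the singular series and for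
its contiguity relation. -/
theorem tsum_tricomiCoeffSing_sub_one (hb : -1 < b) (hc : NotInt c) (hbc : NotInt (b + c))
    (z : ℝ) :
    c * ∑' n, tricomiCoeffSing b (c - 1) n * z ^ n =
      (1 + b + c) * ∑' n, tricomiCoeffSing b c n * z ^ n +
      z * (∑' n, tricomiCoeffSing b c n * z ^ n - ∑' n, tricomiCoeffSing b (c + 1) n * z ^ n) := by
  have hs := summable_tricomiCoeffSing hb hc hbc
  have hs1 := summable_tricomiCoeffSing hb hc.add_one
    (by rw [← add_assoc]; exact hbc.add_one) z
  have e1 : z * (∑' n, tricomiCoeffSing b c n * z ^ n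
      - ∑' n, tricomiCoeffSing b (c + 1) n * z ^ n)
      = ∑' n : ℕ, (n : ℝ) * tricomiCoeffSing b c n * z ^ n := by
    rw [← mul_tsum_succ_mul_pow hs, ← (hs z).tsum_sub hs1]
    congr 1
    refine tsum_congr fun n => ?_
    rw [succ_mul_tricomiCoeffSing hb hc hbc, sub_mul]
  rw [e1, ← tsum_mul_left, ← tsum_mul_left,
    ← ((hs z).mul_left _).tsum_add (summable_nat_mul_pow hs z)]
  refine tsum_congr fun n => ?_
  rw [← mul_assoc, ← add_mul_tricomiCoeffSing hc hbc]
  ring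

theorem hasDerivAt_tricomiDefect (hb : -1 < b) (hc : NotInt c) (hbc : NotInt (b + c)) {z : ℝ}
    (hz : 0 < z) :
    HasDerivAt (tricomiDefect b c) (c * tricomiDefect b (c - 1) z) z := by
  have h1 := hasDerivAt_tricomiInt c hb hz
  have h2 := hasDerivAt_tsum_tricomiCoeffReg hc hbc z
  have h3 := (Real.hasDerivAt_rpow_const (p := 1 + b + c) (Or.inl hz.ne')).mul
    (hasDerivAt_tsum_tricomiCoeffSing hb hc hbc z)
  refine ((h1.sub h2).sub h3).congr_deriv ?_
  have h4 := tsum_tricomiCoeffSing_sub_one hb hc hbc z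
  have h5 : z ^ (1 + b + c) = z ^ (1 + b + c - 1) * z := by
    rw [← Real.rpow_add_one hz.ne', sub_add_cancel]
  rw [tricomiDefect, show 1 + b + (c - 1) = 1 + b + c - 1 by ring, h5]
  linear_combination z ^ (1 + b + c - 1) * h4

/-- All three parts of the defect satisfy the same linear relation, the powers of z in front of the
singular series matching up since raising c by one contributes a factor z. -/
theorem tricomiDefect_contiguous (hb : -1 < b) (hc : NotInt c) (hbc : NotInt (b + c)) {z : ℝ}
    (hz : 0 < z) :
    z * (c * tricomiDefect b (c - 1) z) = (b + 1 + c) * tricomiDefect b c z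
      - tricomiDefect b (c + 1) z + z * tricomiDefect b c z := by
  have h1 := tricomiInt_contiguous c hb hz
  have h2 := tsum_tricomiCoeffReg_contiguous hc hbc z
  have h4 := tsum_tricomiCoeffSing_sub_one hb hc hbc z
  have h5 : z ^ (1 + b + c) = z ^ (1 + b + c - 1) * z := by
    rw [← Real.rpow_add_one hz.ne', sub_add_cancel]
  have h6 : z ^ (1 + b + (c + 1)) = z ^ (1 + b + c - 1) * z * z := by
    rw [← Real.rpow_add_one hz.ne', ← Real.rpow_add_one hz.ne']; congr 1; ring
  simp only [tricomiDefect]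
  rw [show 1 + b + (c - 1) = 1 + b + c - 1 by ring, h5, h6]
  linear_combination h1 - h2 - z ^ (1 + b + c - 1) * z * h4

/-- Here the singular part tends to 0, and the constant term of the regular series is exactly the
limit Γ(1 + b + c) of the integral. -/
theorem tendsto_tricomiDefect (hb : -1 < b) (hc : NotInt c) (hbc : NotInt (b + c))
    (hpos : -1 < b + c) : Tendsto (tricomiDefect b c) (𝓝[>] 0) (𝓝 0) := by
  have h1 := tendsto_tricomiInt_zero hb hpos
  have h2 := tendsto_tsum_pow_zero (summable_tricomiCoeffReg hc hbc)
  have h3 := (tendsto_const_mul_rpow_zero 1 (q := 1 + b + c) (by linarith)).mul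
    (tendsto_tsum_pow_zero (summable_tricomiCoeffSing hb hc hbc))
  have h := (h1.sub h2).sub h3
  rw [tricomiCoeffReg_zero hc, sub_self, zero_mul, sub_zero] at h
  simp only [one_mul] at h
  exact h

theorem tendsto_rpow_mul_tricomiDefect (hb : -1 < b) (hc : NotInt c) (hbc : NotInt (b + c))
    (hneg : b + c < -1) :
    Tendsto (fun z => z ^ (-(1 + b + c)) * tricomiDefect b c z) (𝓝[>] 0) (𝓝 0) := by
  have h1 := tendsto_rpow_mul_tricomiInt_zero hb hneg
  have h2 := (tendsto_const_mul_rpow_zero 1 (q := -(1 + b + c)) (by linarith)).mul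
    (tendsto_tsum_pow_zero (summable_tricomiCoeffReg hc hbc))
  have h3 := tendsto_tsum_pow_zero (summable_tricomiCoeffSing hb hc hbc)
  have h := (h1.sub h2).sub h3
  rw [tricomiCoeffSing_zero, zero_mul, sub_zero, sub_self] at h
  refine h.congr' ?_
  filter_upwards [self_mem_nhdsWithin] with z hz
  have hz : 0 < z := hz
  have h5 : z ^ (-(1 + b + c)) * z ^ (1 + b + c) = 1 := by
    rw [← Real.rpow_add hz, neg_add_cancel, Real.rpow_zero]
  rw [tricomiDefect]
  linear_combination (∑' n, tricomiCoeffSing b c n * z ^ n) * h5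

/-- Only in this strip are both limits at 0 available: b + c < -1 controls the defect at c after
division by z^{1+b+c}, and b + c + 1 > -1 controls the defect at c + 1. With p = -(1 + b + c) in (0,
1), contiguity closes the two derivative formulas into the singular system. -/
theorem tricomiDefect_eq_zero_of_mem_Ioo (hb : -1 < b) (hc : NotInt c) (hbc : NotInt (b + c))
    (h : b + c ∈ Ioo (-2 : ℝ) (-1)) {z : ℝ} (hz : 0 < z) : tricomiDefect b c z = 0 := by
  have hbc1 : NotInt (b + (c + 1)) := by rw [← add_assoc]; exact hbc.add_one
  have hF := eq_zero_of_singular_system (p := -(1 + b + c)) (k := c + 1) (by linarith [h.1])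
    (F := fun z => z ^ (-(1 + b + c)) * tricomiDefect b c z) (G := tricomiDefect b (c + 1))
    (fun z hz => ?_) (fun z hz => ?_) (tendsto_rpow_mul_tricomiDefect hb hc hbc h.2)
    (tendsto_tricomiDefect hb hc.add_one hbc1 (by linarith [h.1])) hz
  · exact (mul_eq_zero.1 hF).resolve_left (Real.rpow_pos_of_pos hz _).ne'
  · have h1 := (Real.hasDerivAt_rpow_const (p := -(1 + b + c)) (Or.inl hz.ne')).mul
      (hasDerivAt_tricomiDefect hb hc hbc hz)
    refine h1.congr_deriv ?_
    have h2 := tricomiDefect_contiguous hb hc hbc hz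
    have h5 : z ^ (-(1 + b + c)) = z ^ (-(1 + b + c) - 1) * z := by
      rw [← Real.rpow_add_one hz.ne', sub_add_cancel]
    rw [h5]
    linear_combination z ^ (-(1 + b + c) - 1) * h2
  · refine (hasDerivAt_tricomiDefect hb hc.add_one hbc1 hz).congr_deriv ?_
    rw [← mul_assoc (z ^ _), ← Real.rpow_add hz, neg_add_cancel, Real.rpow_zero, one_mul,
      add_sub_cancel_right]

/-- Induction on unit strips of b + c: the derivative of the defect at c is a multiple of the defect
at c - 1, hence zero, and the defect vanishes at 0+. Non-integrality of b + c excludes the strip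
boundary -1. -/
theorem tricomiDefect_eq_zero (hb : -1 < b) (hc : NotInt c) (hbc : NotInt (b + c))
    (h : -2 < b + c) {z : ℝ} (hz : 0 < z) : tricomiDefect b c z = 0 := by
  have key : ∀ n : ℕ, ∀ c : ℝ, NotInt c → NotInt (b + c) → -2 < b + c → b + c < -1 + n →
      ∀ z, 0 < z → tricomiDefect b c z = 0 := by
    intro n
    induction n with
    | zero =>
      intro c hc hbc h1 h2 z hz
      exact tricomiDefect_eq_zero_of_mem_Ioo hb hc hbc ⟨h1, by simpa using h2⟩ hz
    | succ n ih =>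
      intro c hc hbc h1 h2 z hz
      rcases lt_or_ge (b + c) (-1) with h3 | h3
      · exact tricomiDefect_eq_zero_of_mem_Ioo hb hc hbc ⟨h1, h3⟩ hz
      have h4 : -1 < b + c := lt_of_le_of_ne h3 (fun h => hbc (-1) (by push_cast; exact h.symm))
      have h0 := ih (c - 1) hc.sub_one (by rw [← add_sub_assoc]; exact hbc.sub_one)
        (by linarith) (by push_cast at h2; linarith)
      have := abs_le_of_abs_deriv_le (R := z + 1) (h := fun _ => 0) (h' := fun _ => 0)
        (fun y hy => hasDerivAt_tricomiDefect hb hc hbc hy.1)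
        (fun y _ => hasDerivAt_const y 0) (fun y hy => by rw [h0 y hy.1]; simp)
        (tendsto_tricomiDefect hb hc hbc h4) tendsto_const_nhds ⟨hz, by linarith⟩
      exact abs_eq_zero.1 (le_antisymm this (abs_nonneg _))
  obtain ⟨n, hn⟩ := exists_nat_gt (b + c + 1)
  exact key n c hc hbc h (by linarith) z hz

/-- **Connection formula** for Tricomi's function. -/
theorem tricomiInt_eq_tsum (hb : -1 < b) (hc : NotInt c) (hbc : NotInt (b + c))
    (h : -2 < b + c) {z : ℝ} (hz : 0 < z) :
    tricomiInt b c z = ∑' n, tricomiCoeffReg b c n * z ^ n +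
      z ^ (1 + b + c) * ∑' n, tricomiCoeffSing b c n * z ^ n := by
  have := tricomiDefect_eq_zero hb hc hbc h hz
  rw [tricomiDefect] at this
  linarith

end defect

/-! ### The Lévy–Khintchine exponent -/

theorem norm_cexp_neg_sub_mul (l u t : ℝ) :
    ‖Complex.exp (-((l - Complex.I * u) * t))‖ = Real.exp (-(l * t)) := by
  rw [Complex.norm_exp]
  congr 1
  simp

theorem norm_rpow_mul_cexp {s l u t : ℝ} (ht : 0 < t) :
    ‖((t ^ s : ℝ) : ℂ) * Complex.exp (-((l - Complex.I * u) * t))‖ =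
      Real.exp (-(l * t)) * t ^ s := by
  rw [norm_mul, norm_cexp_neg_sub_mul, Complex.norm_real, Real.norm_of_nonneg (by positivity),
    mul_comm]

theorem integrableOn_rpow_mul_cexp {s l : ℝ} (u : ℝ) (hs : -1 < s) (hl : 0 < l) :
    IntegrableOn (fun t : ℝ => ((t ^ s : ℝ) : ℂ) * Complex.exp (-((l - Complex.I * u) * t)))
      (Ioi 0) := by
  refine Integrable.mono' (integrableOn_exp_mul_rpow hs hl) (by fun_prop) ?_
  refine (ae_restrict_iff' measurableSet_Ioi).2 (Eventually.of_forall fun t ht => ?_)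
  exact (norm_rpow_mul_cexp ht).le

theorem hasDerivAt_ofReal_rpow {s t : ℝ} (ht : 0 < t) :
    HasDerivAt (fun t : ℝ => ((t ^ s : ℝ) : ℂ)) ((s * t ^ (s - 1) : ℝ) : ℂ) t :=
  (Real.hasDerivAt_rpow_const (Or.inl ht.ne')).ofReal_comp

theorem hasDerivAt_cexp_neg_mul (w : ℂ) (t : ℝ) :
    HasDerivAt (fun t : ℝ => Complex.exp (-(w * t))) (-w * Complex.exp (-(w * t))) t := by
  have h := ((((hasDerivAt_id t).ofReal_comp).const_mul w).neg).cexp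
  refine h.congr_deriv ?_
  simp
  ring

theorem tendsto_rpow_mul_cexp_atTop (s u : ℝ) {l : ℝ} (hl : 0 < l) :
    Tendsto (fun t : ℝ => ((t ^ s : ℝ) : ℂ) * Complex.exp (-((l - Complex.I * u) * t)))
      atTop (𝓝 0) := by
  rw [tendsto_zero_iff_norm_tendsto_zero]
  refine (tendsto_rpow_mul_exp_neg_mul_atTop_nhds_zero s l hl).congr' ?_
  filter_upwards [eventually_gt_atTop 0] with t ht
  rw [norm_rpow_mul_cexp ht, mul_comm, neg_mul]

/-- The functional equation of the Gamma integral with complex rate, by parts; it supplies the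
differential equation in u used to evaluate that integral. -/
theorem mul_integral_rpow_mul_cexp {s l : ℝ} (u : ℝ) (hs : 0 < s) (hl : 0 < l) :
    (l - Complex.I * u) * ∫ t in Ioi (0 : ℝ),
        ((t ^ s : ℝ) : ℂ) * Complex.exp (-((l - Complex.I * u) * t)) =
      s * ∫ t in Ioi (0 : ℝ),
        ((t ^ (s - 1) : ℝ) : ℂ) * Complex.exp (-((l - Complex.I * u) * t)) := by
  set w : ℂ := l - Complex.I * u with hw
  have i1 := (integrableOn_rpow_mul_cexp u (s := s) (by linarith) hl).const_mul w
  have i2 := (integrableOn_rpow_mul_cexp u (s := s - 1) (by linarith) hl).const_mul (s : ℂ)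
  have key := integral_Ioi_of_hasDerivAt_of_tendsto (a := (0 : ℝ)) (m := 0)
    (f := fun t : ℝ => ((t ^ s : ℝ) : ℂ) * Complex.exp (-(w * t)))
    (f' := fun t : ℝ => s * (((t ^ (s - 1) : ℝ) : ℂ) * Complex.exp (-(w * t)))
      - w * (((t ^ s : ℝ) : ℂ) * Complex.exp (-(w * t)))) ?_ ?_ (i2.sub i1)
    (tendsto_rpow_mul_cexp_atTop s u hl)
  · rw [integral_sub i2 i1, integral_const_mul, integral_const_mul] at key
    simp only [Real.zero_rpow hs.ne', Complex.ofReal_zero, zero_mul, sub_zero] at key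
    exact (sub_eq_zero.1 key).symm
  · refine ContinuousAt.continuousWithinAt (ContinuousAt.mul ?_ (by fun_prop))
    exact Complex.continuous_ofReal.continuousAt.comp
      (Real.continuousAt_rpow_const _ _ (Or.inr hs.le))
  · intro t ht
    refine ((hasDerivAt_ofReal_rpow ht).mul (hasDerivAt_cexp_neg_mul w t)).congr_deriv ?_
    push_cast
    ring

theorem hasDerivAt_integral_rpow_mul_cexp {s l : ℝ} (u : ℝ) (hs : 0 < s) (hl : 0 < l) :
    HasDerivAt (fun u : ℝ => ∫ t in Ioi (0 : ℝ),
        ((t ^ (s - 1) : ℝ) : ℂ) * Complex.exp (-((l - Complex.I * u) * t)))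
      (Complex.I * ∫ t in Ioi (0 : ℝ),
        ((t ^ s : ℝ) : ℂ) * Complex.exp (-((l - Complex.I * u) * t))) u := by
  have key := hasDerivAt_integral_of_dominated_loc_of_deriv_le
    (μ := volume.restrict (Ioi (0 : ℝ)))
    (F := fun u t : ℝ => ((t ^ (s - 1) : ℝ) : ℂ) * Complex.exp (-((l - Complex.I * u) * t)))
    (F' := fun u t : ℝ => Complex.I *
      (((t ^ (s - 1) * t : ℝ) : ℂ) * Complex.exp (-((l - Complex.I * u) * t)))) (x₀ := u)
    (s := univ) (bound := fun t => Real.exp (-(l * t)) * t ^ s) univ_mem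
    (Eventually.of_forall fun _ => by fun_prop)
    (integrableOn_rpow_mul_cexp u (by linarith) hl) (by fun_prop) ?_
    (integrableOn_exp_mul_rpow (by linarith) hl) ?_
  · refine key.2.congr_deriv ?_
    rw [← integral_const_mul]
    refine setIntegral_congr_fun measurableSet_Ioi fun t ht => ?_
    have ht : 0 < t := ht
    rw [← Real.rpow_add_one ht.ne', sub_add_cancel]
  · refine (ae_restrict_iff' measurableSet_Ioi).2 (Eventually.of_forall fun t ht v _ => ?_)
    have ht : 0 < t := ht
    rw [← Real.rpow_add_one ht.ne', sub_add_cancel, norm_mul, Complex.norm_I, one_mul,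
      norm_rpow_mul_cexp ht]
  · refine (ae_restrict_iff' measurableSet_Ioi).2 (Eventually.of_forall fun t ht v _ => ?_)
    have h : HasDerivAt (fun v : ℝ => -((l - Complex.I * v) * t)) (Complex.I * t) v := by
      have := ((((hasDerivAt_id v).ofReal_comp).const_mul Complex.I).const_sub (l : ℂ)).mul_const
        (t : ℂ) |>.neg
      refine this.congr_deriv ?_
      simp
    refine (h.cexp.const_mul _).congr_deriv ?_
    push_cast
    ring

/-- The Gamma integral with a complex rate. -/
theorem integral_rpow_mul_cexp {s l : ℝ} (u : ℝ) (hs : 0 < s) (hl : 0 < l) :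
    ∫ t in Ioi (0 : ℝ), ((t ^ (s - 1) : ℝ) : ℂ) * Complex.exp (-((l - Complex.I * u) * t)) =
      Real.Gamma s * (l - Complex.I * u) ^ (-s : ℂ) := by
  set h : ℝ → ℂ := fun u => ∫ t in Ioi (0 : ℝ),
        ((t ^ (s - 1) : ℝ) : ℂ) * Complex.exp (-((l - Complex.I * u) * t)) with hh
  have hre : ∀ v : ℝ, 0 < (l - Complex.I * v : ℂ).re := fun v => by simpa using hl
  have hne : ∀ v : ℝ, (l - Complex.I * v : ℂ) ≠ 0 := fun v h0 => by
    have := hre v; rw [h0] at this; simp at this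
  -- Multiplying by (l - iv)^s should give the constant Γ(s). Its derivative in v vanishes by the
  -- functional equation, and v = 0 is the real Gamma integral.
  have hd : ∀ v : ℝ, HasDerivAt (fun v : ℝ => h v * (l - Complex.I * v : ℂ) ^ (s : ℂ)) 0 v := by
    intro v
    have h1 := hasDerivAt_integral_rpow_mul_cexp v hs hl
    have h2 : HasDerivAt (fun v : ℂ => (l - Complex.I * v : ℂ)) (-Complex.I) v := by
      have := (((hasDerivAt_id (v : ℂ)).const_mul Complex.I).const_sub (l : ℂ))
      refine this.congr_deriv ?_
      simp
    have h3 := (h2.cpow_const (c := (s : ℂ)) (Or.inl (hre v))).comp_ofReal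
    refine (h1.mul h3).congr_deriv ?_
    have h4 := mul_integral_rpow_mul_cexp v hs hl
    have h5 : (l - Complex.I * v : ℂ) ^ (s : ℂ) =
        (l - Complex.I * v : ℂ) ^ (s - 1 : ℂ) * (l - Complex.I * v) := by
      rw [Complex.cpow_sub _ _ (hne v), Complex.cpow_one, div_mul_cancel₀ _ (hne v)]
    rw [h5]
    linear_combination Complex.I * (l - Complex.I * v : ℂ) ^ (s - 1 : ℂ) * h4
  have hconst := is_const_of_deriv_eq_zero (fun v => (hd v).differentiableAt)
    (fun v => (hd v).deriv) u 0
  have h0 : h 0 = Real.Gamma s * (l : ℂ) ^ (-s : ℂ) := by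
    have e1 : h 0 = ((∫ t in Ioi (0 : ℝ), t ^ (s - 1) * Real.exp (-(l * t)) : ℝ) : ℂ) := by
      rw [hh, ← integral_complex_ofReal]
      simp
    rw [e1, Real.integral_rpow_mul_exp_neg_mul_Ioi hs hl, one_div, Real.inv_rpow hl.le,
      ← Real.rpow_neg hl.le, Complex.ofReal_mul, Complex.ofReal_cpow hl.le]
    push_cast
    ring
  simp only [h0, Complex.ofReal_zero, mul_zero, sub_zero] at hconst
  have hl' : (l : ℂ) ≠ 0 := by exact_mod_cast hl.ne'
  rw [mul_assoc, ← Complex.cpow_add _ _ hl', neg_add_cancel, Complex.cpow_zero, mul_one] at hconst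
  change h u = _
  have hw : (l - Complex.I * u : ℂ) ^ (s : ℂ) ≠ 0 := by
    simp [Complex.cpow_eq_zero_iff, hne u]
  rw [Complex.cpow_neg, ← div_eq_mul_inv, eq_div_iff hw, hconst]

/-- The Lévy–Khintchine exponent of the one-sided tempered stable law. -/
theorem integral_levy_tempered_stable {α β l : ℝ} (hβ : β ∈ Ioo (0 : ℝ) 1) (hl : 0 < l) (u : ℝ) :
    ∫ x in Ioi (0 : ℝ), (Complex.exp (Complex.I * u * x) - 1) *
        ((α * (Real.exp (-l * x) / x ^ (1 + β)) : ℝ) : ℂ) =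
      -(tsA α β : ℂ) * ((l - Complex.I * u) ^ (β : ℂ) - (l : ℂ) ^ (β : ℂ)) := by
  obtain ⟨hβ0, hβ1⟩ := hβ
  set w : ℂ := l - Complex.I * u with hw
  have hw0 : (l - Complex.I * (0 : ℝ) : ℂ) = l := by simp
  have hwne : w ≠ 0 := by
    intro h
    have : w.re = 0 := by rw [h]; simp
    simp [hw] at this
    linarith
  have hlne : (l : ℂ) ≠ 0 := by exact_mod_cast hl.ne'
  have i1 := (integrableOn_rpow_mul_cexp u (s := -β) (by linarith) hl).const_mul w
  have i2 := (integrableOn_rpow_mul_cexp 0 (s := -β) (by linarith) hl).const_mul (l : ℂ)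
  rw [hw0] at i2
  have hexp : ∀ x : ℝ, Complex.exp (-(w * x)) =
      Complex.exp (Complex.I * u * x) * Complex.exp (-(l * x)) := by
    intro x
    rw [← Complex.exp_add, hw]
    congr 1
    ring
  have hbound : ∀ x : ℝ, 0 < x → ‖Complex.exp (-(w * x)) - Complex.exp (-((l : ℂ) * x))‖ ≤
      |u| * x * Real.exp (-(l * x)) := by
    intro x hx
    rw [hexp, ← sub_one_mul, norm_mul]
    have h1 : ‖Complex.exp (-((l : ℂ) * x))‖ = Real.exp (-(l * x)) := by
      rw [Complex.norm_exp]; simp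
    have h2 := Real.norm_exp_I_mul_ofReal_sub_one_le (x := u * x)
    rw [h1]
    refine mul_le_mul_of_nonneg_right ?_ (Real.exp_pos _).le
    rw [Real.norm_eq_abs, abs_mul, abs_of_pos hx] at h2
    push_cast at h2
    rw [mul_assoc]
    exact h2
  have i3 : IntegrableOn (fun x : ℝ => ((x ^ (-β - 1) : ℝ) : ℂ) *
      (Complex.exp (-(w * x)) - Complex.exp (-((l : ℂ) * x)))) (Ioi 0) := by
    refine Integrable.mono' ((integrableOn_exp_mul_rpow (b := -β) (by linarith) hl).const_mul |u|)
      (by fun_prop) ?_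
    refine (ae_restrict_iff' measurableSet_Ioi).2 (Eventually.of_forall fun x hx => ?_)
    have hx : 0 < x := hx
    rw [norm_mul, Complex.norm_real, Real.norm_of_nonneg (by positivity)]
    calc x ^ (-β - 1) * _ ≤ x ^ (-β - 1) * (|u| * x * Real.exp (-(l * x))) := by
          gcongr; exact hbound x hx
      _ = |u| * (Real.exp (-(l * x)) * (x ^ (-β - 1) * x)) := by ring
      _ = _ := by rw [← Real.rpow_add_one hx.ne', sub_add_cancel]
  -- Integration by parts removes the non-integrable x^{-1-β}. The boundary term x^{-β} (e^{-wx} -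
  -- e^{-lx}) is O(x^{1-β}) at 0 because the difference of exponentials vanishes there to first
  -- order. What remains are two Gamma integrals of order 1 - β.
  have key := integral_Ioi_of_hasDerivAt_of_tendsto (a := (0 : ℝ)) (m := 0)
    (f := fun x : ℝ => ((x ^ (-β) : ℝ) : ℂ) *
      (Complex.exp (-(w * x)) - Complex.exp (-((l : ℂ) * x))))
    (f' := fun x : ℝ => (l * (((x ^ (-β) : ℝ) : ℂ) * Complex.exp (-((l : ℂ) * x)))
      - w * (((x ^ (-β) : ℝ) : ℂ) * Complex.exp (-(w * x))))
      - β * (((x ^ (-β - 1) : ℝ) : ℂ) *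
      (Complex.exp (-(w * x)) - Complex.exp (-((l : ℂ) * x))))) ?_ ?_
      ((i2.sub i1).sub (i3.const_mul (β : ℂ))) ?_
  · have e1 := integral_sub (i2.sub i1) (i3.const_mul (β : ℂ))
    have e2 := integral_sub i2 i1
    simp only [Pi.sub_apply] at e1
    have g1 := integral_rpow_mul_cexp (s := 1 - β) u (by linarith) hl
    have g2 := integral_rpow_mul_cexp (s := 1 - β) 0 (by linarith) hl
    rw [hw0] at g2
    rw [show 1 - β - 1 = -β by ring] at g1 g2
    rw [e1, e2, integral_const_mul, integral_const_mul, integral_const_mul, g1, g2] at key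
    simp only [Complex.ofReal_zero, mul_zero, sub_self] at key
    have hG : Real.Gamma (1 - β) = -β * Real.Gamma (-β) := by
      rw [← Real.Gamma_add_one (neg_ne_zero.2 hβ0.ne')]; congr 1; ring
    have c1 : w * w ^ (-((1 - β : ℝ) : ℂ)) = w ^ (β : ℂ) := by
      nth_rewrite 1 [← Complex.cpow_one w]
      rw [← Complex.cpow_add _ _ hwne]
      congr 1
      push_cast
      ring
    have c2 : (l : ℂ) * (l : ℂ) ^ (-((1 - β : ℝ) : ℂ)) = (l : ℂ) ^ (β : ℂ) := by
      nth_rewrite 1 [← Complex.cpow_one (l : ℂ)]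
      rw [← Complex.cpow_add _ _ hlne]
      congr 1
      push_cast
      ring
    have e3 : ∫ x in Ioi (0 : ℝ), (Complex.exp (Complex.I * u * x) - 1) *
        ((α * (Real.exp (-l * x) / x ^ (1 + β)) : ℝ) : ℂ) =
        α * ∫ x in Ioi (0 : ℝ), ((x ^ (-β - 1) : ℝ) : ℂ) *
          (Complex.exp (-(w * x)) - Complex.exp (-((l : ℂ) * x))) := by
      rw [← integral_const_mul]
      refine setIntegral_congr_fun measurableSet_Ioi fun x hx => ?_
      have hx : 0 < x := hx
      rw [hexp, div_eq_mul_inv, ← Real.rpow_neg hx.le, show -(1 + β) = -β - 1 by ring]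
      push_cast
      rw [neg_mul]
      ring
    have hβne : (β : ℂ) ≠ 0 := by exact_mod_cast hβ0.ne'
    rw [e3, tsA]
    rw [hG] at key
    push_cast at key c1 c2 ⊢
    refine mul_left_cancel₀ hβne ?_
    linear_combination (-α : ℂ) * key + (α : ℂ) * (-β * Real.Gamma (-β)) * (c2 - c1)
  · rw [ContinuousWithinAt]
    have h0 : Tendsto (fun x : ℝ => |u| * x ^ (1 - β)) (𝓝[≥] 0) (𝓝 0) := by
      have hq : 0 < 1 - β := by linarith
      have : ContinuousAt (fun z : ℝ => |u| * z ^ (1 - β)) 0 :=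
        (Real.continuousAt_rpow_const _ _ (Or.inr hq.le)).const_mul |u|
      have h := this.tendsto
      simp only [Real.zero_rpow hq.ne', mul_zero] at h
      exact tendsto_nhdsWithin_of_tendsto_nhds h
    simp only [Complex.ofReal_zero, mul_zero, sub_self]
    refine squeeze_zero_norm' ?_ h0
    filter_upwards [self_mem_nhdsWithin] with x hx
    rcases eq_or_lt_of_le (show (0 : ℝ) ≤ x from hx) with h | h
    · rw [← h]
      simp only [Complex.ofReal_zero, mul_zero, sub_self, norm_zero]
      positivity
    · rw [norm_mul, Complex.norm_real, Real.norm_of_nonneg (by positivity)]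
      calc x ^ (-β) * _ ≤ x ^ (-β) * (|u| * x * Real.exp (-(l * x))) := by
            gcongr; exact hbound x h
        _ ≤ x ^ (-β) * (|u| * x * 1) := by
            gcongr
            exact Real.exp_le_one_iff.2 (by nlinarith)
        _ = |u| * (x ^ (-β) * x) := by ring
        _ = _ := by rw [← Real.rpow_add_one h.ne']; ring_nf
  · intro x hx
    refine ((hasDerivAt_ofReal_rpow (s := -β) hx).mul ((hasDerivAt_cexp_neg_mul w x).sub
      (hasDerivAt_cexp_neg_mul (l : ℂ) x))).congr_deriv ?_
    simp only [Pi.sub_apply]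
    push_cast
    ring
  · have h1 := tendsto_rpow_mul_cexp_atTop (-β) u hl
    have h2 := tendsto_rpow_mul_cexp_atTop (-β) 0 hl
    rw [hw0] at h2
    have h := h1.sub h2
    rw [sub_zero] at h
    refine h.congr fun x => ?_
    rw [mul_sub]

/-! ### Fourier inversion by Gaussian smoothing -/

/-- The Gaussian smoothing of `μ` in terms of its characteristic function. -/
theorem integral_gaussianPDFReal_eq_integral_charFun (μ : Measure ℝ) [IsProbabilityMeasure μ]
    {v : NNReal} (hv : v ≠ 0) (x : ℝ) :
    ((∫ y, gaussianPDFReal y v x ∂μ : ℝ) : ℂ) =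
      (2 * Real.pi : ℂ)⁻¹ * ∫ u : ℝ, Complex.exp (-(Complex.I * u * x)) * charFun μ u *
        Complex.exp (-(v / 2 : ℂ) * u ^ 2) := by
  have hv0 : (0 : ℝ) < v := by positivity
  have hvc : (v : ℂ) ≠ 0 := by exact_mod_cast hv0.ne'
  have hre : 0 < ((v : ℂ) / 2).re := by
    simp
    positivity
  have hswap : ∫ u : ℝ, Complex.exp (-(Complex.I * u * x)) * charFun μ u *
        Complex.exp (-(v / 2 : ℂ) * u ^ 2) =
      ∫ y, (∫ u : ℝ, Complex.exp (Complex.I * (y - x : ℝ) * u) *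
        Complex.exp (-(v / 2 : ℂ) * u ^ 2)) ∂μ := by
    rw [integral_integral_swap]
    · refine integral_congr_ae (Eventually.of_forall fun u => ?_)
      simp only
      rw [charFun_apply_real, mul_right_comm, ← integral_const_mul]
      refine integral_congr_ae (Eventually.of_forall fun y => ?_)
      simp only
      rw [mul_right_comm, ← Complex.exp_add]
      congr 2
      push_cast
      ring
    · have hg : Integrable (fun p : ℝ × ℝ => Real.exp (-(v / 2 : ℝ) * p.2 ^ 2)) (μ.prod volume) :=
        (integrable_exp_neg_mul_sq (b := (v / 2 : ℝ)) (by positivity)).comp_snd μ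
      refine Integrable.mono' hg (Continuous.aestronglyMeasurable (by
        unfold Function.uncurry; fun_prop)) (Eventually.of_forall fun p => ?_)
      simp only [Function.uncurry]
      rw [norm_mul, Complex.norm_exp, Complex.norm_exp]
      have h1 : (Complex.I * ((p.1 - x : ℝ) : ℂ) * (p.2 : ℂ)).re = 0 := by simp
      have h2 : (-(v / 2 : ℂ) * (p.2 : ℂ) ^ 2).re = -(v / 2 : ℝ) * p.2 ^ 2 := by
        rw [show (-(v / 2 : ℂ) * (p.2 : ℂ) ^ 2) = ((-(v / 2 : ℝ) * p.2 ^ 2 : ℝ) : ℂ) by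
          push_cast; rfl, Complex.ofReal_re]
      rw [h1, h2, Real.exp_zero, one_mul]
  rw [hswap, ← integral_complex_ofReal, ← integral_const_mul]
  refine integral_congr_ae (Eventually.of_forall fun y => ?_)
  simp only
  rw [fourierIntegral_gaussian hre, gaussianPDFReal]
  have h1 : ((Real.pi : ℂ) / (v / 2)) ^ (1 / 2 : ℂ) = ((Real.sqrt (2 * Real.pi / v) : ℝ) : ℂ) := by
    rw [Real.sqrt_eq_rpow, Complex.ofReal_cpow (by positivity)]
    congr 1
    · push_cast
      field_simp
    · push_cast
      rfl
  have h2 : (Real.sqrt (2 * Real.pi * v))⁻¹ =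
      (2 * Real.pi)⁻¹ * Real.sqrt (2 * Real.pi / v) := by
    rw [Real.sqrt_mul (by positivity), Real.sqrt_div (by positivity)]
    have hs1 : Real.sqrt v ≠ 0 := by positivity
    have hs2 : Real.sqrt (2 * Real.pi) ≠ 0 := by positivity
    have hs3 := Real.mul_self_sqrt (show 0 ≤ 2 * Real.pi by positivity)
    have hpi := Real.pi_pos.ne'
    field_simp
    rw [sq, hs3]
  rw [h1, h2]
  push_cast
  rw [mul_assoc]
  congr 3
  field_simp
  ring

theorem integral_comp_add_mul_gaussianReal {v : NNReal} (hv : v ≠ 0) {g : ℝ → ℝ}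
    (hg : Continuous g) (y : ℝ) :
    ∫ s, g (y + Real.sqrt v * s) ∂(gaussianReal 0 1) = ∫ x, gaussianPDFReal y v x * g x := by
  have h1 : (gaussianReal 0 1).map (fun s => y + Real.sqrt v * s) = gaussianReal y v := by
    have h2 : (gaussianReal 0 1).map (Real.sqrt v * ·) = gaussianReal 0 v := by
      rw [gaussianReal_map_const_mul, mul_zero, mul_one]
      congr 1
      ext
      simp
    have h3 := gaussianReal_map_const_add (μ := 0) (v := v) y
    rw [← h2, Measure.map_map (by fun_prop) (by fun_prop), zero_add] at h3
    exact h3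
  have h4 := integral_gaussianReal_eq_integral_smul (μ := y) (f := g) hv
  simp only [smul_eq_mul] at h4
  rw [← h4, ← h1, integral_map (by fun_prop) hg.aestronglyMeasurable]

theorem gaussianPDFReal_le (y : ℝ) (v : NNReal) (x : ℝ) :
    gaussianPDFReal y v x ≤ (Real.sqrt (2 * Real.pi * v))⁻¹ := by
  rw [gaussianPDFReal]
  refine mul_le_of_le_one_right (by positivity) (Real.exp_le_one_iff.2 ?_)
  rw [neg_div]
  have : 0 ≤ (x - y) ^ 2 / (2 * v) := by positivity
  linarith

/-- Both sides are the expectation of g(Y + √v Z) with Y of law μ and Z an independent standard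
Gaussian. The left side makes the limit v → 0 visible, the right side the smoothed density. -/
theorem integral_gaussian_smoothing (μ : Measure ℝ) [IsProbabilityMeasure μ] {v : NNReal}
    (hv : v ≠ 0) {g : ℝ → ℝ} (hg : Continuous g) {C : ℝ} (hC : ∀ x, ‖g x‖ ≤ C)
    (hgi : Integrable g) :
    ∫ p : ℝ × ℝ, g (p.1 + Real.sqrt v * p.2) ∂(μ.prod (gaussianReal 0 1)) =
      ∫ x, (∫ y, gaussianPDFReal y v x ∂μ) * g x := by
  have h_int : Integrable (fun p : ℝ × ℝ => g (p.1 + Real.sqrt v * p.2))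
      (μ.prod (gaussianReal 0 1)) :=
    Integrable.of_bound (Continuous.aestronglyMeasurable (by fun_prop)) C
      (Eventually.of_forall fun p => hC _)
  have hmeas : Measurable fun p : ℝ × ℝ => gaussianPDFReal p.1 v p.2 := by
    unfold gaussianPDFReal
    fun_prop
  rw [integral_prod _ h_int]
  simp_rw [integral_comp_add_mul_gaussianReal hv hg]
  rw [integral_integral_swap]
  · refine integral_congr_ae (Eventually.of_forall fun x => ?_)
    exact integral_mul_const _ _
  · refine Integrable.mono' ((hgi.comp_snd μ).norm.const_mul (Real.sqrt (2 * Real.pi * v))⁻¹)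
      (hmeas.mul (hg.measurable.comp measurable_snd)).aestronglyMeasurable
      (Eventually.of_forall fun p => ?_)
    simp only [Function.uncurry]
    rw [norm_mul, Real.norm_of_nonneg (gaussianPDFReal_nonneg _ _ _)]
    exact mul_le_mul_of_nonneg_right (gaussianPDFReal_le _ _ _) (norm_nonneg _)

/-- **Fourier inversion**: a law with integrable characteristic function has a continuous
density. -/
theorem exists_continuousDensity (μ : Measure ℝ) [IsProbabilityMeasure μ]
    (hφ : Integrable (charFun μ)) :
    ∃ f : ℝ → ℝ, IsContinuousDensity μ f ∧ ∀ x : ℝ, (f x : ℂ) =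
      (2 * Real.pi : ℂ)⁻¹ * ∫ u : ℝ, Complex.exp (-(Complex.I * u * x)) * charFun μ u := by
  set D : ℝ → ℂ := fun x =>
    (2 * Real.pi : ℂ)⁻¹ * ∫ u : ℝ, Complex.exp (-(Complex.I * u * x)) * charFun μ u with hD
  have hnexp : ∀ u x : ℝ, ‖Complex.exp (-(Complex.I * u * x))‖ = 1 := fun u x => by
    rw [Complex.norm_exp]; simp
  set v : ℕ → NNReal := fun n => 1 / ((n : NNReal) + 1) with hvdef
  have hv : ∀ n, v n ≠ 0 := fun n => by positivity
  have hv0 : Tendsto (fun n => ((v n : NNReal) : ℝ)) atTop (𝓝 0) := by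
    simpa [hvdef] using tendsto_one_div_add_atTop_nhds_zero_nat (𝕜 := ℝ)
  have hngauss : ∀ (n : ℕ) (u : ℝ), ‖Complex.exp (-(v n / 2 : ℂ) * u ^ 2)‖ ≤ 1 := fun n u => by
    rw [show (-(v n / 2 : ℂ) * (u : ℂ) ^ 2) = ((-(v n / 2 : ℝ) * u ^ 2 : ℝ) : ℂ) by
          push_cast; rfl, Complex.norm_exp, Complex.ofReal_re]
    refine Real.exp_le_one_iff.2 ?_
    have : 0 ≤ (v n / 2 : ℝ) * u ^ 2 := by positivity
    linarith
  -- Density of μ convolved with a centred Gaussian of variance v n. These densities converge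
  -- pointwise to D, and this is what shows that D is real and nonnegative.
  set q : ℕ → ℝ → ℝ := fun n x => ∫ y, gaussianPDFReal y (v n) x ∂μ with hq
  have hqD : ∀ x, Tendsto (fun n => ((q n x : ℝ) : ℂ)) atTop (𝓝 (D x)) := by
    intro x
    simp_rw [hq, integral_gaussianPDFReal_eq_integral_charFun μ (hv _)]
    refine Tendsto.const_mul _ ?_
    refine tendsto_integral_of_dominated_convergence (fun u => ‖charFun μ u‖) ?_ hφ.norm ?_ ?_
    · intro n
      exact ((Continuous.aestronglyMeasurable (by fun_prop)).mul hφ.1).mul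
        (Continuous.aestronglyMeasurable (by fun_prop))
    · refine fun n => Eventually.of_forall fun u => ?_
      rw [norm_mul, norm_mul, hnexp, one_mul]
      exact mul_le_of_le_one_right (norm_nonneg _) (hngauss n u)
    · refine Eventually.of_forall fun u => ?_
      have h1 : Tendsto (fun n => Complex.exp (-(v n / 2 : ℂ) * u ^ 2)) atTop (𝓝 1) := by
        have h2 : Tendsto (fun n => (((v n : NNReal) : ℝ) : ℂ)) atTop (𝓝 ((0 : ℝ) : ℂ)) :=
          (Complex.continuous_ofReal.tendsto 0).comp hv0
        have h3 : Tendsto (fun n => -((((v n : NNReal) : ℝ) : ℂ) / 2) * (u : ℂ) ^ 2) atTop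
            (𝓝 (-(((0 : ℝ) : ℂ) / 2) * (u : ℂ) ^ 2)) := ((h2.div_const 2).neg).mul_const _
        have h4 := (Complex.continuous_exp.tendsto _).comp h3
        simp only [Complex.ofReal_zero, zero_div, neg_zero, zero_mul, Complex.exp_zero] at h4
        exact h4
      simpa using h1.const_mul (Complex.exp (-(Complex.I * u * x)) * charFun μ u)
  have hq0 : ∀ n x, 0 ≤ q n x := fun n x => integral_nonneg fun y => gaussianPDFReal_nonneg _ _ _
  set f : ℝ → ℝ := fun x => (D x).re with hf
  have hqf : ∀ x, Tendsto (fun n => q n x) atTop (𝓝 (f x)) := fun x => by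
    exact (Complex.continuous_re.tendsto _).comp (hqD x)
  have hfD : ∀ x, (f x : ℂ) = D x := fun x =>
    tendsto_nhds_unique ((Complex.continuous_ofReal.tendsto _).comp (hqf x)) (hqD x)
  have hf0 : ∀ x, 0 ≤ f x := fun x => ge_of_tendsto' (hqf x) fun n => hq0 n x
  have hDcont : Continuous D := by
    refine continuous_const.mul ?_
    refine continuous_of_dominated (bound := fun u => ‖charFun μ u‖) ?_ ?_ hφ.norm ?_
    · exact fun x => (Continuous.aestronglyMeasurable (by fun_prop)).mul hφ.1
    · refine fun x => Eventually.of_forall fun u => ?_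
      rw [norm_mul, hnexp, one_mul]
    · refine Eventually.of_forall fun u => ?_
      fun_prop
  have hfcont : Continuous f := Complex.continuous_re.comp hDcont
  set B : ℝ := (2 * Real.pi)⁻¹ * ∫ u, ‖charFun μ u‖ with hB
  have hnpi : ‖(2 * Real.pi : ℂ)⁻¹‖ = (2 * Real.pi)⁻¹ := by
    rw [norm_inv, norm_mul, Complex.norm_real, Real.norm_of_nonneg Real.pi_pos.le]
    simp
  have hqB : ∀ n x, ‖q n x‖ ≤ B := by
    intro n x
    rw [← Complex.norm_real]
    simp_rw [hq, integral_gaussianPDFReal_eq_integral_charFun μ (hv _)]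
    rw [norm_mul, hnpi, hB]
    refine mul_le_mul_of_nonneg_left ?_ (by positivity)
    refine norm_integral_le_of_norm_le hφ.norm (Eventually.of_forall fun u => ?_)
    rw [norm_mul, norm_mul, hnexp, one_mul]
    exact mul_le_of_le_one_right (norm_nonneg _) (hngauss n u)
  have hfB : ∀ x, f x ≤ B := fun x =>
    le_of_tendsto' (hqf x) fun n => (le_abs_self _).trans (hqB n x)
  refine ⟨f, ⟨hfcont, hf0, ?_⟩, hfD⟩
  -- Local finiteness, from f ≤ B, is needed to compare the two measures on compactly supported
  -- functions.
  have hlf : IsLocallyFiniteMeasure (volume.withDensity fun x => ENNReal.ofReal (f x)) := by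
    have hle : volume.withDensity (fun x => ENNReal.ofReal (f x)) ≤
        ENNReal.ofReal B • (volume : Measure ℝ) := by
      rw [← withDensity_const]
      exact withDensity_mono (Eventually.of_forall fun x => ENNReal.ofReal_le_ofReal (hfB x))
    have : IsLocallyFiniteMeasure (ENNReal.ofReal B • (volume : Measure ℝ)) :=
      inferInstanceAs (IsLocallyFiniteMeasure (B.toNNReal • (volume : Measure ℝ)))
    exact Measure.isLocallyFiniteMeasure_of_le hle
  refine Measure.ext_of_integral_eq_on_compactlySupported fun g => ?_
  have hgcont : Continuous g := g.continuous
  have hgi : Integrable (fun x => g x) := hgcont.integrable_of_hasCompactSupport g.hasCompactSupport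
  obtain ⟨C, hC⟩ := hgcont.bounded_above_of_compact_support g.hasCompactSupport
  rw [integral_withDensity_eq_integral_toReal_smul
    (f := fun x => ENNReal.ofReal (f x)) hfcont.measurable.ennreal_ofReal
    (Eventually.of_forall fun _ => ENNReal.ofReal_lt_top)]
  have h1 : Tendsto (fun n => ∫ x, q n x * g x) atTop (𝓝 (∫ x, f x * g x)) := by
    refine tendsto_integral_of_dominated_convergence (fun x => B * ‖g x‖) ?_
      (hgi.norm.const_mul B) ?_ ?_
    · intro n
      refine AEStronglyMeasurable.mul ?_ hgcont.aestronglyMeasurable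
      have hmeas : StronglyMeasurable (Function.uncurry fun x y : ℝ => gaussianPDFReal y (v n) x) := by
        have : Measurable (Function.uncurry fun x y : ℝ => gaussianPDFReal y (v n) x) := by
          unfold gaussianPDFReal Function.uncurry
          fun_prop
        exact this.stronglyMeasurable
      exact (StronglyMeasurable.integral_prod_right hmeas).aestronglyMeasurable
    · refine fun n => Eventually.of_forall fun x => ?_
      rw [norm_mul]
      exact mul_le_mul_of_nonneg_right (hqB n x) (norm_nonneg _)
    · exact Eventually.of_forall fun x => (hqf x).mul_const _
  have h2 : Tendsto (fun n => ∫ x, q n x * g x) atTop (𝓝 (∫ x, g x ∂μ)) := by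
    simp_rw [hq, ← integral_gaussian_smoothing μ (hv _) hgcont hC hgi]
    have e1 : ∫ x, g x ∂μ = ∫ p : ℝ × ℝ, g p.1 ∂(μ.prod (gaussianReal 0 1)) := by
      rw [integral_fun_fst]
      simp
    rw [e1]
    refine tendsto_integral_of_dominated_convergence (fun _ => C)
      (fun n => Continuous.aestronglyMeasurable (by fun_prop)) (integrable_const C)
      (fun n => Eventually.of_forall fun p => hC _) (Eventually.of_forall fun p => ?_)
    have h3 : Tendsto (fun n => p.1 + Real.sqrt (v n) * p.2) atTop
        (𝓝 (p.1 + Real.sqrt 0 * p.2)) :=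
      (((Real.continuous_sqrt.tendsto 0).comp hv0).mul_const _).const_add _
    rw [Real.sqrt_zero, zero_mul, add_zero] at h3
    exact (hgcont.tendsto _).comp h3
  rw [tendsto_nhds_unique h2 h1]
  refine integral_congr_ae (Eventually.of_forall fun x => ?_)
  simp only [smul_eq_mul]
  rw [ENNReal.toReal_ofReal (hf0 x)]

/-! ### Rotation of rays -/

/-- The point at distance `r` from `p` on the ray with angle `θ`. -/
noncomputable def rayPt (p : ℂ) (θ r : ℝ) : ℂ := p + r * Complex.exp (θ * Complex.I)

theorem hasDerivAt_cexp_mul_I (θ : ℝ) : HasDerivAt (fun θ : ℝ => Complex.exp (θ * Complex.I))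
    (Complex.exp (θ * Complex.I) * Complex.I) θ := by
  have := (((hasDerivAt_id θ).ofReal_comp).mul_const Complex.I).cexp
  simpa using this

theorem hasDerivAt_rayPt_angle (p : ℂ) (θ r : ℝ) :
    HasDerivAt (fun θ : ℝ => rayPt p θ r) (r * (Complex.exp (θ * Complex.I) * Complex.I)) θ :=
  ((hasDerivAt_cexp_mul_I θ).const_mul _).const_add _

theorem hasDerivAt_rayPt_radius (p : ℂ) (θ r : ℝ) :
    HasDerivAt (fun r : ℝ => rayPt p θ r) (Complex.exp (θ * Complex.I)) r := by
  have := (((hasDerivAt_id r).ofReal_comp).mul_const (Complex.exp (θ * Complex.I))).const_add p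
  exact this.congr_deriv (by simp)

theorem measurable_rayPt (p : ℂ) (θ : ℝ) : Measurable (rayPt p θ) := by
  unfold rayPt
  fun_prop

theorem norm_cexp_mul_I (θ : ℝ) : ‖Complex.exp (θ * Complex.I)‖ = 1 :=
  Complex.norm_exp_ofReal_mul_I θ

/-- The integral of `F` along the ray from `p` with angle `θ`. -/
noncomputable def rayIntegral (F : ℂ → ℂ) (p : ℂ) (θ : ℝ) : ℂ :=
  ∫ r in Ioi (0 : ℝ), F (rayPt p θ r) * Complex.exp (θ * Complex.I)

/-- **Cauchy's theorem** for rays: the integral does not change when the ray is rotated. -/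
theorem hasDerivAt_rayIntegral {F F' : ℂ → ℂ} {p : ℂ} {θ₀ M κ : ℝ} {s : Set ℝ} (hs : s ∈ 𝓝 θ₀)
    (hκ : 0 < κ) (hFm : Measurable F) (hF'm : Measurable F')
    (hF : ∀ θ ∈ s, ∀ r : ℝ, 0 < r → HasDerivAt F (F' (rayPt p θ r)) (rayPt p θ r))
    (hFb : ∀ θ ∈ s, ∀ r : ℝ, 0 < r → ‖F (rayPt p θ r)‖ ≤ M * Real.exp (-(κ * r)))
    (hF'b : ∀ θ ∈ s, ∀ r : ℝ, 0 < r → ‖F' (rayPt p θ r)‖ ≤ M * Real.exp (-(κ * r))) :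
    HasDerivAt (rayIntegral F p) 0 θ₀ := by
  have hθ₀ : θ₀ ∈ s := mem_of_mem_nhds hs
  have i0 : IntegrableOn (fun r : ℝ => M * Real.exp (-(κ * r))) (Ioi 0) := by
    have := (integrableOn_exp_mul_rpow (b := 0) (by norm_num) hκ).const_mul M
    simpa [IntegrableOn] using this
  have i1 : IntegrableOn (fun r : ℝ => M * (Real.exp (-(κ * r)) * r)) (Ioi 0) := by
    have := (integrableOn_exp_mul_rpow (b := 1) (by norm_num) hκ).const_mul M
    simpa [IntegrableOn] using this
  set G' : ℝ → ℝ → ℂ := fun θ r =>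
    F' (rayPt p θ r) * (r * (Complex.exp (θ * Complex.I) * Complex.I)) *
      Complex.exp (θ * Complex.I) + F (rayPt p θ r) * (Complex.exp (θ * Complex.I) * Complex.I)
    with hG'
  have hG'b : ∀ θ ∈ s, ∀ r : ℝ, 0 < r →
      ‖G' θ r‖ ≤ M * (Real.exp (-(κ * r)) * r) + M * Real.exp (-(κ * r)) := by
    intro θ hθ r hr
    refine (norm_add_le _ _).trans (add_le_add ?_ ?_)
    · rw [norm_mul, norm_mul, norm_mul, norm_mul, norm_cexp_mul_I, Complex.norm_I, mul_one, mul_one,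
        mul_one, Complex.norm_real, Real.norm_of_nonneg hr.le, ← mul_assoc]
      exact mul_le_mul_of_nonneg_right (hF'b θ hθ r hr) hr.le
    · rw [norm_mul, norm_mul, norm_cexp_mul_I, Complex.norm_I, mul_one, mul_one]
      exact hFb θ hθ r hr
  have hG'm : ∀ θ, Measurable (G' θ) := fun θ => by
    have h1 := hFm.comp (measurable_rayPt p θ)
    have h2 := hF'm.comp (measurable_rayPt p θ)
    exact ((h2.mul (by fun_prop)).mul measurable_const).add (h1.mul measurable_const)
  have key := hasDerivAt_integral_of_dominated_loc_of_deriv_le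
    (μ := volume.restrict (Ioi (0 : ℝ)))
    (F := fun θ r => F (rayPt p θ r) * Complex.exp (θ * Complex.I)) (F' := G')
    (bound := fun r => M * (Real.exp (-(κ * r)) * r) + M * Real.exp (-(κ * r))) hs
    (Eventually.of_forall fun θ =>
      ((hFm.comp (measurable_rayPt p θ)).mul measurable_const).aestronglyMeasurable) ?_
    (hG'm θ₀).aestronglyMeasurable ?_ (i1.add i0) ?_
  · refine key.2.congr_deriv ?_
    have h_int : IntegrableOn (G' θ₀) (Ioi 0) := key.1
    -- By the Cauchy–Riemann equations the angular derivative of the integrand is the radial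
    -- derivative of i r e^{iθ} F, which vanishes at r = 0 and at infinity.
    have h := integral_Ioi_of_hasDerivAt_of_tendsto (a := (0 : ℝ)) (m := 0)
      (f := fun r : ℝ => (r : ℂ) * (Complex.exp (θ₀ * Complex.I) * Complex.I) * F (rayPt p θ₀ r))
      (f' := G' θ₀) ?_ ?_ h_int ?_
    · rw [h]
      simp
    · rw [ContinuousWithinAt]
      simp only [Complex.ofReal_zero, zero_mul]
      have h0 : Tendsto (fun r : ℝ => r * (M * Real.exp (-(κ * r)))) (𝓝[≥] 0) (𝓝 0) := by
        have : ContinuousAt (fun r : ℝ => r * (M * Real.exp (-(κ * r)))) 0 := by fun_prop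
        have h := this.tendsto
        simp only [zero_mul] at h
        exact tendsto_nhdsWithin_of_tendsto_nhds h
      refine squeeze_zero_norm' ?_ h0
      filter_upwards [self_mem_nhdsWithin] with r hr
      rcases eq_or_lt_of_le (show (0 : ℝ) ≤ r from hr) with h | h
      · rw [← h]
        simp
      · rw [norm_mul, norm_mul, norm_mul, norm_cexp_mul_I, Complex.norm_I, mul_one, mul_one,
          Complex.norm_real, Real.norm_of_nonneg h.le]
        exact mul_le_mul_of_nonneg_left (hFb θ₀ hθ₀ r h) h.le
    · intro r hr
      have d1 : HasDerivAt (fun r : ℝ => (r : ℂ) * (Complex.exp (θ₀ * Complex.I) * Complex.I))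
          (Complex.exp (θ₀ * Complex.I) * Complex.I) r := by
        simpa using ((hasDerivAt_id r).ofReal_comp).mul_const
          (Complex.exp (θ₀ * Complex.I) * Complex.I)
      have d2 := (hF θ₀ hθ₀ r hr).scomp r (hasDerivAt_rayPt_radius p θ₀ r)
      refine (d1.mul d2).congr_deriv ?_
      simp only [hG', smul_eq_mul, Function.comp_apply]
      ring
    · have h0 := (tendsto_rpow_mul_exp_neg_mul_atTop_nhds_zero 1 κ hκ).const_mul M
      rw [mul_zero] at h0
      refine squeeze_zero_norm' ?_ h0
      filter_upwards [eventually_gt_atTop 0] with r hr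
      rw [norm_mul, norm_mul, norm_mul, norm_cexp_mul_I, Complex.norm_I, mul_one, mul_one,
          Complex.norm_real, Real.norm_of_nonneg hr.le, Real.rpow_one]
      have := mul_le_mul_of_nonneg_left (hFb θ₀ hθ₀ r hr) hr.le
      rw [neg_mul]
      linarith
  · refine Integrable.mono' i0
      ((hFm.comp (measurable_rayPt p θ₀)).mul measurable_const).aestronglyMeasurable ?_
    refine (ae_restrict_iff' measurableSet_Ioi).2 (Eventually.of_forall fun r hr => ?_)
    rw [norm_mul, norm_cexp_mul_I, mul_one]
    exact hFb θ₀ hθ₀ r hr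
  · exact (ae_restrict_iff' measurableSet_Ioi).2
      (Eventually.of_forall fun r hr θ hθ => hG'b θ hθ r hr)
  · refine (ae_restrict_iff' measurableSet_Ioi).2 (Eventually.of_forall fun r hr θ hθ => ?_)
    have d2 := (hF θ hθ r hr).scomp θ (hasDerivAt_rayPt_angle p θ r)
    refine (d2.mul (hasDerivAt_cexp_mul_I θ)).congr_deriv ?_
    simp only [hG', smul_eq_mul, Function.comp_apply]
    ring

/-- A sublinear power is absorbed by an arbitrarily small linear term. Beyond the threshold T one
has s^{1-β} ≥ A/ε, that is A s^β ≤ ε s; below it the constant A T^β suffices. -/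
theorem exists_mul_rpow_le {β : ℝ} (hβ : β ∈ Ioo (0 : ℝ) 1) {A ε : ℝ} (hA : 0 ≤ A) (hε : 0 < ε) :
    ∃ C, ∀ s : ℝ, 0 ≤ s → A * s ^ β ≤ ε * s + C := by
  obtain ⟨hβ0, hβ1⟩ := hβ
  set T := (A / ε + 1) ^ (1 / (1 - β)) with hT
  have hT0 : 0 < T := by positivity
  refine ⟨A * T ^ β, fun s hs => ?_⟩
  rcases le_or_gt s T with h | h
  · have := Real.rpow_le_rpow hs h hβ0.le
    nlinarith
  · have hs0 : 0 < s := hT0.trans h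
    have h1 : A / ε + 1 ≤ s ^ (1 - β) := by
      have := Real.rpow_le_rpow hT0.le h.le (show 0 ≤ 1 - β by linarith)
      rwa [hT, ← Real.rpow_mul (by positivity), one_div_mul_cancel (by linarith),
        Real.rpow_one] at this
    have h2 : s ^ (1 - β) * s ^ β = s := by
      rw [← Real.rpow_add hs0, sub_add_cancel, Real.rpow_one]
    have h3 : 0 < s ^ β := by positivity
    have h4 : A ≤ ε * s ^ (1 - β) := by
      have := mul_le_mul_of_nonneg_left h1 hε.le
      have h5 : ε * (A / ε + 1) = A + ε := by field_simp
      linarith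
    have h6 : A * s ^ β ≤ ε * s := by
      calc A * s ^ β ≤ ε * s ^ (1 - β) * s ^ β := mul_le_mul_of_nonneg_right h4 h3.le
        _ = ε * s := by rw [mul_assoc, h2]
    have h7 : 0 ≤ A * T ^ β := by positivity
    linarith

/-! ### The inversion integrand as values of one analytic function -/

theorem IsTSPlus.charFun {α β l : ℝ} {μ : Measure ℝ} (h : IsTSPlus α β l μ)
    (hβ : β ∈ Ioo (0 : ℝ) 1) (hl : 0 < l) (u : ℝ) :
    charFun μ u = Complex.exp
      (-(tsA α β : ℂ) * ((l - Complex.I * u) ^ (β : ℂ) - (l : ℂ) ^ (β : ℂ))) := by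
  rw [h.charFun_eq, integral_levy_tempered_stable hβ hl]

theorem IsTS.isProbabilityMeasure {αp βp lp αm βm lm : ℝ} {μ : Measure ℝ}
    (h : IsTS αp βp lp αm βm lm μ) : IsProbabilityMeasure μ := by
  obtain ⟨μp, μm, hp, ⟨ρ, hρ, rfl⟩, rfl⟩ := h
  have := hp.isProb
  have := hρ.isProb
  have : IsProbabilityMeasure (ρ.map fun x => -x) :=
    Measure.isProbabilityMeasure_map (by fun_prop)
  infer_instance

/-- The function whose contour integral is, up to a factor, the density of the law `TS`. -/
noncomputable def tsF (ap βp am βm L x : ℝ) (w : ℂ) : ℂ :=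
  Complex.exp (x * w - ap * w ^ (βp : ℂ) - am * (L - w) ^ (βm : ℂ))

/-- With w = lp - iu, the base lm + iu of the negative part is L - w, so both factors become
functions of one variable. The constants lp^βp and lm^βm collect into γ, and e^{-iux} = e^{xw}
e^{-lp x}. -/
theorem IsTS.exp_mul_charFun {αp βp lp αm βm lm : ℝ} {μ : Measure ℝ}
    (h : IsTS αp βp lp αm βm lm μ) (hβp : βp ∈ Ioo (0 : ℝ) 1) (hlp : 0 < lp)
    (hβm : βm ∈ Ioo (0 : ℝ) 1) (hlm : 0 < lm) (x u : ℝ) :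
    Complex.exp (-(Complex.I * u * x)) * charFun μ u =
      Real.exp (tsGamma αp βp lp αm βm lm - lp * x) *
        tsF (tsA αp βp) βp (tsA αm βm) βm (lp + lm) x (lp - Complex.I * u) := by
  obtain ⟨μp, μm, hp, ⟨ρ, hρ, rfl⟩, rfl⟩ := h
  have := hp.isProb
  have := hρ.isProb
  have : IsProbabilityMeasure (ρ.map fun x => -x) :=
    Measure.isProbabilityMeasure_map (by fun_prop)
  have hneg : charFun (ρ.map fun x => -x) u = charFun ρ (-u) := by
    have := charFun_map_mul (μ := ρ) (-1) u
    simpa using this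
  rw [charFun_conv, hneg, hp.charFun hβp hlp, hρ.charFun hβm hlm, tsF, Complex.ofReal_exp,
    ← Complex.exp_add, ← Complex.exp_add, ← Complex.exp_add]
  congr 1
  simp only [tsGamma]
  push_cast [Complex.ofReal_cpow hlp.le, Complex.ofReal_cpow hlm.le]
  rw [show (lp : ℂ) + lm - (lp - Complex.I * u) = lm - Complex.I * -u by ring]
  ring

/-! ### Estimates for `tsF` and the passage to the branch cut -/

section kernel

variable {ap βp am βm lp lm x : ℝ}

theorem measurable_tsF (ap βp am βm L x : ℝ) : Measurable (tsF ap βp am βm L x) := by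
  unfold tsF
  have h1 : Measurable fun w : ℂ => w ^ (βp : ℂ) := measurable_id.pow_const _
  have h2 : Measurable fun w : ℂ => ((L : ℂ) - w) ^ (βm : ℂ) :=
    (measurable_const.sub measurable_id).pow_const _
  fun_prop

theorem norm_tsF (ap βp am βm L x : ℝ) (w : ℂ) : ‖tsF ap βp am βm L x w‖ =
    Real.exp (x * w.re - ap * (w ^ (βp : ℂ)).re - am * ((L - w) ^ (βm : ℂ)).re) := by
  rw [tsF, Complex.norm_exp]
  congr 1
  simp

/-- In the closed right half-plane the argument of w^β is at most πβ/2 < π/2 in modulus, so the real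
part controls the norm. -/
theorem re_cpow_ge {w : ℂ} (hw : 0 ≤ w.re) {β : ℝ} (hβ : β ∈ Ioo (0 : ℝ) 1) :
    Real.cos (Real.pi / 2 * β) * ‖w‖ ^ β ≤ (w ^ (β : ℂ)).re := by
  rw [Complex.cpow_ofReal_re, mul_comm]
  refine mul_le_mul_of_nonneg_left ?_ (by positivity)
  have h1 : |w.arg| ≤ Real.pi / 2 := Complex.abs_arg_le_pi_div_two_iff.2 hw
  rw [← Real.cos_abs (w.arg * β), abs_mul, abs_of_pos hβ.1]
  refine Real.cos_le_cos_of_nonneg_of_le_pi ?_ ?_ ?_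
  · have := abs_nonneg w.arg
    exact mul_nonneg this hβ.1.le
  · nlinarith [Real.pi_pos, hβ.1, hβ.2]
  · exact mul_le_mul_of_nonneg_right h1 hβ.1.le

theorem cos_half_pi_mul_pos {β : ℝ} (hβ : β ∈ Ioo (0 : ℝ) 1) : 0 < Real.cos (Real.pi / 2 * β) :=
  Real.cos_pos_of_mem_Ioo ⟨by nlinarith [Real.pi_pos, hβ.1], by nlinarith [Real.pi_pos, hβ.2]⟩

theorem neg_rpow_le_re_cpow (w : ℂ) (β : ℝ) : -‖w‖ ^ β ≤ (w ^ (β : ℂ)).re := by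
  have := Complex.abs_re_le_norm (w ^ (β : ℂ))
  rw [Complex.norm_cpow_real] at this
  exact (abs_le.1 this).1

theorem rayPt_re (l θ r : ℝ) : (rayPt l θ r).re = l + r * Real.cos θ := by
  simp [rayPt, Complex.exp_ofReal_mul_I_re]

theorem rayPt_im (l θ r : ℝ) : (rayPt l θ r).im = r * Real.sin θ := by
  simp [rayPt, Complex.exp_ofReal_mul_I_im]

theorem norm_rayPt_le {l r : ℝ} (hl : 0 < l) (hr : 0 < r) (θ : ℝ) : ‖rayPt l θ r‖ ≤ l + r := by
  refine (norm_add_le _ _).trans (le_of_eq ?_)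
  rw [norm_mul, norm_cexp_mul_I, mul_one, Complex.norm_real, Complex.norm_real,
    Real.norm_of_nonneg hl.le, Real.norm_of_nonneg hr.le]

/-- l sin θ is the distance from 0 to the line carrying the ray; it bounds w^{βp-1} in the
derivative of `tsF`. -/
theorem mul_sin_le_norm_rayPt {l : ℝ} (hl : 0 < l) (r : ℝ) (θ : ℝ) (hθ : 0 ≤ Real.sin θ) :
    l * Real.sin θ ≤ ‖rayPt l θ r‖ := by
  rw [← abs_of_nonneg (norm_nonneg (rayPt l θ r)), ← abs_of_nonneg (mul_nonneg hl.le hθ),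
    ← sq_le_sq, ← Complex.normSq_eq_norm_sq, Complex.normSq_apply, rayPt_re, rayPt_im]
  have h : (l + r * Real.cos θ) * (l + r * Real.cos θ) + r * Real.sin θ * (r * Real.sin θ) =
      (r + l * Real.cos θ) ^ 2 + (l * Real.sin θ) ^ 2 := by
    linear_combination (r ^ 2 - l ^ 2) * Real.sin_sq_add_cos_sq θ
  rw [h]
  exact le_add_of_nonneg_left (sq_nonneg _)

theorem re_sub_rayPt {r θ : ℝ} (hr : 0 ≤ r) (hθ : Real.cos θ ≤ 0) (lp lm : ℝ) :
    lm ≤ (((lp + lm : ℝ) : ℂ) - rayPt lp θ r).re := by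
  rw [Complex.sub_re, rayPt_re, Complex.ofReal_re]
  nlinarith

theorem le_norm_sub_rayPt {r θ : ℝ} (hlm : 0 < lm) (hr : 0 ≤ r) (hθ : Real.cos θ ≤ 0) (lp : ℝ) :
    r ≤ ‖((lp + lm : ℝ) : ℂ) - rayPt lp θ r‖ := by
  rw [← abs_of_nonneg (norm_nonneg (((lp + lm : ℝ) : ℂ) - rayPt lp θ r)), ← abs_of_nonneg hr,
    ← sq_le_sq, ← Complex.normSq_eq_norm_sq, Complex.normSq_apply, Complex.sub_re, Complex.sub_im,
    abs_of_nonneg hr, rayPt_re, rayPt_im, Complex.ofReal_re, Complex.ofReal_im]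
  have := Real.sin_sq_add_cos_sq θ
  nlinarith [mul_nonneg hlm.le hr, mul_nonneg (mul_nonneg hlm.le hr) (neg_nonneg.2 hθ)]

/-- The bound on rays that are close to the vertical one. -/
theorem norm_tsF_le_of_arg_le (hx : 0 ≤ x) (hap : 0 ≤ ap) (ham : 0 ≤ am)
    (hβp : βp ∈ Ioo (0 : ℝ) 1) (hβm : βm ∈ Ioo (0 : ℝ) 1) (hlp : 0 < lp) (hlm : 0 < lm)
    {θ₀ θ r : ℝ} (hθ₀ : θ₀ ≤ Real.pi) (hθ₀β : θ₀ * βp ≤ Real.pi / 2)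
    (hθ : θ ∈ Icc (Real.pi / 2) θ₀) (hr : 0 < r) :
    ‖tsF ap βp am βm (lp + lm) x (rayPt lp θ r)‖ ≤
      Real.exp (x * lp) * Real.exp (-(am * Real.cos (Real.pi / 2 * βm)) * r ^ βm) := by
  have hcos : Real.cos θ ≤ 0 :=
    Real.cos_nonpos_of_pi_div_two_le_of_le hθ.1 (by linarith [hθ.2, Real.pi_pos])
  have hsin : 0 ≤ Real.sin θ :=
    Real.sin_nonneg_of_nonneg_of_le_pi (by linarith [hθ.1, Real.pi_pos]) (by linarith [hθ.2])
  have h1 : (rayPt lp θ r).re ≤ lp := by rw [rayPt_re]; nlinarith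
  have hre := re_sub_rayPt hr.le hcos lp lm
  have h2 := re_cpow_ge (hlm.le.trans hre) hβm
  have h3 := Real.rpow_le_rpow hr.le (le_norm_sub_rayPt hlm hr.le hcos lp) hβm.1.le
  have hκ := cos_half_pi_mul_pos hβm
  have harg0 : 0 ≤ (rayPt lp θ r).arg :=
    Complex.arg_nonneg_iff.2 (by rw [rayPt_im]; positivity)
  -- Adding the positive number lp to r e^{iθ} can only decrease the argument. Formally, Im(w
  -- e^{-iθ₀}) = r sin(θ - θ₀) - lp sin θ₀ is not positive.
  have harg : (rayPt lp θ r).arg ≤ θ₀ := by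
    by_contra! hlt
    have hpi := Complex.arg_le_pi (rayPt lp θ r)
    have hθ₀0 : 0 < θ₀ := by linarith [hθ.1, hθ.2, Real.pi_pos]
    have hs : 0 < Real.sin ((rayPt lp θ r).arg - θ₀) :=
      Real.sin_pos_of_pos_of_lt_pi (by linarith) (by linarith)
    have hre' := Complex.norm_mul_cos_arg (rayPt lp θ r)
    have him' := Complex.norm_mul_sin_arg (rayPt lp θ r)
    have hne : rayPt lp θ r ≠ 0 := by
      intro h0
      rw [h0, Complex.arg_zero] at hlt
      linarith
    have hpos : 0 < ‖rayPt lp θ r‖ := norm_pos_iff.2 hne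
    have hprod := mul_pos hpos hs
    rw [Real.sin_sub, mul_sub, ← mul_assoc, ← mul_assoc, hre', him', rayPt_re, rayPt_im] at hprod
    have hsub : Real.sin (θ - θ₀) ≤ 0 :=
      Real.sin_nonpos_of_nonpos_of_neg_pi_le (by linarith [hθ.2]) (by linarith [hθ.1, Real.pi_pos])
    rw [Real.sin_sub] at hsub
    have hs0 : 0 ≤ Real.sin θ₀ := Real.sin_nonneg_of_nonneg_of_le_pi hθ₀0.le hθ₀
    nlinarith [mul_nonneg hlp.le hs0]
  have h4 : 0 ≤ (rayPt lp θ r ^ (βp : ℂ)).re := by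
    rw [Complex.cpow_ofReal_re]
    refine mul_nonneg (by positivity) (Real.cos_nonneg_of_neg_pi_div_two_le_of_le ?_ ?_)
    · have := mul_nonneg harg0 hβp.1.le
      linarith [Real.pi_pos]
    · exact (mul_le_mul_of_nonneg_right harg hβp.1.le).trans hθ₀β
  rw [norm_tsF, ← Real.exp_add]
  refine Real.exp_le_exp.2 ?_
  have e1 := mul_le_mul_of_nonneg_left h1 hx
  have e2 := mul_nonneg hap h4
  have e3 := mul_le_mul_of_nonneg_left ((mul_le_mul_of_nonneg_left h3 hκ.le).trans h2) ham
  push_cast at e3 ⊢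
  linarith

/-- The bound on rays that point to the left. -/
theorem norm_tsF_le_of_cos_le (hap : 0 ≤ ap) (ham : 0 ≤ am)
    (hβp : βp ∈ Ioo (0 : ℝ) 1) (hβm : βm ∈ Ioo (0 : ℝ) 1) (hlp : 0 < lp) (hlm : 0 < lm)
    (hx : 0 < x) {k : ℝ} (hk : 0 < k) :
    ∃ M : ℝ, 0 ≤ M ∧ ∀ θ r : ℝ, Real.cos θ ≤ -k → 0 < r →
      ‖tsF ap βp am βm (lp + lm) x (rayPt lp θ r)‖ ≤ M * Real.exp (-(x * k / 2 * r)) := by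
  -- To the left of the vertical w^βp may have negative real part; half of the decay rate xk of
  -- e^{xw} absorbs it.
  obtain ⟨C, hC⟩ := exists_mul_rpow_le hβp hap (ε := x * k / 2) (by positivity)
  refine ⟨Real.exp (x * lp + (x * k / 2 * lp + C)), (Real.exp_pos _).le, fun θ r hcos hr => ?_⟩
  have hre := re_sub_rayPt hr.le (by linarith : Real.cos θ ≤ 0) lp lm
  have h2 := re_cpow_ge (hlm.le.trans hre) hβm
  have hκ := cos_half_pi_mul_pos hβm
  have h3 : 0 ≤ ((((lp + lm : ℝ) : ℂ) - rayPt lp θ r) ^ (βm : ℂ)).re :=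
    le_trans (by positivity) h2
  have h4 := neg_rpow_le_re_cpow (rayPt lp θ r) βp
  have h5 : ‖rayPt lp θ r‖ ^ βp ≤ (lp + r) ^ βp :=
    Real.rpow_le_rpow (norm_nonneg _) (norm_rayPt_le hlp hr θ) hβp.1.le
  have h6 := hC (lp + r) (by linarith)
  rw [norm_tsF, ← Real.exp_add]
  refine Real.exp_le_exp.2 ?_
  rw [rayPt_re]
  have e1 : x * (lp + r * Real.cos θ) ≤ x * lp - x * k * r := by
    have := mul_le_mul_of_nonneg_left hcos (mul_nonneg hx.le hr.le)
    linarith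
  have e2 := mul_nonneg ham h3
  have e3 : -(ap * (rayPt lp θ r ^ (βp : ℂ)).re) ≤ ap * (lp + r) ^ βp := by
    have := mul_le_mul_of_nonneg_left (show -(rayPt lp θ r ^ (βp : ℂ)).re ≤ (lp + r) ^ βp by
      linarith) hap
    linarith
  linarith

/-- The derivative of `tsF`. -/
noncomputable def tsFDeriv (ap βp am βm L x : ℝ) (w : ℂ) : ℂ :=
  tsF ap βp am βm L x w *
    (x - ap * (βp * w ^ ((βp - 1 : ℝ) : ℂ)) + am * (βm * (L - w) ^ ((βm - 1 : ℝ) : ℂ)))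

theorem hasDerivAt_tsF (ap βp am βm L x : ℝ) {w : ℂ} (hw : w ∈ Complex.slitPlane)
    (hw' : (L : ℂ) - w ∈ Complex.slitPlane) :
    HasDerivAt (tsF ap βp am βm L x) (tsFDeriv ap βp am βm L x w) w := by
  have d1 := ((hasDerivAt_id w).cpow_const (c := (βp : ℂ)) hw).const_mul (ap : ℂ)
  have d2 := (((hasDerivAt_id w).const_sub (L : ℂ)).cpow_const (c := (βm : ℂ)) hw').const_mul
    (am : ℂ)
  have d3 := (hasDerivAt_id w).const_mul (x : ℂ)
  refine ((d3.sub d1).sub d2).cexp.congr_deriv ?_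
  simp only [tsFDeriv, tsF, Pi.sub_apply, id]
  push_cast
  ring

theorem measurable_tsFDeriv (ap βp am βm L x : ℝ) : Measurable (tsFDeriv ap βp am βm L x) := by
  unfold tsFDeriv
  have h1 : Measurable fun w : ℂ => w ^ ((βp - 1 : ℝ) : ℂ) := measurable_id.pow_const _
  have h2 : Measurable fun w : ℂ => ((L : ℂ) - w) ^ ((βm - 1 : ℝ) : ℂ) :=
    (measurable_const.sub measurable_id).pow_const _
  have h3 := measurable_tsF ap βp am βm L x
  fun_prop

theorem hasDerivAt_rayIntegral_tsF (hap : 0 ≤ ap) (ham : 0 ≤ am)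
    (hβp : βp ∈ Ioo (0 : ℝ) 1) (hβm : βm ∈ Ioo (0 : ℝ) 1) (hlp : 0 < lp) (hlm : 0 < lm)
    (hx : 0 < x) {θ₀ : ℝ} (hθ₀ : θ₀ ∈ Ioo (Real.pi / 2) Real.pi) :
    HasDerivAt (rayIntegral (tsF ap βp am βm (lp + lm) x) lp) 0 θ₀ := by
  have hc0 : Real.cos θ₀ < 0 :=
    Real.cos_neg_of_pi_div_two_lt_of_lt hθ₀.1 (by linarith [hθ₀.2, Real.pi_pos])
  have hs0 : 0 < Real.sin θ₀ :=
    Real.sin_pos_of_pos_of_lt_pi (by linarith [hθ₀.1, Real.pi_pos]) hθ₀.2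
  obtain ⟨M, hM, hMb⟩ := norm_tsF_le_of_cos_le hap ham hβp hβm hlp hlm hx
    (k := -Real.cos θ₀ / 2) (by linarith)
  set K := x + ap * (βp * (lp * (Real.sin θ₀ / 2)) ^ (βp - 1)) + am * (βm * lm ^ (βm - 1)) with hK
  have hβp0 := hβp.1
  have hβm0 := hβm.1
  have hK0 : 0 ≤ K := by positivity
  -- On this neighbourhood the rays lean uniformly to the left, which gives one exponential
  -- majorant, and they stay away from 0 and off the cut.
  have hs : {θ | Real.cos θ < Real.cos θ₀ / 2} ∩ {θ | Real.sin θ₀ / 2 < Real.sin θ} ∈ 𝓝 θ₀ := by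
    refine inter_mem ?_ ?_
    · exact Real.continuous_cos.continuousAt.eventually_lt continuousAt_const (by linarith)
    · exact continuousAt_const.eventually_lt Real.continuous_sin.continuousAt (by linarith)
  refine hasDerivAt_rayIntegral (F' := tsFDeriv ap βp am βm (lp + lm) x) (M := M * (1 + K))
    (κ := x * (-Real.cos θ₀ / 2) / 2) hs (by nlinarith) (measurable_tsF _ _ _ _ _ _)
    (measurable_tsFDeriv _ _ _ _ _ _) ?_ ?_ ?_
  · rintro θ ⟨hcos, hsin⟩ r hr
    simp only [mem_ofPred_eq] at hcos hsin
    refine hasDerivAt_tsF _ _ _ _ _ _ (Or.inr ?_) (Or.inl ?_)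
    · rw [rayPt_im]
      have : 0 < Real.sin θ := by linarith
      positivity
    · exact hlm.trans_le (re_sub_rayPt hr.le (by linarith) lp lm)
  · rintro θ ⟨hcos, hsin⟩ r hr
    simp only [mem_ofPred_eq] at hcos hsin
    refine (hMb θ r (by linarith) hr).trans ?_
    exact mul_le_mul_of_nonneg_right (by nlinarith) (Real.exp_pos _).le
  · rintro θ ⟨hcos, hsin⟩ r hr
    simp only [mem_ofPred_eq] at hcos hsin
    have hb := hMb θ r (by linarith) hr
    have h1 : ‖rayPt lp θ r ^ ((βp - 1 : ℝ) : ℂ)‖ ≤ (lp * (Real.sin θ₀ / 2)) ^ (βp - 1) := by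
      rw [Complex.norm_cpow_real]
      refine Real.rpow_le_rpow_of_nonpos (by positivity) ?_ (by linarith [hβp.2])
      refine le_trans ?_ (mul_sin_le_norm_rayPt hlp r θ (by linarith))
      exact mul_le_mul_of_nonneg_left hsin.le hlp.le
    have h2 : ‖(((lp + lm : ℝ) : ℂ) - rayPt lp θ r) ^ ((βm - 1 : ℝ) : ℂ)‖ ≤ lm ^ (βm - 1) := by
      rw [Complex.norm_cpow_real]
      refine Real.rpow_le_rpow_of_nonpos hlm ?_ (by linarith [hβm.2])
      exact (re_sub_rayPt hr.le (by linarith) lp lm).trans (Complex.re_le_norm _)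
    rw [tsFDeriv, norm_mul]
    have h3 : ‖(x : ℂ) - ap * (βp * rayPt lp θ r ^ ((βp - 1 : ℝ) : ℂ)) +
        am * (βm * (((lp + lm : ℝ) : ℂ) - rayPt lp θ r) ^ ((βm - 1 : ℝ) : ℂ))‖ ≤ K := by
      refine (norm_add_le _ _).trans (add_le_add ((norm_sub_le _ _).trans (add_le_add ?_ ?_)) ?_)
      · rw [Complex.norm_real, Real.norm_of_nonneg hx.le]
      · rw [norm_mul, norm_mul, Complex.norm_real, Complex.norm_real, Real.norm_of_nonneg hap,
          Real.norm_of_nonneg hβp0.le]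
        gcongr
      · rw [norm_mul, norm_mul, Complex.norm_real, Complex.norm_real, Real.norm_of_nonneg ham,
          Real.norm_of_nonneg hβm0.le]
        gcongr
    calc _ ≤ (M * Real.exp (-(x * (-Real.cos θ₀ / 2) / 2 * r))) * K :=
          mul_le_mul hb h3 (norm_nonneg _) (by positivity)
      _ ≤ _ := by
        have : 0 ≤ M * Real.exp (-(x * (-Real.cos θ₀ / 2) / 2 * r)) := by positivity
        nlinarith

/-- On the negative axis the principal logarithm is continuous from the upper half-plane only, and
the rotating rays approach the cut from that side. -/
theorem continuousWithinAt_tsF (ap βp am βm L x : ℝ) {w : ℂ} (hw : w ≠ 0)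
    (hw' : (L : ℂ) - w ∈ Complex.slitPlane) :
    ContinuousWithinAt (tsF ap βp am βm L x) {w | 0 ≤ w.im} w := by
  have h1 : ContinuousWithinAt (fun w : ℂ => w ^ (βp : ℂ)) {w | 0 ≤ w.im} w := by
    by_cases hs : w ∈ Complex.slitPlane
    · exact (ContinuousAt.cpow continuousAt_id continuousAt_const hs).continuousWithinAt
    · have hlog : ContinuousWithinAt Complex.log {w | 0 ≤ w.im} w := by
        rw [Complex.mem_slitPlane_iff, not_or, not_lt, not_not] at hs
        refine Complex.continuousWithinAt_log_of_re_neg_of_im_zero (lt_of_le_of_ne hs.1 ?_) hs.2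
        intro h
        exact hw (Complex.ext h hs.2)
      have h2 : ContinuousWithinAt (fun w : ℂ => Complex.exp (Complex.log w * βp))
          {w | 0 ≤ w.im} w := (hlog.mul continuousWithinAt_const).cexp
      refine h2.congr_of_eventuallyEq ?_ (by rw [Complex.cpow_def_of_ne_zero hw])
      filter_upwards [mem_nhdsWithin_of_mem_nhds (isOpen_ne.mem_nhds hw)] with z hz
      rw [Complex.cpow_def_of_ne_zero hz]
  have h2 : ContinuousWithinAt (fun w : ℂ => ((L : ℂ) - w) ^ (βm : ℂ)) {w | 0 ≤ w.im} w :=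
    (ContinuousAt.cpow (continuousAt_const.sub continuousAt_id) continuousAt_const
      hw').continuousWithinAt
  unfold tsF
  fun_prop

theorem tendsto_tsF_rayPt {r θ₀ : ℝ} (hlm : 0 < lm) (hr : 0 < r)
    (hθ₀ : θ₀ ∈ Icc (Real.pi / 2) Real.pi) (hne : rayPt lp θ₀ r ≠ 0) {s : Set ℝ}
    (hs : s ⊆ Icc (Real.pi / 2) Real.pi) :
    Tendsto (fun θ => tsF ap βp am βm (lp + lm) x (rayPt lp θ r) * Complex.exp (θ * Complex.I))
      (𝓝[s] θ₀)
      (𝓝 (tsF ap βp am βm (lp + lm) x (rayPt lp θ₀ r) * Complex.exp (θ₀ * Complex.I))) := by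
  have hcos : Real.cos θ₀ ≤ 0 :=
    Real.cos_nonpos_of_pi_div_two_le_of_le hθ₀.1 (by linarith [hθ₀.2, Real.pi_pos])
  have h1 := continuousWithinAt_tsF ap βp am βm (lp + lm) x hne
    (Or.inl (hlm.trans_le (re_sub_rayPt hr.le hcos lp lm)))
  have h2 : ContinuousWithinAt (fun θ => rayPt lp θ r) s θ₀ :=
    (hasDerivAt_rayPt_angle lp θ₀ r).continuousAt.continuousWithinAt
  have h3 : ContinuousWithinAt (fun θ => tsF ap βp am βm (lp + lm) x (rayPt lp θ r)) s θ₀ := by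
    refine ContinuousWithinAt.comp (f := fun θ => rayPt lp θ r) h1 h2 fun θ hθ => ?_
    have hθ' := hs hθ
    simp only [mem_ofPred_eq]
    rw [rayPt_im]
    exact mul_nonneg hr.le (Real.sin_nonneg_of_nonneg_of_le_pi
      (by linarith [hθ'.1, Real.pi_pos]) hθ'.2)
  exact h3.mul (hasDerivAt_cexp_mul_I θ₀).continuousAt.continuousWithinAt

theorem integrableOn_exp_neg_mul_rpow {k β : ℝ} (hk : 0 < k) (hβ : 0 < β) (C : ℝ) :
    IntegrableOn (fun r : ℝ => C * Real.exp (-k * r ^ β)) (Ioi 0) := by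
  have := (integrableOn_rpow_mul_exp_neg_mul_rpow (p := β) (s := 0) (by norm_num) hβ hk).const_mul C
  simpa [IntegrableOn] using this

theorem tendsto_rayIntegral_pi_div_two (hap : 0 ≤ ap) (ham : 0 < am)
    (hβp : βp ∈ Ioo (0 : ℝ) 1) (hβm : βm ∈ Ioo (0 : ℝ) 1) (hlp : 0 < lp) (hlm : 0 < lm)
    (hx : 0 < x) :
    Tendsto (rayIntegral (tsF ap βp am βm (lp + lm) x) lp) (𝓝[>] (Real.pi / 2))
      (𝓝 (rayIntegral (tsF ap βp am βm (lp + lm) x) lp (Real.pi / 2))) := by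
  have hpi := Real.pi_pos
  -- As θ tends to π/2 the decay of e^{xw} degenerates, so the majorant uses the a₋ term instead.
  -- This requires Re w^βp ≥ 0, which holds for arguments up to π/(2βp); that bound exceeds π/2
  -- since βp < 1.
  set θ₀ := min Real.pi (Real.pi / 2 / βp) with hθ₀
  have h1 : θ₀ ≤ Real.pi := min_le_left _ _
  have h2 : θ₀ * βp ≤ Real.pi / 2 := by
    have : θ₀ ≤ Real.pi / 2 / βp := min_le_right _ _
    rwa [le_div_iff₀ hβp.1] at this
  have h3 : Real.pi / 2 < θ₀ := by
    refine lt_min (by linarith) ?_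
    rw [lt_div_iff₀ hβp.1]
    nlinarith [hβp.2]
  have hs : Ioo (Real.pi / 2) θ₀ ∈ 𝓝[>] (Real.pi / 2) := Ioo_mem_nhdsGT h3
  rw [← nhdsWithin_Ioo_eq_nhdsGT h3]
  refine tendsto_integral_filter_of_dominated_convergence (fun r => Real.exp (x * lp) *
    Real.exp (-(am * Real.cos (Real.pi / 2 * βm)) * r ^ βm)) ?_ ?_
    (integrableOn_exp_neg_mul_rpow (mul_pos ham (cos_half_pi_mul_pos hβm)) hβm.1 _) ?_
  · exact Eventually.of_forall fun θ => (((measurable_tsF _ _ _ _ _ _).comp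
      (measurable_rayPt _ θ)).mul measurable_const).aestronglyMeasurable
  · filter_upwards [self_mem_nhdsWithin] with θ hθ
    refine (ae_restrict_iff' measurableSet_Ioi).2 (Eventually.of_forall fun r hr => ?_)
    rw [norm_mul, norm_cexp_mul_I, mul_one]
    exact norm_tsF_le_of_arg_le hx.le hap ham.le hβp hβm hlp hlm h1 h2 ⟨hθ.1.le, hθ.2.le⟩ hr
  · refine (ae_restrict_iff' measurableSet_Ioi).2 (Eventually.of_forall fun r hr => ?_)
    refine tendsto_tsF_rayPt hlm hr ⟨le_rfl, by linarith⟩ ?_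
      (fun θ hθ => ⟨hθ.1.le, hθ.2.le.trans h1⟩)
    intro h0
    have := rayPt_re lp (Real.pi / 2) r
    rw [h0, Real.cos_pi_div_two] at this
    simp at this
    linarith

theorem tendsto_rayIntegral_pi (hap : 0 ≤ ap) (ham : 0 < am)
    (hβp : βp ∈ Ioo (0 : ℝ) 1) (hβm : βm ∈ Ioo (0 : ℝ) 1) (hlp : 0 < lp) (hlm : 0 < lm)
    (hx : 0 < x) :
    Tendsto (rayIntegral (tsF ap βp am βm (lp + lm) x) lp) (𝓝[<] Real.pi)
      (𝓝 (rayIntegral (tsF ap βp am βm (lp + lm) x) lp Real.pi)) := by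
  have hpi := Real.pi_pos
  obtain ⟨M, hM, hMb⟩ := norm_tsF_le_of_cos_le hap ham.le hβp hβm hlp hlm hx
    (k := 1 / 2) (by norm_num)
  have h3 : Real.pi / 2 < Real.pi := by linarith
  rw [← nhdsWithin_Ioo_eq_nhdsLT h3]
  refine tendsto_integral_filter_of_dominated_convergence
    (fun r => M * Real.exp (-(x * (1 / 2) / 2 * r))) ?_ ?_ ?_ ?_
  · exact Eventually.of_forall fun θ => (((measurable_tsF _ _ _ _ _ _).comp
      (measurable_rayPt _ θ)).mul measurable_const).aestronglyMeasurable
  · have : ∀ᶠ θ in 𝓝 Real.pi, Real.cos θ < -(1 / 2) :=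
      Real.continuous_cos.continuousAt.eventually_lt continuousAt_const
        (by rw [Real.cos_pi]; norm_num)
    filter_upwards [nhdsWithin_le_nhds this] with θ hθ
    refine (ae_restrict_iff' measurableSet_Ioi).2 (Eventually.of_forall fun r hr => ?_)
    rw [norm_mul, norm_cexp_mul_I, mul_one]
    exact hMb θ r hθ.le hr
  · have := (integrableOn_exp_mul_rpow (b := 0) (r := x * (1 / 2) / 2) (by norm_num)
      (by positivity)).const_mul M
    simpa [IntegrableOn] using this
  · have hae : ∀ᵐ r : ℝ, r ≠ lp := Measure.ae_ne volume lp
    refine (ae_restrict_iff' measurableSet_Ioi).2 (hae.mono fun r hne hr => ?_)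
    refine tendsto_tsF_rayPt hlm hr ⟨by linarith, le_rfl⟩ ?_
      (fun θ hθ => ⟨hθ.1.le, hθ.2.le⟩)
    intro h0
    have := rayPt_re lp Real.pi r
    rw [h0, Real.cos_pi] at this
    simp at this
    exact hne (by linarith)

theorem rayIntegral_pi_div_two_eq (hap : 0 ≤ ap) (ham : 0 < am)
    (hβp : βp ∈ Ioo (0 : ℝ) 1) (hβm : βm ∈ Ioo (0 : ℝ) 1) (hlp : 0 < lp) (hlm : 0 < lm)
    (hx : 0 < x) :
    rayIntegral (tsF ap βp am βm (lp + lm) x) lp (Real.pi / 2) =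
      rayIntegral (tsF ap βp am βm (lp + lm) x) lp Real.pi := by
  have hpi := Real.pi_pos
  have hlt : Real.pi / 2 < Real.pi := by linarith
  have hd := fun θ (hθ : θ ∈ Ioo (Real.pi / 2) Real.pi) =>
    hasDerivAt_rayIntegral_tsF (x := x) hap ham.le hβp hβm hlp hlm hx hθ
  obtain ⟨a, ha⟩ := isOpen_Ioo.exists_is_const_of_deriv_eq_zero isPreconnected_Ioo
    (fun θ hθ => (hd θ hθ).differentiableAt.differentiableWithinAt) (fun θ hθ => (hd θ hθ).deriv)
  have h1 := tendsto_rayIntegral_pi_div_two hap ham hβp hβm hlp hlm hx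
  have h2 := tendsto_rayIntegral_pi hap ham hβp hβm hlp hlm hx
  have e1 : rayIntegral (tsF ap βp am βm (lp + lm) x) lp (Real.pi / 2) = a := by
    refine tendsto_nhds_unique h1 (tendsto_const_nhds.congr' ?_)
    filter_upwards [Ioo_mem_nhdsGT hlt] with θ hθ using (ha θ hθ).symm
  have e2 : rayIntegral (tsF ap βp am βm (lp + lm) x) lp Real.pi = a := by
    refine tendsto_nhds_unique h2 (tendsto_const_nhds.congr' ?_)
    filter_upwards [Ioo_mem_nhdsLT hlt] with θ hθ using (ha θ hθ).symm
  rw [e1, e2]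

end kernel

theorem tsA_pos {α β : ℝ} (hα : 0 < α) (hβ : β ∈ Ioo (0 : ℝ) 1) : 0 < tsA α β := by
  have h : Real.Gamma (1 - β) = -β * Real.Gamma (-β) := by
    rw [← Real.Gamma_add_one (neg_ne_zero.2 hβ.1.ne')]; congr 1; ring
  have h1 : 0 < Real.Gamma (1 - β) := Real.Gamma_pos_of_pos (by linarith [hβ.2])
  have h2 : Real.Gamma (-β) < 0 := by
    by_contra! h0
    have := mul_nonneg hβ.1.le h0
    linarith
  rw [tsA]
  nlinarith

section kernel

variable {ap βp am βm lp lm x : ℝ}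

theorem rayPt_pi_div_two (l r : ℝ) : rayPt l (Real.pi / 2 : ℝ) r = l + Complex.I * r := by
  rw [rayPt]
  push_cast
  rw [Complex.exp_pi_div_two_mul_I, mul_comm]

theorem tsF_conj (hlp : 0 < lp) (hlm : 0 < lm) (u : ℝ) :
    tsF ap βp am βm (lp + lm) x (lp - Complex.I * u) =
      (starRingEnd ℂ) (tsF ap βp am βm (lp + lm) x (lp + Complex.I * u)) := by
  have h1 : ((lp : ℂ) + Complex.I * u).arg ≠ Real.pi := by
    have : (lp : ℂ) + Complex.I * u ∈ Complex.slitPlane := Or.inl (by simpa using hlp)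
    exact (Complex.mem_slitPlane_iff_arg.1 this).1
  have h2 : (((lp + lm : ℝ) : ℂ) - (lp + Complex.I * u)).arg ≠ Real.pi := by
    have : ((lp + lm : ℝ) : ℂ) - (lp + Complex.I * u) ∈ Complex.slitPlane :=
      Or.inl (by simpa using hlm)
    exact (Complex.mem_slitPlane_iff_arg.1 this).1
  have c1 : (starRingEnd ℂ) ((lp : ℂ) + Complex.I * u) = lp - Complex.I * u := by
    simp [sub_eq_add_neg]
  have c2 : (starRingEnd ℂ) (((lp + lm : ℝ) : ℂ) - (lp + Complex.I * u)) =
      ((lp + lm : ℝ) : ℂ) - (lp - Complex.I * u) := by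
    rw [map_sub, c1, Complex.conj_ofReal]
  have h3 := Complex.conj_cpow _ (βp : ℂ) h1
  have h4 := Complex.conj_cpow _ (βm : ℂ) h2
  rw [c1, Complex.conj_ofReal] at h3
  rw [c2, Complex.conj_ofReal] at h4
  rw [tsF, tsF, ← Complex.exp_conj, map_sub, map_sub, map_mul, map_mul, map_mul, Complex.conj_ofReal,
    Complex.conj_ofReal, Complex.conj_ofReal, c1, h3, h4]

theorem integrableOn_tsF_vertical (hx : 0 ≤ x) (hap : 0 ≤ ap) (ham : 0 < am)
    (hβp : βp ∈ Ioo (0 : ℝ) 1) (hβm : βm ∈ Ioo (0 : ℝ) 1) (hlp : 0 < lp) (hlm : 0 < lm) :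
    IntegrableOn (fun u : ℝ => tsF ap βp am βm (lp + lm) x (lp + Complex.I * u)) (Ioi 0) := by
  refine Integrable.mono' (integrableOn_exp_neg_mul_rpow
    (mul_pos ham (cos_half_pi_mul_pos hβm)) hβm.1 (Real.exp (x * lp)))
    ((measurable_tsF _ _ _ _ _ _).comp (by fun_prop)).aestronglyMeasurable ?_
  refine (ae_restrict_iff' measurableSet_Ioi).2 (Eventually.of_forall fun r hr => ?_)
  rw [← rayPt_pi_div_two]
  refine norm_tsF_le_of_arg_le hx hap ham.le hβp hβm hlp hlm (by linarith [Real.pi_pos]) ?_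
    ⟨le_rfl, le_rfl⟩ hr
  nlinarith [Real.pi_pos, hβp.2]

theorem integrable_tsF_vertical (hx : 0 ≤ x) (hap : 0 ≤ ap) (ham : 0 < am)
    (hβp : βp ∈ Ioo (0 : ℝ) 1) (hβm : βm ∈ Ioo (0 : ℝ) 1) (hlp : 0 < lp) (hlm : 0 < lm) :
    Integrable (fun u : ℝ => tsF ap βp am βm (lp + lm) x (lp - Complex.I * u)) := by
  have h1 := integrableOn_tsF_vertical hx hap ham hβp hβm hlp hlm
  have h2 : IntegrableOn (fun u : ℝ => tsF ap βp am βm (lp + lm) x (lp - Complex.I * u))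
      (Ioi 0) := by
    refine Integrable.mono' h1.norm
      ((measurable_tsF _ _ _ _ _ _).comp (by fun_prop)).aestronglyMeasurable
      (Eventually.of_forall fun u => ?_)
    rw [tsF_conj hlp hlm, RCLike.norm_conj]
  have h3 : IntegrableOn (fun u : ℝ => tsF ap βp am βm (lp + lm) x (lp - Complex.I * u))
      (Iio 0) := by
    have h4 : IntegrableOn (fun u : ℝ => tsF ap βp am βm (lp + lm) x (lp + Complex.I * u))
      (Ioi (-0)) := by rwa [neg_zero]
    have := h4.comp_neg_Iio
    simpa [sub_eq_add_neg] using this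
  have h5 := ((integrableOn_Iic_iff_integrableOn_Iio (by simp)).2 h3).union h2
  rwa [Iic_union_Ioi, integrableOn_univ] at h5

/-- The inversion integral, moved to the branch cut. -/
theorem integral_tsF_vertical (hx : 0 < x) (hap : 0 ≤ ap) (ham : 0 < am)
    (hβp : βp ∈ Ioo (0 : ℝ) 1) (hβm : βm ∈ Ioo (0 : ℝ) 1) (hlp : 0 < lp) (hlm : 0 < lm) :
    ∫ u : ℝ, tsF ap βp am βm (lp + lm) x (lp - Complex.I * u) =
      ((-2 * ∫ s in Ioi (0 : ℝ), (tsF ap βp am βm (lp + lm) x (-(s : ℂ))).im : ℝ) : ℂ) := by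
  set F := tsF ap βp am βm (lp + lm) x with hF
  have h1 := integrableOn_tsF_vertical hx.le hap ham hβp hβm hlp hlm
  have h2 := integrable_tsF_vertical hx.le hap ham hβp hβm hlp hlm
  have e1 : ∫ u : ℝ, F (lp - Complex.I * u) =
      ((2 * (∫ u in Ioi (0 : ℝ), F (lp + Complex.I * u)).re : ℝ) : ℂ) := by
    rw [← intervalIntegral.integral_Iic_add_Ioi (b := 0) h2.integrableOn h2.integrableOn]
    have a1 : ∫ u in Iic (0 : ℝ), F (lp - Complex.I * u) =
        ∫ u in Ioi (0 : ℝ), F (lp + Complex.I * u) := by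
      have := integral_comp_neg_Iic (0 : ℝ) (fun u : ℝ => F (lp + Complex.I * u))
      rw [neg_zero] at this
      rw [← this]
      simp [sub_eq_add_neg]
    have a2 : ∫ u in Ioi (0 : ℝ), F (lp - Complex.I * u) =
        (starRingEnd ℂ) (∫ u in Ioi (0 : ℝ), F (lp + Complex.I * u)) := by
      rw [← integral_conj]
      refine integral_congr_ae (Eventually.of_forall fun u => ?_)
      exact tsF_conj hlp hlm u
    rw [a1, a2, Complex.add_conj]
  have e2 : rayIntegral F lp (Real.pi / 2) =
      Complex.I * ∫ u in Ioi (0 : ℝ), F (lp + Complex.I * u) := by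
    rw [rayIntegral, ← integral_const_mul]
    refine integral_congr_ae (Eventually.of_forall fun r => ?_)
    simp only
    rw [rayPt_pi_div_two]
    push_cast
    rw [Complex.exp_pi_div_two_mul_I, mul_comm]
  have hpt : ∀ r : ℝ, rayPt lp Real.pi r = ((lp - r : ℝ) : ℂ) := fun r => by
    rw [rayPt, Complex.exp_pi_mul_I]
    push_cast
    ring
  have h_int : IntegrableOn (fun r : ℝ => F ((lp - r : ℝ) : ℂ)) (Ioi 0) := by
    obtain ⟨M, hM, hMb⟩ := norm_tsF_le_of_cos_le hap ham.le hβp hβm hlp hlm hx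
      (k := 1) (by norm_num)
    have := (integrableOn_exp_mul_rpow (b := 0) (r := x * 1 / 2) (by norm_num)
      (by positivity)).const_mul M
    refine Integrable.mono' this
      ((measurable_tsF _ _ _ _ _ _).comp (by fun_prop)).aestronglyMeasurable ?_
    refine (ae_restrict_iff' measurableSet_Ioi).2 (Eventually.of_forall fun r hr => ?_)
    rw [← hpt, Real.rpow_zero, mul_one]
    exact hMb Real.pi r (by rw [Real.cos_pi]) hr
  have e3 : rayIntegral F lp Real.pi = -∫ r in Ioi (0 : ℝ), F ((lp - r : ℝ) : ℂ) := by
    rw [rayIntegral, ← integral_neg]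
    refine integral_congr_ae (Eventually.of_forall fun r => ?_)
    simp only
    rw [hpt, Complex.exp_pi_mul_I]
    ring
  have e4 : (∫ r in Ioi (0 : ℝ), F ((lp - r : ℝ) : ℂ)).im =
      ∫ s in Ioi (0 : ℝ), (F (-(s : ℂ))).im := by
    have a1 : (∫ r in Ioi (0 : ℝ), F ((lp - r : ℝ) : ℂ)).im =
        ∫ r in Ioi (0 : ℝ), (F ((lp - r : ℝ) : ℂ)).im := (integral_im h_int).symm
    -- On the segment between 0 and lp both bases are nonnegative reals, so `tsF` is real there and
    -- only the cut contributes.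
    have a2 : ∫ r in Ioi (0 : ℝ), (F ((lp - r : ℝ) : ℂ)).im =
        ∫ r in Ioi lp, (F ((lp - r : ℝ) : ℂ)).im := by
      refine setIntegral_eq_of_subset_of_forall_sdiff_eq_zero measurableSet_Ioi
        (Ioi_subset_Ioi hlp.le) fun r hr => ?_
      have h3 : 0 ≤ lp - r := by have : ¬ lp < r := hr.2; linarith
      have h4 : 0 ≤ lp + lm - (lp - r) := by have : 0 < r := hr.1; linarith
      rw [hF, tsF]
      rw [← Complex.ofReal_cpow h3, ← Complex.ofReal_sub, ← Complex.ofReal_cpow h4]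
      norm_cast
    have a3 : ∫ r in Ioi lp, (F ((lp - r : ℝ) : ℂ)).im =
        ∫ s in Ioi (0 : ℝ), (F (-(s : ℂ))).im := by
      have := (measurePreserving_add_right volume lp).setIntegral_preimage_emb
        (measurableEmbedding_addRight lp) (fun r => (F ((lp - r : ℝ) : ℂ)).im) (Ioi lp)
      rw [← this]
      have hpre : (fun s : ℝ => s + lp) ⁻¹' Ioi lp = Ioi 0 := by
        ext s
        simp
      rw [hpre]
      refine integral_congr_ae (Eventually.of_forall fun s => ?_)
      simp only
      rw [show lp - (s + lp) = -s by ring]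
      push_cast
      rfl
    rw [a1, a2, a3]
  have e5 := rayIntegral_pi_div_two_eq hap ham hβp hβm hlp hlm hx
  rw [← hF, e2, e3] at e5
  have e6 := congrArg Complex.im e5
  rw [Complex.neg_im, e4, Complex.I_mul_im] at e6
  rw [e1, e6]
  congr 1
  ring

/-- The principal power at -s is the upper boundary value s^βp e^{iπβp}, and it is the only non-real
ingredient of the exponent. -/
theorem im_tsF_neg (L : ℝ) (hL : 0 < L) {s : ℝ} (hs : 0 < s) :
    (tsF ap βp am βm L x (-(s : ℂ))).im =
      Real.exp (-(x * s)) * Real.exp (-(am * (L + s) ^ βm)) *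
        (Complex.exp (-(ap * s ^ βp : ℝ) * Complex.exp (βp * Real.pi * Complex.I))).im := by
  have h1 : (-(s : ℂ)) ^ (βp : ℂ) = ((s ^ βp : ℝ) : ℂ) * Complex.exp (βp * Real.pi * Complex.I) := by
    have := Complex.ofReal_cpow_of_nonpos (x := -s) (by linarith) (βp : ℂ)
    push_cast at this
    rw [this, neg_neg, Complex.ofReal_cpow hs.le]
    congr 2
    ring
  have h2 : ((L : ℂ) - -(s : ℂ)) ^ (βm : ℂ) = (((L + s) ^ βm : ℝ) : ℂ) := by
    rw [Complex.ofReal_cpow (by linarith)]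
    push_cast
    rw [sub_neg_eq_add]
  rw [tsF, h1, h2]
  have h3 : (x : ℂ) * -s - ap * (((s ^ βp : ℝ) : ℂ) * Complex.exp (βp * Real.pi * Complex.I))
      - am * (((L + s) ^ βm : ℝ) : ℂ) =
      ((-(x * s) + -(am * (L + s) ^ βm) : ℝ) : ℂ) +
        (-(ap * s ^ βp : ℝ) * Complex.exp (βp * Real.pi * Complex.I)) := by
    push_cast
    ring
  rw [h3, Complex.exp_add, ← Complex.ofReal_exp, Complex.im_ofReal_mul, Real.exp_add]

end kernel

theorem IsTS.integrable_charFun {αp βp lp αm βm lm : ℝ} {μ : Measure ℝ}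
    (h : IsTS αp βp lp αm βm lm μ) (hαp : 0 < αp) (hβp : βp ∈ Ioo (0 : ℝ) 1) (hlp : 0 < lp)
    (hαm : 0 < αm) (hβm : βm ∈ Ioo (0 : ℝ) 1) (hlm : 0 < lm) : Integrable (charFun μ) := by
  have h1 := (integrable_tsF_vertical (x := 0) le_rfl (tsA_pos hαp hβp).le (tsA_pos hαm hβm) hβp hβm
    hlp hlm).const_mul (Real.exp (tsGamma αp βp lp αm βm lm - lp * 0) : ℂ)
  refine h1.congr (Eventually.of_forall fun u => ?_)
  have := h.exp_mul_charFun hβp hlp hβm hlm 0 u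
  simp only
  rw [← this]
  simp

/-! ### Expansion of the cut integral into Laplace integrals -/

/-- The integral `∫₀^∞ e^{-xs} s^b (L + s)^c ds`. -/
noncomputable def laplaceInt (b c L x : ℝ) : ℝ :=
  ∫ s in Ioi (0 : ℝ), Real.exp (-(x * s)) * (s ^ b * (L + s) ^ c)

theorem laplaceInt_eq_tricomiInt (b c : ℝ) {L x : ℝ} (hL : 0 < L) (hx : 0 < x) :
    laplaceInt b c L x = x ^ (-(1 + b + c)) * tricomiInt b c (L * x) := by
  have h := integral_comp_mul_left_Ioi
    (fun s : ℝ => Real.exp (-s) * s ^ b * (L * x + s) ^ c) 0 hx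
  rw [mul_zero, smul_eq_mul] at h
  rw [tricomiInt, laplaceInt]
  have h2 : ∫ s in Ioi (0 : ℝ), Real.exp (-(x * s)) * (x * s) ^ b * (L * x + x * s) ^ c =
      x ^ (b + c) * ∫ s in Ioi (0 : ℝ), Real.exp (-(x * s)) * (s ^ b * (L + s) ^ c) := by
    rw [← integral_const_mul]
    refine setIntegral_congr_fun measurableSet_Ioi fun s hs => ?_
    have hs : 0 < s := hs
    rw [show L * x + x * s = x * (L + s) by ring, Real.mul_rpow hx.le hs.le,
      Real.mul_rpow hx.le (by linarith), Real.rpow_add hx]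
    ring
  rw [h2] at h
  rw [show -(1 + b + c) = -(b + c) + -1 by ring, Real.rpow_add hx, Real.rpow_neg_one, mul_assoc, ← h,
    ← mul_assoc, ← Real.rpow_add hx, neg_add_cancel, Real.rpow_zero, one_mul]

theorem HasSum.mul_of_summable_norm {R : Type*} [NormedRing R] [CompleteSpace R] {f g : ℕ → R}
    {s t : R} (hf : HasSum f s) (hg : HasSum g t) (hf' : Summable fun n => ‖f n‖)
    (hg' : Summable fun n => ‖g n‖) : HasSum (fun n : ℕ × ℕ => f n.1 * g n.2) (s * t) :=
  hf.mul hg (summable_mul_of_summable_norm hf' hg')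

theorem hasSum_exp_mul_exp (p q : ℝ) :
    HasSum (fun n : ℕ × ℕ => p ^ n.1 / n.1.factorial * (q ^ n.2 / n.2.factorial))
      (Real.exp p * Real.exp q) := by
  rw [Real.exp_eq_exp_ℝ]
  exact HasSum.mul_of_summable_norm (f := fun n => p ^ n / n.factorial)
    (g := fun n => q ^ n / n.factorial) (NormedSpace.expSeries_div_hasSum_exp p)
    (NormedSpace.expSeries_div_hasSum_exp q) (NormedSpace.norm_expSeries_div_summable p)
    (NormedSpace.norm_expSeries_div_summable q)

theorem hasSum_cexp_mul_cexp (p q : ℂ) :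
    HasSum (fun n : ℕ × ℕ => p ^ n.1 / n.1.factorial * (q ^ n.2 / n.2.factorial))
      (Complex.exp p * Complex.exp q) := by
  rw [Complex.exp_eq_exp_ℂ]
  exact HasSum.mul_of_summable_norm (f := fun n => p ^ n / n.factorial)
    (g := fun n => q ^ n / n.factorial) (NormedSpace.expSeries_div_hasSum_exp p)
    (NormedSpace.expSeries_div_hasSum_exp q) (NormedSpace.norm_expSeries_div_summable p)
    (NormedSpace.norm_expSeries_div_summable q)

section expansion

variable {A B βp βm L x : ℝ}

theorem integrableOn_exp_rpow_mul_exp_rpow (hA : 0 ≤ A) (hB : 0 ≤ B) (hβp : βp ∈ Ioo (0 : ℝ) 1)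
    (hβm : βm ∈ Ioo (0 : ℝ) 1) (hL : 0 < L) (hx : 0 < x) :
    IntegrableOn (fun s : ℝ => Real.exp (-(x * s)) *
      (Real.exp (A * s ^ βp) * Real.exp (B * (L + s) ^ βm))) (Ioi 0) := by
  obtain ⟨C, hC⟩ := exists_mul_rpow_le hβp hA (show 0 < x / 4 by positivity)
  obtain ⟨D, hD⟩ := exists_mul_rpow_le hβm hB (show 0 < x / 4 by positivity)
  have h := (integrableOn_exp_mul_rpow (b := 0) (r := x / 2) (by norm_num)
    (by positivity)).const_mul (Real.exp (C + D + x / 4 * L))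
  refine Integrable.mono' h (by fun_prop) ?_
  refine (ae_restrict_iff' measurableSet_Ioi).2 (Eventually.of_forall fun s hs => ?_)
  have hs : 0 < s := hs
  rw [Real.norm_of_nonneg (by positivity), Real.rpow_zero, mul_one, ← Real.exp_add, ← Real.exp_add,
    ← Real.exp_add]
  refine Real.exp_le_exp.2 ?_
  have h1 := hC s hs.le
  have h2 := hD (L + s) (by linarith)
  linarith

theorem aestronglyMeasurable_laplace (b c : ℝ) :
    AEStronglyMeasurable (fun s : ℝ => Real.exp (-(x * s)) * (s ^ b * (L + s) ^ c))
      (volume.restrict (Ioi 0)) := by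
  refine Measurable.aestronglyMeasurable ?_
  fun_prop

theorem integrableOn_laplace (hβp : βp ∈ Ioo (0 : ℝ) 1)
    (hβm : βm ∈ Ioo (0 : ℝ) 1) (hL : 0 < L) (hx : 0 < x) (n : ℕ × ℕ) :
    IntegrableOn (fun s : ℝ => Real.exp (-(x * s)) * (s ^ (βp * n.1) * (L + s) ^ (βm * n.2)))
      (Ioi 0) := by
  have h := (integrableOn_exp_rpow_mul_exp_rpow zero_le_one zero_le_one hβp hβm hL hx).const_mul
    ((n.1.factorial : ℝ) * n.2.factorial)
  refine Integrable.mono' h (aestronglyMeasurable_laplace _ _) ?_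
  refine (ae_restrict_iff' measurableSet_Ioi).2 (Eventually.of_forall fun s hs => ?_)
  have hs : 0 < s := hs
  have hLs : 0 < L + s := by linarith
  rw [Real.norm_of_nonneg (by positivity), Real.rpow_mul_natCast hs.le,
    Real.rpow_mul_natCast hLs.le]
  -- Each monomial is at most n! times the exponential, so integrability of every term follows from
  -- that of the full product of exponentials.
  have h1 := Real.pow_div_factorial_le_exp (s ^ βp) (by positivity) n.1
  have h2 := Real.pow_div_factorial_le_exp ((L + s) ^ βm) (by positivity) n.2
  rw [div_le_iff₀ (by positivity)] at h1 h2
  calc Real.exp (-(x * s)) * ((s ^ βp) ^ n.1 * ((L + s) ^ βm) ^ n.2)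
      ≤ Real.exp (-(x * s)) * ((Real.exp (s ^ βp) * n.1.factorial) *
        (Real.exp ((L + s) ^ βm) * n.2.factorial)) := by gcongr
    _ = _ := by rw [one_mul, one_mul]; ring

theorem laplaceInt_nonneg (b c : ℝ) (hL : 0 < L) : 0 ≤ laplaceInt b c L x := by
  refine setIntegral_nonneg measurableSet_Ioi fun s hs => ?_
  have hs : 0 < s := hs
  positivity

/-- All terms are nonnegative, and every finite sum is the integral of a partial sum of the double
exponential series, hence at most the integral of the product of exponentials. This majorant serves
both the interchange of sum and integral and the triple series. -/
theorem summable_laplaceInt (hA : 0 ≤ A) (hB : 0 ≤ B) (hβp : βp ∈ Ioo (0 : ℝ) 1)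
    (hβm : βm ∈ Ioo (0 : ℝ) 1) (hL : 0 < L) (hx : 0 < x) :
    Summable fun n : ℕ × ℕ => A ^ n.1 / n.1.factorial * (B ^ n.2 / n.2.factorial) *
      laplaceInt (βp * n.1) (βm * n.2) L x := by
  refine summable_of_sum_le (c := ∫ s in Ioi (0 : ℝ), Real.exp (-(x * s)) *
    (Real.exp (A * s ^ βp) * Real.exp (B * (L + s) ^ βm)))
    (fun n => mul_nonneg (by positivity) (laplaceInt_nonneg _ _ hL)) fun u => ?_
  simp only [laplaceInt]
  simp_rw [← integral_const_mul]
  rw [← integral_finsetSum _ fun n _ => (integrableOn_laplace hβp hβm hL hx n).const_mul _]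
  refine setIntegral_mono_on
    (integrable_finsetSum _ fun n _ => (integrableOn_laplace hβp hβm hL hx n).const_mul _)
    (integrableOn_exp_rpow_mul_exp_rpow hA hB hβp hβm hL hx) measurableSet_Ioi fun s hs => ?_
  have hs : 0 < s := hs
  have hLs : 0 < L + s := by linarith
  have h1 := sum_le_hasSum u (fun n _ => by positivity)
    (hasSum_exp_mul_exp (A * s ^ βp) (B * (L + s) ^ βm))
  refine le_trans (le_of_eq ?_) (mul_le_mul_of_nonneg_left h1 (Real.exp_pos (-(x * s))).le)
  rw [Finset.mul_sum]
  refine Finset.sum_congr rfl fun n _ => ?_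
  rw [Real.rpow_mul_natCast hs.le, Real.rpow_mul_natCast hLs.le, mul_pow, mul_pow]
  ring

theorem hasSum_integral_im_tsF {ap am : ℝ} (hβp : βp ∈ Ioo (0 : ℝ) 1)
    (hβm : βm ∈ Ioo (0 : ℝ) 1) (hL : 0 < L) (hx : 0 < x) :
    HasSum (fun n : ℕ × ℕ => (-ap) ^ n.1 / n.1.factorial * ((-am) ^ n.2 / n.2.factorial) *
        Real.sin (Real.pi * (βp * n.1)) * laplaceInt (βp * n.1) (βm * n.2) L x)
      (∫ s in Ioi (0 : ℝ), (tsF ap βp am βm L x (-(s : ℂ))).im) := by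
  set F : ℕ × ℕ → ℝ → ℝ := fun n s => ((-ap) ^ n.1 / n.1.factorial *
    ((-am) ^ n.2 / n.2.factorial) * Real.sin (Real.pi * (βp * n.1))) *
      (Real.exp (-(x * s)) * (s ^ (βp * n.1) * (L + s) ^ (βm * n.2))) with hF
  have hFi : ∀ n, Integrable (F n) (volume.restrict (Ioi 0)) := fun n =>
    (integrableOn_laplace hβp hβm hL hx n).const_mul _
  -- Bounding the sine by 1 leaves the positive series with |ap| and |am|.
  have hFs : Summable fun n => ∫ s in Ioi (0 : ℝ), ‖F n s‖ := by
    refine Summable.of_nonneg_of_le (fun n => integral_nonneg fun s => norm_nonneg _) (fun n => ?_)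
      (summable_laplaceInt (abs_nonneg ap) (abs_nonneg am) hβp hβm hL hx)
    rw [laplaceInt, ← integral_const_mul]
    refine setIntegral_mono_on (hFi n).norm ((integrableOn_laplace hβp hβm hL hx n).const_mul _)
      measurableSet_Ioi fun s hs => ?_
    have hs : 0 < s := hs
    have hLs : 0 < L + s := by linarith
    have h0 : 0 ≤ Real.exp (-(x * s)) * (s ^ (βp * n.1) * (L + s) ^ (βm * n.2)) := by positivity
    rw [hF, norm_mul, Real.norm_of_nonneg h0]
    refine mul_le_mul_of_nonneg_right ?_ h0
    rw [norm_mul, norm_mul, norm_div, norm_div, norm_pow, norm_pow, norm_neg, norm_neg,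
      Real.norm_natCast, Real.norm_natCast, Real.norm_eq_abs, Real.norm_eq_abs, Real.norm_eq_abs]
    exact mul_le_of_le_one_right (by positivity) (Real.abs_sin_le_one _)
  have h := hasSum_integral_of_summable_integral_norm hFi hFs
  have e1 : ∀ n, ∫ s in Ioi (0 : ℝ), F n s = (-ap) ^ n.1 / n.1.factorial *
      ((-am) ^ n.2 / n.2.factorial) * Real.sin (Real.pi * (βp * n.1)) *
        laplaceInt (βp * n.1) (βm * n.2) L x := fun n => by
    rw [laplaceInt, ← integral_const_mul]
  have e2 : ∫ s in Ioi (0 : ℝ), ∑' n, F n s =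
      ∫ s in Ioi (0 : ℝ), (tsF ap βp am βm L x (-(s : ℂ))).im := by
    refine setIntegral_congr_fun measurableSet_Ioi fun s hs => ?_
    have hs : 0 < s := hs
    have hLs : 0 < L + s := by linarith
    refine HasSum.tsum_eq ?_
    have h1 := (Complex.hasSum_im (hasSum_cexp_mul_cexp
      (-(ap * s ^ βp : ℝ) * Complex.exp (βp * Real.pi * Complex.I))
      ((-(am * (L + s) ^ βm) : ℝ) : ℂ))).mul_left (Real.exp (-(x * s)))
    rw [im_tsF_neg L hL hs]
    convert! h1 using 1
    · funext n
      -- The n-th power of e^{iπβp} has imaginary part sin(π βp n); everything else in the term is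
      -- real.
      have h2 : (-(ap * s ^ βp : ℝ) * Complex.exp (βp * Real.pi * Complex.I)) ^ n.1 /
          (n.1.factorial : ℂ) * (((-(am * (L + s) ^ βm) : ℝ) : ℂ) ^ n.2 / (n.2.factorial : ℂ)) =
          (((-(ap * s ^ βp)) ^ n.1 / n.1.factorial *
            ((-(am * (L + s) ^ βm)) ^ n.2 / n.2.factorial) : ℝ) : ℂ) *
            Complex.exp ((Real.pi * (βp * n.1) : ℝ) * Complex.I) := by
        rw [mul_pow, ← Complex.exp_nat_mul]
        push_cast
        rw [show (n.1 : ℂ) * (βp * Real.pi * Complex.I) = Real.pi * (βp * n.1) * Complex.I by ring]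
        ring
      rw [h2, Complex.im_ofReal_mul, Complex.exp_ofReal_mul_I_im, hF]
      simp only
      rw [Real.rpow_mul_natCast hs.le, Real.rpow_mul_natCast hLs.le, neg_mul_eq_neg_mul ap, mul_pow,
        neg_mul_eq_neg_mul am, mul_pow]
      ring
    · rw [← Complex.ofReal_exp, Complex.im_mul_ofReal]
      ring
  rw [e2] at h
  simpa only [e1] using h

end expansion

/-! ### Matching the expansion with the terms of the series -/

theorem inv_Gamma_mul_Gamma_neg (b : ℝ) :
    (Real.Gamma (1 + b) * Real.Gamma (-b))⁻¹ = -(Real.sin (Real.pi * b) / Real.pi) := by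
  have h := Real.Gamma_mul_Gamma_one_sub (-b)
  rw [sub_neg_eq_add] at h
  rw [mul_comm, h, inv_div, mul_neg, Real.sin_neg, neg_div]

theorem gammaQuot_zero_left (n : ℕ) : gammaQuot 0 n = if n = 0 then 1 else 0 := by
  rw [gammaQuot, Real.Gamma_zero, div_zero]

theorem gammaQuot_succ {z : ℝ} (hz : NotInt z) (n : ℕ) :
    gammaQuot z (n + 1) = (z + n) * gammaQuot z n := by
  have h : ∀ m, gammaQuot z m = Real.Gamma (z + m) / Real.Gamma z := fun m => by
    rw [gammaQuot]
    split_ifs with hm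
    · rw [hm, Nat.cast_zero, add_zero, div_self hz.Gamma_ne_zero]
    · rfl
  rw [h, h, Nat.cast_add, Nat.cast_one, ← add_assoc,
    Real.Gamma_add_one (hz.add_int' n (by push_cast; ring)).ne_zero, mul_div_assoc]

/-- The rising factorial of -c is, up to sign, the falling factorial of c; this converts d⁽¹⁾ into
`tricomiCoeffReg`. -/
theorem neg_one_pow_mul_gammaQuot_neg {c : ℝ} (hc : NotInt c) (n : ℕ) :
    (-1) ^ n * gammaQuot (-c) n = Real.Gamma (1 + c) / Real.Gamma (1 + c - n) := by
  induction n with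
  | zero =>
    rw [gammaQuot, if_pos rfl, Nat.cast_zero, sub_zero, pow_zero, one_mul,
      div_self (hc.add_int' 1 (by push_cast; ring)).Gamma_ne_zero]
  | succ n ih =>
    have h1 : Real.Gamma (1 + c - n) = (c - n) * Real.Gamma (c - n) := by
      rw [← Real.Gamma_add_one (hc.add_int' (-n) (by push_cast; ring)).ne_zero]
      congr 1
      ring
    have h2 : Real.Gamma (c - n) ≠ 0 := (hc.add_int' (-n) (by push_cast; ring)).Gamma_ne_zero
    have h3 : c - n ≠ 0 := (hc.add_int' (-n) (by push_cast; ring)).ne_zero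
    rw [gammaQuot_succ (hc.int_sub' 0 (by push_cast; ring)), pow_succ,
      show (-1 : ℝ) ^ n * -1 * ((-c + n) * gammaQuot (-c) n) =
        (c - n) * ((-1) ^ n * gammaQuot (-c) n) by ring, ih, h1, Nat.cast_add, Nat.cast_one,
      show 1 + c - ((n : ℝ) + 1) = c - n by ring]
    field_simp

section inner

variable {αp βp lp αm βm lm x : ℝ}

/-- The sum over the first index of the terms of the triple series. -/
noncomputable def tsInner (αp βp lp αm βm lm x : ℝ) (n : ℕ × ℕ) : ℝ :=
  (-tsA αp βp) ^ n.1 / n.1.factorial * ((-tsA αm βm) ^ n.2 / n.2.factorial) *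
    (Real.Gamma (1 + βp * n.1) * Real.Gamma (-(βp * n.1)))⁻¹ *
      laplaceInt (βp * n.1) (βm * n.2) (lp + lm) x

/-- Separates the factor independent of n₁, common to both coefficients, from the part summed by the
connection formula. -/
theorem tsTerm_eq (n₁ n₂ n₃ : ℕ) :
    tsTerm αp βp lp αm βm lm x n₁ n₂ n₃ =
      (-tsA αp βp) ^ n₂ / n₂.factorial * ((-tsA αm βm) ^ n₃ / n₃.factorial) *
        (Real.Gamma (1 + βp * n₂) * Real.Gamma (-(βp * n₂)))⁻¹ *
      ((-1) ^ n₁ / n₁.factorial *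
        (Real.Gamma (1 - n₁ + βp * n₂ + βm * n₃) * gammaQuot (-(βm * n₃)) n₁ * (lp + lm) ^ n₁ *
            x ^ (-1 + n₁ - βp * n₂ - βm * n₃) +
          Real.Gamma (-1 - n₁ - βp * n₂ - βm * n₃) * Real.Gamma (1 + n₁ + βp * n₂) *
            (Real.Gamma (-(βm * n₃)))⁻¹ * (lp + lm) ^ (1 + n₁ + βp * n₂ + βm * n₃) * x ^ n₁)) := by
  rw [tsTerm, tsD1, tsD2, neg_pow (tsA αp βp), neg_pow (tsA αm βm), pow_add, pow_add]
  simp only [div_eq_mul_inv, mul_inv]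
  ring

theorem tsTerm_zero_mid (n₁ n₃ : ℕ) : tsTerm αp βp lp αm βm lm x n₁ 0 n₃ = 0 := by
  simp [tsTerm_eq]

/-- At n₃ = 0 the convention 1/Γ(0) = 0 removes d⁽²⁾, and the Pochhammer symbol of 0 removes d⁽¹⁾
except at n₁ = 0. -/
theorem tsTerm_zero_right (n₁ n₂ : ℕ) :
    tsTerm αp βp lp αm βm lm x n₁ n₂ 0 =
      if n₁ = 0 then (-tsA αp βp) ^ n₂ / n₂.factorial *
        (Real.Gamma (1 + βp * n₂) * Real.Gamma (-(βp * n₂)))⁻¹ *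
          (Real.Gamma (1 + βp * n₂) * x ^ (-1 - βp * n₂)) else 0 := by
  rw [tsTerm_eq]
  simp only [Nat.cast_zero, mul_zero, neg_zero, gammaQuot_zero_left, Real.Gamma_zero, inv_zero]
  split_ifs with h
  · subst h; simp
  · simp

theorem laplaceInt_zero_right {b L : ℝ} (hb : -1 < b) (hx : 0 < x) :
    laplaceInt b 0 L x = Real.Gamma (1 + b) * x ^ (-1 - b) := by
  have h := Real.integral_rpow_mul_exp_neg_mul_Ioi (a := b + 1) (r := x) (by linarith) hx
  rw [one_div, Real.inv_rpow hx.le, ← Real.rpow_neg hx.le] at h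
  rw [laplaceInt, show 1 + b = b + 1 by ring, show -1 - b = -(b + 1) by ring, mul_comm, ← h]
  refine setIntegral_congr_fun measurableSet_Ioi fun s hs => ?_
  rw [Real.rpow_zero, mul_one, add_sub_cancel_right, mul_comm]

/-- The connection formula at z = Lx, multiplied by x^{-(1+b+c)}: this factor cancels the power of x
in front of the singular series and produces the negative powers of x in d⁽¹⁾. -/
theorem hasSum_tsTerm_of_ne_zero {n₂ n₃ : ℕ} (hc : NotInt (βm * n₃))
    (hbc : NotInt (βp * n₂ + βm * n₃)) (hβp : 0 < βp) (hβm : 0 < βm) (hlp : 0 < lp) (hlm : 0 < lm)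
    (hx : 0 < x) :
    HasSum (fun n₁ => tsTerm αp βp lp αm βm lm x n₁ n₂ n₃)
      (tsInner αp βp lp αm βm lm x (n₂, n₃)) := by
  have hL : 0 < lp + lm := by positivity
  have hb : 0 ≤ βp * n₂ := by positivity
  have hc0 : 0 ≤ βm * n₃ := by positivity
  simp only [tsTerm_eq, tsInner]
  generalize (-tsA αp βp) ^ n₂ / n₂.factorial * ((-tsA αm βm) ^ n₃ / n₃.factorial) *
        (Real.Gamma (1 + βp * n₂) * Real.Gamma (-(βp * n₂)))⁻¹ = K
  generalize βp * (n₂ : ℝ) = b at *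
  generalize βm * (n₃ : ℝ) = c at *
  generalize lp + lm = L at *
  refine HasSum.mul_left K ?_
  have hz : 0 < L * x := by positivity
  rw [laplaceInt_eq_tricomiInt b c hL hx,
    tricomiInt_eq_tsum (by linarith) hc hbc (by linarith) hz]
  have h := (((summable_tricomiCoeffReg hc hbc (L * x)).hasSum.add
    ((summable_tricomiCoeffSing (b := b) (by linarith) hc hbc (L * x)).hasSum.mul_left
      ((L * x) ^ (1 + b + c)))).mul_left (x ^ (-(1 + b + c))))
  convert! h using 1
  funext n
  have hg := neg_one_pow_mul_gammaQuot_neg hc n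
  have e1 : x ^ (-1 + (n : ℝ) - b - c) = x ^ (-(1 + b + c)) * x ^ n := by
    rw [← Real.rpow_natCast x n, ← Real.rpow_add hx]
    congr 1
    ring
  have e2 : L ^ (1 + (n : ℝ) + b + c) = L ^ (1 + b + c) * L ^ n := by
    rw [← Real.rpow_natCast L n, ← Real.rpow_add hL]
    congr 1
    ring
  have e3 : x ^ (-(1 + b + c)) * (L * x) ^ (1 + b + c) = L ^ (1 + b + c) := by
    rw [Real.mul_rpow hL.le hx.le, mul_left_comm, ← Real.rpow_add hx, neg_add_cancel,
      Real.rpow_zero, mul_one]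
  rw [e1, e2, mul_add, mul_add, ← mul_assoc _ ((L * x) ^ (1 + b + c)), e3, tricomiCoeffReg,
    tricomiCoeffSing, mul_pow]
  congr 1
  · rw [show Real.Gamma (1 + c) * Real.Gamma (1 + b + c - n) /
      (n.factorial * Real.Gamma (1 + c - n)) = Real.Gamma (1 + c) / Real.Gamma (1 + c - n) *
        (Real.Gamma (1 + b + c - n) / n.factorial) by rw [div_mul_div_comm, mul_comm (n.factorial : ℝ)],
      ← hg, show 1 - (n : ℝ) + b + c = 1 + b + c - n by ring]
    ring
  · rw [div_eq_mul_inv _ (Real.Gamma (-c) * _), mul_inv]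
    ring

theorem hasSum_tsTerm (hβm' : Irrational βm)
    (hβ : ∀ m n : ℕ, 1 ≤ m → 1 ≤ n → ∀ k : ℤ, (m : ℝ) * βp + n * βm ≠ k)
    (hβp : 0 < βp) (hβm : 0 < βm) (hlp : 0 < lp) (hlm : 0 < lm) (hx : 0 < x) (n₂ n₃ : ℕ) :
    HasSum (fun n₁ => tsTerm αp βp lp αm βm lm x n₁ n₂ n₃)
      (tsInner αp βp lp αm βm lm x (n₂, n₃)) := by
  rcases Nat.eq_zero_or_pos n₂ with rfl | h2
  · simp only [tsTerm_zero_mid]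
    rw [tsInner]
    simp
  -- Here c = 0 is an integer and the connection formula is not available; the Laplace integral is a
  -- Gamma integral and equals the single surviving term.
  rcases Nat.eq_zero_or_pos n₃ with rfl | h3
  · simp only [tsTerm_zero_right]
    rw [tsInner, Nat.cast_zero, mul_zero, pow_zero, Nat.factorial_zero, Nat.cast_one, div_one,
      mul_one, laplaceInt_zero_right (by have : 0 ≤ βp * n₂ := by positivity
                                         linarith) hx]
    exact hasSum_ite_eq 0 _
  · refine hasSum_tsTerm_of_ne_zero (fun k hk => ?_) (fun k hk => ?_) hβp hβm hlp hlm hx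
    · have : Irrational (βm * n₃) := hβm'.mul_natCast h3.ne'
      exact this.ne_int k hk
    · exact hβ n₂ n₃ h2 h3 k (by rw [← hk]; ring)

theorem hasSum_tsInner (hβp : βp ∈ Ioo (0 : ℝ) 1) (hβm : βm ∈ Ioo (0 : ℝ) 1) (hlp : 0 < lp)
    (hlm : 0 < lm) (hx : 0 < x) :
    HasSum (tsInner αp βp lp αm βm lm x)
      (-(Real.pi⁻¹ * ∫ s in Ioi (0 : ℝ),
        (tsF (tsA αp βp) βp (tsA αm βm) βm (lp + lm) x (-(s : ℂ))).im)) := by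
  have h := (hasSum_integral_im_tsF (ap := tsA αp βp) (am := tsA αm βm) hβp hβm
    (show 0 < lp + lm by positivity) hx).mul_left (-Real.pi⁻¹)
  rw [neg_mul] at h
  convert! h using 1
  funext n
  rw [tsInner, inv_Gamma_mul_Gamma_neg]
  ring

end inner

/-! ### Gamma estimates in terms of the distance to the integers -/

theorem Gamma_one_add_eq_prod_mul {σ : ℝ} (hσ : NotInt σ) (n : ℕ) :
    Real.Gamma (1 + σ) = (∏ j ∈ Finset.range n, (σ - j)) * Real.Gamma (1 + σ - n) := by
  induction n with
  | zero => simp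
  | succ n ih =>
    have h1 : Real.Gamma (1 + σ - n) = (σ - n) * Real.Gamma (σ - n) := by
      rw [← Real.Gamma_add_one (hσ.add_int' (-n) (by push_cast; ring)).ne_zero]
      congr 1
      ring
    rw [ih, Finset.prod_range_succ, h1, Nat.cast_add, Nat.cast_one,
      show 1 + σ - ((n : ℝ) + 1) = σ - n by ring, mul_assoc]

theorem descFactorial_floor_le_prod_abs {σ : ℝ} (hσ : 0 ≤ σ) (n : ℕ) :
    (⌊σ⌋₊.descFactorial n : ℝ) ≤ ∏ j ∈ Finset.range n, |σ - j| := by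
  induction n with
  | zero => simp
  | succ n ih =>
    rw [Nat.descFactorial_succ, Finset.prod_range_succ, Nat.cast_mul, mul_comm]
    refine mul_le_mul ih ?_ (by positivity) (Finset.prod_nonneg fun _ _ => abs_nonneg _)
    rcases le_total n ⌊σ⌋₊ with h | h
    · rw [Nat.cast_sub h]
      exact le_trans (by linarith [Nat.floor_le hσ]) (le_abs_self _)
    · rw [Nat.sub_eq_zero_of_le h, Nat.cast_zero]
      exact abs_nonneg _

/-- Only the two integers adjacent to σ can give small factors, whence δ². The other factors compare
with two factorials, one on each side of σ; recombining them through a binomial coefficient, and the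
crude bounds on the upper side, cost at most 8^n. -/
theorem sq_mul_factorial_le_prod_abs {σ δ : ℝ} (hσ : 0 ≤ σ) (hδ : 0 < δ)
    (h : ∀ k : ℤ, δ ≤ |σ - k|) (n : ℕ) :
    δ ^ 2 * n.factorial ≤ 8 ^ n * ∏ j ∈ Finset.range n, |σ - j| := by
  set N := ⌊σ⌋₊ with hN
  set P : ℕ → ℝ := fun n => ∏ j ∈ Finset.range n, |σ - j| with hP
  have hP0 : ∀ n, 0 ≤ P n := fun n => Finset.prod_nonneg fun _ _ => abs_nonneg _
  have hPs : ∀ n, P (n + 1) = P n * |σ - n| := fun n => Finset.prod_range_succ _ _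
  have hNle : (N : ℝ) ≤ σ := Nat.floor_le hσ
  have hlt : σ < N + 1 := Nat.lt_floor_add_one σ
  have hδ1 : δ ≤ 1 := by
    have := h N
    rw [Int.cast_natCast, abs_of_nonneg (by linarith)] at this
    linarith
  have hδ2 : δ ^ 2 ≤ δ := by nlinarith
  have hδ3 : δ ^ 2 ≤ 1 := hδ2.trans hδ1
  change δ ^ 2 * n.factorial ≤ 8 ^ n * P n
  have h1 : (N.factorial : ℝ) ≤ P N := by
    have := descFactorial_floor_le_prod_abs hσ N
    rwa [← hN, Nat.descFactorial_self] at this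
  have h2 : (N.factorial : ℝ) * δ ≤ P (N + 1) := by
    rw [hPs]
    exact mul_le_mul h1 (by simpa using h N) hδ.le (hP0 _)
  have h3 : ∀ m : ℕ, (N.factorial : ℝ) * δ ^ 2 * (m + 1).factorial ≤ 2 ^ m * P (N + 2 + m) := by
    intro m
    induction m with
    | zero =>
      rw [show N + 2 + 0 = N + 1 + 1 from rfl, hPs, pow_zero, one_mul, zero_add, Nat.factorial_one,
        Nat.cast_one, mul_one, sq, ← mul_assoc]
      exact mul_le_mul h2 (by simpa using h (N + 1)) hδ.le (hP0 _)
    | succ m ih =>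
      have hf : ((m : ℝ) + 2) / 2 ≤ |σ - (N + 2 + m : ℕ)| := by
        push_cast
        rw [abs_sub_comm, abs_of_nonneg (by linarith [(Nat.cast_nonneg m : (0 : ℝ) ≤ m)])]
        linarith [(Nat.cast_nonneg m : (0 : ℝ) ≤ m)]
      rw [← add_assoc, hPs, Nat.factorial_succ (m + 1)]
      have := mul_le_mul ih hf (by positivity) (mul_nonneg (by positivity) (hP0 _))
      push_cast at this ⊢
      rw [pow_succ (2 : ℝ) m]
      linarith
  rcases le_or_gt n N with hn | hn
  · have h4 : (n.factorial : ℝ) ≤ P n := by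
      refine le_trans ?_ (descFactorial_floor_le_prod_abs hσ n)
      rw [← hN, Nat.descFactorial_eq_factorial_mul_choose]
      exact_mod_cast Nat.le_mul_of_pos_right _ (Nat.choose_pos hn)
    calc δ ^ 2 * n.factorial ≤ 1 * n.factorial := by gcongr
      _ ≤ 8 ^ n * P n := by
        refine mul_le_mul (one_le_pow₀ (by norm_num)) h4 (by positivity) (by positivity)
  · obtain ⟨m, rfl⟩ := Nat.exists_eq_add_of_lt hn
    have h5 : ((N : ℝ) + m + 1) ≤ 2 ^ (N + m + 1) := by
      exact_mod_cast (Nat.lt_two_pow_self (n := N + m + 1)).le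
    rcases m with _ | m
    · have h6 : ((N + 0 + 1).factorial : ℝ) ≤ 8 ^ (N + 0 + 1) * N.factorial := by
        rw [Nat.factorial_succ]
        push_cast
        refine mul_le_mul_of_nonneg_right ?_ (by positivity)
        refine le_trans (by simpa using h5) (pow_le_pow_left₀ (by norm_num) (by norm_num) _)
      calc δ ^ 2 * ((N + 0 + 1).factorial : ℝ) ≤ δ * (8 ^ (N + 0 + 1) * N.factorial) := by gcongr
        _ = 8 ^ (N + 0 + 1) * (N.factorial * δ) := by ring
        _ ≤ _ := by gcongr
    · have h6 : ((N + (m + 1)).factorial : ℝ) ≤ 2 ^ (N + (m + 1)) * (N.factorial * (m + 1).factorial) := by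
        rw [← Nat.add_choose_mul_factorial_mul_factorial N (m + 1)]
        push_cast
        rw [mul_assoc]
        refine mul_le_mul_of_nonneg_right ?_ (by positivity)
        exact_mod_cast Nat.choose_le_two_pow _ _
      have h7 := h3 m
      rw [show N + 2 + m = N + (m + 1) + 1 by ring] at h7
      rw [Nat.factorial_succ]
      push_cast
      push_cast at h5
      calc δ ^ 2 * (((N : ℝ) + (m + 1) + 1) * (N + (m + 1)).factorial)
          ≤ δ ^ 2 * (2 ^ (N + (m + 1) + 1) * (2 ^ (N + (m + 1)) *
            (N.factorial * (m + 1).factorial))) := by gcongr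
        _ = 2 ^ (N + (m + 1) + 1) * 2 ^ (N + (m + 1)) *
            (N.factorial * δ ^ 2 * (m + 1).factorial) := by ring
        _ ≤ 2 ^ (N + (m + 1) + 1) * 2 ^ (N + (m + 1)) * (2 ^ m * P (N + (m + 1) + 1)) := by gcongr
        _ = 2 ^ (N + (m + 1) + 1 + (N + (m + 1)) + m) * P (N + (m + 1) + 1) := by
          rw [pow_add, pow_add]; ring
        _ ≤ (2 ^ 3) ^ (N + (m + 1) + 1) * P (N + (m + 1) + 1) := by
          rw [← pow_mul]
          refine mul_le_mul_of_nonneg_right (pow_le_pow_right₀ (by norm_num) (by omega)) (hP0 _)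
        _ = _ := by norm_num

theorem NotInt.of_le_abs_sub {σ δ : ℝ} (hδ : 0 < δ) (h : ∀ k : ℤ, δ ≤ |σ - k|) : NotInt σ :=
  fun k hk => by
    have := h k
    rw [hk, sub_self, abs_zero] at this
    linarith

/-- Descending n steps by the functional equation divides by the product just bounded from below.
The resulting n! in the denominator offsets the growth of the Pochhammer symbol. -/
theorem abs_Gamma_one_add_sub_le {σ δ : ℝ} (hσ : 0 ≤ σ) (hδ : 0 < δ)
    (h : ∀ k : ℤ, δ ≤ |σ - k|) (n : ℕ) :
    |Real.Gamma (1 + σ - n)| ≤ (δ⁻¹) ^ 2 * 8 ^ n / n.factorial * Real.Gamma (1 + σ) := by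
  have h1 := Gamma_one_add_eq_prod_mul (NotInt.of_le_abs_sub hδ h) n
  have h2 := sq_mul_factorial_le_prod_abs hσ hδ h n
  have h3 : Real.Gamma (1 + σ) = (∏ j ∈ Finset.range n, |σ - j|) * |Real.Gamma (1 + σ - n)| := by
    rw [← Finset.abs_prod, ← abs_mul, ← h1,
      abs_of_nonneg (Real.Gamma_nonneg_of_nonneg (by linarith))]
  have h4 := mul_le_mul_of_nonneg_right h2 (abs_nonneg (Real.Gamma (1 + σ - n)))
  rw [mul_assoc _ (∏ j ∈ Finset.range n, |σ - j|), ← h3] at h4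
  rw [inv_pow, inv_mul_eq_div, div_div, div_mul_eq_mul_div, le_div_iff₀ (by positivity)]
  linarith

/-- The factors are at most M + 1, …, M + n in modulus, and their product is n! times a binomial
coefficient. -/
theorem abs_gammaQuot_neg_le {c : ℝ} {M : ℕ} (hc : NotInt c) (hc0 : 0 ≤ c) (hM : c ≤ M) (n : ℕ) :
    |gammaQuot (-c) n| ≤ 2 ^ (M + n) * n.factorial := by
  have h1 : |gammaQuot (-c) n| ≤ (M + 1).ascFactorial n := by
    induction n with
    | zero => simp [gammaQuot]
    | succ n ih =>
      rw [gammaQuot_succ (hc.int_sub' 0 (by push_cast; ring)), abs_mul, Nat.ascFactorial_succ,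
        Nat.cast_mul]
      refine mul_le_mul ?_ ih (abs_nonneg _) (by positivity)
      rw [abs_le]
      push_cast
      constructor <;> linarith [(Nat.cast_nonneg n : (0 : ℝ) ≤ n)]
  refine h1.trans ?_
  rw [Nat.ascFactorial_eq_factorial_mul_choose, Nat.cast_mul, mul_comm]
  refine mul_le_mul_of_nonneg_right ?_ (by positivity)
  exact_mod_cast Nat.choose_le_two_pow _ _

theorem two_mul_le_abs_sin_pi_mul {y δ : ℝ} (h : ∀ k : ℤ, δ ≤ |y - k|) :
    2 * δ ≤ |Real.sin (Real.pi * y)| := by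
  have h1 : |Real.pi * (y - round y)| = Real.pi * |y - round y| := by
    rw [abs_mul, abs_of_pos Real.pi_pos]
  have h2 := Real.mul_abs_le_abs_sin (x := Real.pi * (y - round y)) (by
    rw [h1]
    have := abs_sub_round y
    nlinarith [Real.pi_pos])
  rw [h1, mul_sub, mul_comm Real.pi (round y : ℝ), Real.sin_sub_int_mul_pi, abs_mul, abs_zpow,
    abs_neg, abs_one, one_zpow, one_mul] at h2
  refine le_trans ?_ h2
  rw [← mul_assoc, div_mul_cancel₀ _ Real.pi_pos.ne']
  linarith [h (round y)]

/-- The Beta function is at most 1 here, since its integrand on the half-line is dominated by (1 +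
t)^{-2}, of integral 1. -/
theorem Gamma_mul_Gamma_le {u v : ℝ} (hu : 1 ≤ u) (hv : 1 ≤ v) :
    Real.Gamma u * Real.Gamma v ≤ Real.Gamma (u + v) := by
  have h1 := integral_rpow_mul_one_add_rpow (b := u - 1) (c := -(u + v)) (by linarith)
    (by linarith)
  have h2 := integral_rpow_mul_one_add_rpow (b := 0) (c := -2) (by norm_num) (by norm_num)
  have i1 := integrableOn_rpow_mul_one_add_rpow (b := u - 1) (c := -(u + v)) (by linarith)
    (by linarith)
  have i2 := integrableOn_rpow_mul_one_add_rpow (b := 0) (c := -2) (by norm_num) (by norm_num)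
  have h3 := setIntegral_mono_on i1 i2 measurableSet_Ioi fun t ht => by
    have ht : 0 < t := ht
    rw [Real.rpow_zero, one_mul]
    calc t ^ (u - 1) * (1 + t) ^ (-(u + v)) ≤ (1 + t) ^ (u - 1) * (1 + t) ^ (-(u + v)) := by
          gcongr
          linarith
      _ = (1 + t) ^ (-1 - v) := by rw [← Real.rpow_add (by linarith)]; ring_nf
      _ ≤ (1 + t) ^ (-2 : ℝ) := Real.rpow_le_rpow_of_exponent_le (by linarith) (by linarith)
  rw [h1, h2] at h3
  norm_num at h3
  rw [show -1 - (u - 1) - (-v + -u) = v by ring] at h3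
  rwa [div_le_one (Real.Gamma_pos_of_pos (by linarith))] at h3

theorem NoSmallDivisors.exists_inv_pow_le {βp βm : ℝ} (h : NoSmallDivisors βp βm) :
    ∃ E : ℝ, 1 ≤ E ∧ ∀ m n : ℕ, 1 ≤ m → 1 ≤ n → ∀ k : ℤ,
      (E ^ (m + n))⁻¹ ≤ |βp * m + βm * n - k| := by
  obtain ⟨c, K, hc, h⟩ := h
  -- As m + n ≥ 1, the constant c can be moved into the base of the power: E = max(1, 1/c) e^{|K|}.
  have hE : 1 ≤ max 1 c⁻¹ * Real.exp |K| :=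
    one_le_mul_of_one_le_of_one_le (le_max_left _ _) (Real.one_le_exp (abs_nonneg K))
  refine ⟨_, hE, fun m n hm hn k => ?_⟩
  refine le_trans ?_ (by simpa only [mul_comm] using h m n hm hn k)
  rw [mul_pow, mul_inv, ← Real.exp_nat_mul, ← Real.exp_neg]
  refine mul_le_mul ?_ (Real.exp_le_exp.2 ?_) (Real.exp_pos _).le hc.le
  · refine inv_le_of_inv_le₀ hc ?_
    exact (le_max_right 1 c⁻¹).trans (le_self_pow₀ (le_max_left _ _) (by omega))
  · push_cast
    have : K * ((m : ℝ) + n) ≤ |K| * ((m : ℝ) + n) := by gcongr; exact le_abs_self K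
    linarith

theorem NoSmallDivisors.swap {βp βm : ℝ} (h : NoSmallDivisors βp βm) : NoSmallDivisors βm βp := by
  obtain ⟨c, K, hc, h⟩ := h
  refine ⟨c, K, hc, fun m n hm hn k => ?_⟩
  rw [add_comm (m : ℝ), add_comm ((m : ℝ) * βm)]
  exact h n m hn hm k

/-- Replacing L + s by s decreases the integrand. Thus the Gamma factor left over in the regular
part is bounded by an integral whose series is already known to converge. -/
theorem Gamma_one_add_mul_rpow_le_laplaceInt {βp βm L x : ℝ} (hβp : βp ∈ Ioo (0 : ℝ) 1)
    (hβm : βm ∈ Ioo (0 : ℝ) 1) (hL : 0 < L) (hx : 0 < x) (n₂ n₃ : ℕ) :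
    Real.Gamma (1 + (βp * n₂ + βm * n₃)) * x ^ (-1 - (βp * n₂ + βm * n₃)) ≤
      laplaceInt (βp * n₂) (βm * n₃) L x := by
  have hb : 0 ≤ βp * n₂ := mul_nonneg hβp.1.le (Nat.cast_nonneg _)
  have hc : 0 ≤ βm * n₃ := mul_nonneg hβm.1.le (Nat.cast_nonneg _)
  rw [← laplaceInt_zero_right (L := L) (by linarith) hx, laplaceInt, laplaceInt]
  refine integral_mono_of_nonneg ?_ (integrableOn_laplace hβp hβm hL hx (n₂, n₃)) ?_
  · refine (ae_restrict_iff' measurableSet_Ioi).2 (Eventually.of_forall fun s hs => ?_)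
    have hs : 0 < s := hs
    change 0 ≤ _
    positivity
  · refine (ae_restrict_iff' measurableSet_Ioi).2 (Eventually.of_forall fun s hs => ?_)
    have hs : 0 < s := hs
    simp only
    rw [Real.rpow_zero, mul_one, Real.rpow_add hs]
    gcongr
    linarith

theorem abs_inv_Gamma_mul_Gamma_neg_le (b : ℝ) :
    |(Real.Gamma (1 + b) * Real.Gamma (-b))⁻¹| ≤ Real.pi⁻¹ := by
  rw [inv_Gamma_mul_Gamma_neg, abs_neg, abs_div, abs_of_pos Real.pi_pos, div_eq_mul_inv]
  exact mul_le_of_le_one_left (by positivity) (Real.abs_sin_le_one _)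

theorem abs_inv_Gamma_neg_le {c : ℝ} (hc : 0 ≤ c) :
    |(Real.Gamma (-c))⁻¹| ≤ Real.pi⁻¹ * Real.Gamma (1 + c) := by
  have h := abs_inv_Gamma_mul_Gamma_neg_le c
  have h0 : 0 < Real.Gamma (1 + c) := Real.Gamma_pos_of_pos (by linarith)
  rw [mul_inv, abs_mul, abs_of_pos (inv_pos.2 h0), inv_mul_le_iff₀ h0] at h
  linarith

theorem abs_Gamma_neg_le {y δ : ℝ} (hy : 0 < 1 + y) (hδ : 0 < δ) (h : ∀ k : ℤ, δ ≤ |y - k|) :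
    |Real.Gamma (-y)| ≤ Real.pi * δ⁻¹ * (Real.Gamma (1 + y))⁻¹ := by
  have h1 := Real.Gamma_mul_Gamma_one_sub (-y)
  rw [sub_neg_eq_add, mul_neg, Real.sin_neg, div_neg] at h1
  have h2 : |Real.Gamma (-y)| * Real.Gamma (1 + y) = Real.pi / |Real.sin (Real.pi * y)| := by
    rw [← abs_of_pos (Real.Gamma_pos_of_pos hy), ← abs_mul, h1, abs_neg, abs_div,
      abs_of_pos Real.pi_pos]
  rw [← div_eq_mul_inv, le_div_iff₀ (Real.Gamma_pos_of_pos hy), h2, div_eq_mul_inv]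
  have h3 := two_mul_le_abs_sin_pi_mul h
  gcongr
  linarith

/-! ### Absolute convergence of the triple series -/

section triple

variable {αp βp lp αm βm lm x : ℝ}

/-- One factor n! from the Pochhammer bound cancels one from the descent of Gamma, leaving the
exponential series in 16 L x, with 16 = 8 · 2 from the two estimates. -/
theorem abs_regular_part_le {b c L δ J : ℝ} {M : ℕ} (hb : 0 ≤ b) (hc : 0 ≤ c) (hcM : c ≤ M)
    (hci : NotInt c) (hL : 0 < L) (hx : 0 < x) (hδ : 0 < δ) (h : ∀ k : ℤ, δ ≤ |b + c - k|)
    (hJ : Real.Gamma (1 + (b + c)) * x ^ (-1 - (b + c)) ≤ J) (n : ℕ) :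
    |(-1) ^ n / n.factorial * (Real.Gamma (1 - n + b + c) * gammaQuot (-c) n * L ^ n *
      x ^ (-1 + n - b - c))| ≤ (16 * L * x) ^ n / n.factorial * ((δ⁻¹) ^ 2 * 2 ^ M * J) := by
  have h1 := abs_Gamma_one_add_sub_le (by linarith) hδ h n
  have h2 := abs_gammaQuot_neg_le hci hc hcM n
  have hG : 0 < Real.Gamma (1 + (b + c)) := Real.Gamma_pos_of_pos (by linarith)
  have e1 : x ^ (-1 + (n : ℝ) - b - c) = x ^ (-1 - (b + c)) * x ^ n := by
    rw [← Real.rpow_natCast x n, ← Real.rpow_add hx]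
    congr 1
    ring
  rw [show 1 - (n : ℝ) + b + c = 1 + (b + c) - n by ring, e1, abs_mul, abs_div, abs_pow, abs_neg,
    abs_one, one_pow, Nat.abs_cast, abs_mul, abs_mul, abs_mul, abs_of_pos (pow_pos hL n),
    abs_of_pos (by positivity : 0 < x ^ (-1 - (b + c)) * x ^ n)]
  calc 1 / (n.factorial : ℝ) * (|Real.Gamma (1 + (b + c) - n)| * |gammaQuot (-c) n| * L ^ n *
        (x ^ (-1 - (b + c)) * x ^ n))
      ≤ 1 / (n.factorial : ℝ) * ((δ⁻¹ ^ 2 * 8 ^ n / n.factorial * Real.Gamma (1 + (b + c))) *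
        (2 ^ (M + n) * n.factorial) * L ^ n * (x ^ (-1 - (b + c)) * x ^ n)) := by gcongr
    _ = (16 * L * x) ^ n / n.factorial * (δ⁻¹ ^ 2 * 2 ^ M *
        (Real.Gamma (1 + (b + c)) * x ^ (-1 - (b + c)))) := by
      rw [mul_pow, mul_pow, show (16 : ℝ) = 8 * 2 by norm_num, mul_pow, pow_add]
      field_simp
    _ ≤ _ := by gcongr

/-- Reflection turns the two Gamma values at negative arguments into δ⁻¹ Γ(1+c) / Γ(2+n+b+c), up to
a constant; submultiplicativity of Gamma then cancels all Gamma factors. Shifting by 1 + n does not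
change the distance to the integers. -/
theorem abs_singular_part_le {b c L δ : ℝ} (hb : 0 ≤ b) (hc : 0 ≤ c)
    (hL : 0 < L) (hx : 0 < x) (hδ : 0 < δ) (h : ∀ k : ℤ, δ ≤ |b + c - k|) (n : ℕ) :
    |(-1) ^ n / n.factorial * (Real.Gamma (-1 - n - b - c) * Real.Gamma (1 + n + b) *
      (Real.Gamma (-c))⁻¹ * L ^ (1 + n + b + c) * x ^ n)| ≤
        (L * x) ^ n / n.factorial * (δ⁻¹ * (L * (L ^ b * L ^ c))) := by
  have hn : (0 : ℝ) ≤ n := Nat.cast_nonneg n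
  have h1 := abs_Gamma_neg_le (y := 1 + n + b + c) (by linarith) hδ fun k => by
    have := h (k - 1 - n)
    push_cast at this
    rwa [show b + c - ((k : ℝ) - 1 - n) = 1 + n + b + c - k by ring] at this
  have h2 := abs_inv_Gamma_neg_le hc
  have h3 := Gamma_mul_Gamma_le (u := 1 + n + b) (v := 1 + c) (by linarith) (by linarith)
  have e1 : L ^ (1 + (n : ℝ) + b + c) = L * (L ^ b * L ^ c) * L ^ n := by
    rw [← Real.rpow_natCast L n, ← Real.rpow_add hL, Real.rpow_add hL, Real.rpow_add hL,
      Real.rpow_add hL, Real.rpow_add hL, Real.rpow_one]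
    ring
  have hG : 0 < Real.Gamma (1 + (1 + n + b + c)) := Real.Gamma_pos_of_pos (by linarith)
  have hG' : 0 < Real.Gamma (1 + n + b) := Real.Gamma_pos_of_pos (by linarith)
  rw [show (1 : ℝ) + n + b + (1 + c) = 1 + (1 + n + b + c) by ring] at h3
  rw [show -1 - (n : ℝ) - b - c = -(1 + n + b + c) by ring, e1, abs_mul, abs_div, abs_pow, abs_neg,
    abs_one, one_pow, Nat.abs_cast, abs_mul, abs_mul, abs_mul, abs_mul, abs_of_pos (pow_pos hx n),
    abs_of_pos hG', abs_of_pos (by positivity : 0 < L * (L ^ b * L ^ c) * L ^ n)]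
  calc 1 / (n.factorial : ℝ) * (|Real.Gamma (-(1 + n + b + c))| * Real.Gamma (1 + n + b) *
        |(Real.Gamma (-c))⁻¹| * (L * (L ^ b * L ^ c) * L ^ n) * x ^ n)
      ≤ 1 / (n.factorial : ℝ) * ((Real.pi * δ⁻¹ * (Real.Gamma (1 + (1 + n + b + c)))⁻¹) *
        Real.Gamma (1 + n + b) * (Real.pi⁻¹ * Real.Gamma (1 + c)) *
          (L * (L ^ b * L ^ c) * L ^ n) * x ^ n) := by gcongr
    _ = (L * x) ^ n / n.factorial * (δ⁻¹ * (L * (L ^ b * L ^ c))) *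
        (Real.Gamma (1 + n + b) * Real.Gamma (1 + c) / Real.Gamma (1 + (1 + n + b + c))) := by
      rw [mul_pow]
      have := Real.pi_pos
      field_simp
    _ ≤ _ := mul_le_of_le_one_right (by positivity) ((div_le_one hG).2 h3)

theorem summable_tsTerm (hβm' : Irrational βm) (hE : NoSmallDivisors βp βm)
    (hβp : βp ∈ Ioo (0 : ℝ) 1) (hβm : βm ∈ Ioo (0 : ℝ) 1) (hlp : 0 < lp) (hlm : 0 < lm)
    (hx : 0 < x) :
    Summable fun n : ℕ × ℕ × ℕ => tsTerm αp βp lp αm βm lm x n.1 n.2.1 n.2.2 := by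
  obtain ⟨E, hE1, hE⟩ := hE.exists_inv_pow_le
  have hE0 : 0 < E := by linarith
  set L := lp + lm with hLdef
  have hL : 0 < L := by positivity
  set ap := tsA αp βp
  set am := tsA αm βm
  -- Majorants in (n₂, n₃) with δ⁻¹ = E^{n₂+n₃}: the regular part costs δ⁻² and a further 2^{n₃}
  -- from βm n₃ ≤ n₃, the singular part only δ⁻¹.
  set M₁ : ℕ × ℕ → ℝ := fun n => (|ap| * E ^ 2) ^ n.1 / n.1.factorial *
    ((|am| * E ^ 2 * 2) ^ n.2 / n.2.factorial) * laplaceInt (βp * n.1) (βm * n.2) L x with hM₁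
  set M₂ : ℕ × ℕ → ℝ := fun n => (|ap| * E * L ^ βp) ^ n.1 / n.1.factorial *
    ((|am| * E * L ^ βm) ^ n.2 / n.2.factorial) * L with hM₂
  have hM₁0 : ∀ n, 0 ≤ M₁ n := fun n =>
    mul_nonneg (by positivity) (laplaceInt_nonneg _ _ hL)
  have hM₂0 : ∀ n, 0 ≤ M₂ n := fun n => by positivity
  have s₁ : Summable M₁ := summable_laplaceInt (by positivity) (by positivity) hβp hβm hL hx
  have s₂ : Summable M₂ := (hasSum_exp_mul_exp _ _).summable.mul_right L
  have t₁ : Summable fun n : ℕ × ℕ × ℕ => (16 * L * x) ^ n.1 / n.1.factorial * M₁ n.2 :=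
    (Real.summable_pow_div_factorial _).mul_of_nonneg s₁ (fun n => by positivity) hM₁0
  have t₂ : Summable fun n : ℕ × ℕ × ℕ => (L * x) ^ n.1 / n.1.factorial * M₂ n.2 :=
    (Real.summable_pow_div_factorial _).mul_of_nonneg s₂ (fun n => by positivity) hM₂0
  refine Summable.of_norm_bounded (t₁.add t₂) ?_
  rintro ⟨n₁, n₂, n₃⟩
  simp only [Real.norm_eq_abs]
  have hr0 : 0 ≤ (16 * L * x) ^ n₁ / n₁.factorial * M₁ (n₂, n₃) :=
    mul_nonneg (by positivity) (hM₁0 _)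
  have hs0 : 0 ≤ (L * x) ^ n₁ / n₁.factorial * M₂ (n₂, n₃) :=
    mul_nonneg (by positivity) (hM₂0 _)
  have hρ : |(Real.Gamma (1 + βp * n₂) * Real.Gamma (-(βp * n₂)))⁻¹| ≤ 1 :=
    (abs_inv_Gamma_mul_Gamma_neg_le _).trans (inv_le_one_of_one_le₀ (by linarith [Real.pi_gt_three]))
  rcases Nat.eq_zero_or_pos n₂ with rfl | h2
  · rw [tsTerm_zero_mid, abs_zero]
    positivity
  have hb : 0 ≤ βp * n₂ := mul_nonneg hβp.1.le (Nat.cast_nonneg _)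
  rcases Nat.eq_zero_or_pos n₃ with rfl | h3
  · rw [tsTerm_zero_right]
    split_ifs with h1
    · subst h1
      refine le_trans ?_ (le_add_of_nonneg_right hs0)
      rw [← laplaceInt_zero_right (L := L) (by linarith) hx, abs_mul, abs_mul, abs_div, abs_pow,
        abs_neg, Nat.abs_cast, abs_of_nonneg (laplaceInt_nonneg _ _ hL)]
      simp only [hM₁, pow_zero, Nat.factorial_zero, Nat.cast_one, div_one, one_mul, mul_one,
        Nat.cast_zero, mul_zero]
      refine mul_le_mul_of_nonneg_right ?_ (laplaceInt_nonneg _ _ hL)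
      refine (mul_le_of_le_one_right (by positivity) hρ).trans ?_
      gcongr
      exact le_mul_of_one_le_right (abs_nonneg _) (one_le_pow₀ hE1)
    · rw [abs_zero]
      positivity
  have hc : 0 ≤ βm * n₃ := mul_nonneg hβm.1.le (Nat.cast_nonneg _)
  have hδ : 0 < (E ^ (n₂ + n₃))⁻¹ := by positivity
  have hirr : Irrational (βm * n₃) := hβm'.mul_natCast h3.ne'
  have hr := abs_regular_part_le hb hc (mul_le_of_le_one_left (Nat.cast_nonneg n₃) hβm.2.le)
    (fun k hk => hirr.ne_int k hk) hL hx hδ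
    (hE n₂ n₃ h2 h3) (Gamma_one_add_mul_rpow_le_laplaceInt hβp hβm hL hx n₂ n₃) n₁
  have hs := abs_singular_part_le hb hc hL hx hδ (hE n₂ n₃ h2 h3) n₁
  rw [inv_inv] at hr hs
  rw [tsTerm_eq, ← hLdef, mul_add ((-1) ^ n₁ / (n₁.factorial : ℝ))]
  rw [abs_mul, abs_mul, abs_mul, abs_div, abs_div, abs_pow, abs_pow, abs_neg, abs_neg, Nat.abs_cast,
    Nat.abs_cast]
  refine (mul_le_mul (mul_le_of_le_one_right (by positivity) hρ)
    ((abs_add_le _ _).trans (add_le_add hr hs)) (abs_nonneg _) (by positivity)).trans ?_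
  rw [mul_add]
  refine add_le_add (le_of_eq ?_) (le_of_eq ?_)
  · simp only [hM₁]
    rw [mul_pow, mul_pow, mul_pow, pow_add]
    ring
  · simp only [hM₂]
    rw [mul_pow, mul_pow, mul_pow, mul_pow, pow_add, Real.rpow_mul_natCast hL.le,
      Real.rpow_mul_natCast hL.le]
    ring

/-- A summable triple series has the same sum as the iterated series. -/
theorem HasIteratedSum.hasTripleSum {t : ℕ → ℕ → ℕ → ℝ} {T : ℝ} (h : HasIteratedSum t T)
    (hs : Summable fun n : ℕ × ℕ × ℕ => t n.1 n.2.1 n.2.2) : HasTripleSum t T := by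
  obtain ⟨S, h1, h2⟩ := h
  have h3 := (Equiv.prodComm (ℕ × ℕ) ℕ).hasSum_iff.2 hs.hasSum
  have h4 := h3.prod_fiberwise (g := S) fun n => h1 n.1 n.2
  rw [HasTripleSum, h2.unique h4]
  exact hs.hasSum

end triple

/-! ### Reflection and assembly -/

section density

variable {αp βp lp αm βm lm : ℝ} {μ : Measure ℝ}

theorem charFun_map_neg (μ : Measure ℝ) (u : ℝ) :
    charFun (μ.map fun x => -x) u = charFun μ (-u) := by
  simpa using charFun_map_mul (μ := μ) (-1) u

/-- The law of -Y has the two triples of parameters exchanged; this reduces the negative half-line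
to the positive one. -/
theorem IsTS.exists_swap (h : IsTS αp βp lp αm βm lm μ) :
    ∃ ν : Measure ℝ, IsTS αm βm lm αp βp lp ν ∧ ∀ u, charFun ν u = charFun μ (-u) := by
  obtain ⟨μp, μm, hp, ⟨ρ, hρ, rfl⟩, rfl⟩ := h
  have := hp.isProb
  have := hρ.isProb
  have : IsProbabilityMeasure (ρ.map fun x => -x) :=
    Measure.isProbabilityMeasure_map (by fun_prop)
  have : IsProbabilityMeasure (μp.map fun x => -x) :=
    Measure.isProbabilityMeasure_map (by fun_prop)
  refine ⟨ρ.conv (μp.map fun x => -x), ⟨ρ, _, hρ, ⟨μp, hp, rfl⟩, rfl⟩, fun u => ?_⟩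
  rw [charFun_conv, charFun_conv, charFun_map_neg, charFun_map_neg, neg_neg, mul_comm]

theorem IsTS.fourier_inversion_eq (h : IsTS αp βp lp αm βm lm μ) (hαp : 0 < αp)
    (hβp : βp ∈ Ioo (0 : ℝ) 1) (hlp : 0 < lp) (hαm : 0 < αm) (hβm : βm ∈ Ioo (0 : ℝ) 1)
    (hlm : 0 < lm) {x : ℝ} (hx : 0 < x) :
    (2 * Real.pi : ℂ)⁻¹ * ∫ u : ℝ, Complex.exp (-(Complex.I * u * x)) * charFun μ u =
      ((Real.exp (tsGamma αp βp lp αm βm lm - lp * x) *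
        -(Real.pi⁻¹ * ∫ s in Ioi (0 : ℝ),
          (tsF (tsA αp βp) βp (tsA αm βm) βm (lp + lm) x (-(s : ℂ))).im) : ℝ) : ℂ) := by
  simp only [h.exp_mul_charFun hβp hlp hβm hlm]
  rw [integral_const_mul, integral_tsF_vertical hx (tsA_pos hαp hβp).le (tsA_pos hαm hβm) hβp hβm
    hlp hlm]
  generalize ∫ s in Ioi (0 : ℝ), (tsF (tsA αp βp) βp (tsA αm βm) βm (lp + lm) x (-(s : ℂ))).im = J
  push_cast
  have : (Real.pi : ℂ) ≠ 0 := Complex.ofReal_ne_zero.2 Real.pi_pos.ne'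
  field_simp

theorem IsTS.hasSum_series (hαp : 0 < αp)
    (hβp : βp ∈ Ioo (0 : ℝ) 1) (hlp : 0 < lp) (hαm : 0 < αm) (hβm : βm ∈ Ioo (0 : ℝ) 1)
    (hβm' : Irrational βm) (hlm : 0 < lm)
    (hβ : ∀ m n : ℕ, 1 ≤ m → 1 ≤ n → ∀ k : ℤ, (m : ℝ) * βp + n * βm ≠ k)
    (h : IsTS αp βp lp αm βm lm μ) {x y : ℝ} (hx : 0 < x)
    (hy : (y : ℂ) = (2 * Real.pi : ℂ)⁻¹ *
      ∫ u : ℝ, Complex.exp (-(Complex.I * u * x)) * charFun μ u) :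
    ∃ T : ℝ, HasIteratedSum (tsTerm αp βp lp αm βm lm x) T ∧
      (NoSmallDivisors βp βm → HasTripleSum (tsTerm αp βp lp αm βm lm x) T) ∧
        y = Real.exp (tsGamma αp βp lp αm βm lm - lp * x) * T := by
  have hit : HasIteratedSum (tsTerm αp βp lp αm βm lm x) _ :=
    ⟨tsInner αp βp lp αm βm lm x, hasSum_tsTerm hβm' hβ hβp.1 hβm.1 hlp hlm hx,
      hasSum_tsInner hβp hβm hlp hlm hx⟩
  refine ⟨_, hit, fun hE => hit.hasTripleSum (summable_tsTerm hβm' hE hβp hβm hlp hlm hx), ?_⟩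
  rw [h.fourier_inversion_eq hαp hβp hlp hαm hβm hlm hx] at hy
  exact Complex.ofReal_injective hy

end density

end TemperedStable

theorem mainTheorem1 (αp βp lp αm βm lm : ℝ)
    (hαp : 0 < αp) (hlp : 0 < lp) (hβp : βp ∈ Set.Ioo (0 : ℝ) 1) (hβp' : Irrational βp)
    (hαm : 0 < αm) (hlm : 0 < lm) (hβm : βm ∈ Set.Ioo (0 : ℝ) 1) (hβm' : Irrational βm)
    (hβ : ∀ m n : ℕ, 1 ≤ m → 1 ≤ n → ∀ k : ℤ, (m : ℝ) * βp + n * βm ≠ k)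
    (μ : MeasureTheory.Measure ℝ) (hμ : IsTS αp βp lp αm βm lm μ) :
    ∃ f : ℝ → ℝ, IsContinuousDensity μ f ∧
      (∀ x : ℝ, 0 < x → ∃ T : ℝ,
        HasIteratedSum (tsTerm αp βp lp αm βm lm x) T ∧
        (NoSmallDivisors βp βm → HasTripleSum (tsTerm αp βp lp αm βm lm x) T) ∧
        f x = Real.exp (tsGamma αp βp lp αm βm lm - lp * x) * T) ∧
      (∀ x : ℝ, x < 0 → ∃ T : ℝ,
        HasIteratedSum (tsTerm αm βm lm αp βp lp (-x)) T ∧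
        (NoSmallDivisors βp βm → HasTripleSum (tsTerm αm βm lm αp βp lp (-x)) T) ∧
        f x = Real.exp (tsGamma αm βm lm αp βp lp - lm * (-x)) * T) := by
  have := hμ.isProbabilityMeasure
  obtain ⟨f, hf, hfx⟩ := exists_continuousDensity μ
    (hμ.integrable_charFun hαp hβp hlp hαm hβm hlm)
  refine ⟨f, hf, fun x hx => ?_, fun x hx => ?_⟩
  · exact IsTS.hasSum_series hαp hβp hlp hαm hβm hβm' hlm hβ hμ hx (hfx x)
  · obtain ⟨ν, hν, hνc⟩ := hμ.exists_swap
    have hβs : ∀ m n : ℕ, 1 ≤ m → 1 ≤ n → ∀ k : ℤ, (m : ℝ) * βm + n * βp ≠ k :=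
      fun m n hm hn k => by
        rw [add_comm]
        exact hβ n m hn hm k
    obtain ⟨T, h1, h2, h3⟩ := IsTS.hasSum_series (x := -x) (y := f x) hαm hβm hlm hαp hβp hβp' hlp
      hβs hν (by linarith) (by
        -- The substitution u → -u turns the inversion integral of μ at x into that of the reflected
        -- law at -x.
        rw [hfx x, ← integral_neg_eq_self]
        simp [hνc])
    exact ⟨T, h1, fun hE => h2 hE.swap, h3⟩
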